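/- Let $(M,g)$ be a closed (that is, compact, connected, Hausdorff, without boundary) smooth Riemannian manifold of dimension $n$ without conjugate points, i.e. for every $x\in M$ the exponential map $\exp_x\colon T_xM\to M$ has invertible differential at every point of $T_xM$. Suppose that the fundamental group $\pi_1(M)$ is residually finite, i.e. the intersection of its finite index subgroups is trivial. Then for every real number $R>0$ there are a closed connected smooth Riemannian manifold $N$ of dimension $n$ and a surjective covering map $p\colon N\to M$ with finite fibres which is smooth and locally isometric (its differential preserves the Riemannian metrics), such that the injectivity radius of $N$ is at least $R$. Here the injectivity radius of $N$ is the infimum over $q\in N$ of the supremum of the radii $r\geq 0$ such that $\exp_q$ restricts to a diffeomorphism from the open ball of radius $r$ about $0$ in $T_qN$ onto an open subset of $N$. -/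

import Mathlib

open scoped Manifold ContDiff NNReal ENNReal

universe u

noncomputable section

namespace RiemGeom

/-- A smooth Riemannian metric on a smooth `n`-dimensional manifold without boundary. -/
abbrev Metric (n : ℕ) (M : Type u) [TopologicalSpace M]
    [ChartedSpace (EuclideanSpace ℝ (Fin n)) M] [IsManifold (𝓡 n) ∞ M] :=
  Bundle.ContMDiffRiemannianMetric (𝓡 n) ∞ (EuclideanSpace ℝ (Fin n))
    (fun x : M => TangentSpace (𝓡 n) x)

section

variable {n : ℕ} {M : Type u} [TopologicalSpace M]
  [ChartedSpace (EuclideanSpace ℝ (Fin n)) M] [IsManifold (𝓡 n) ∞ M]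

/-- The metric in the local coordinates of the chart `e`: the pullback of `g` under `e.symm`
at the coordinate point `y`, evaluated at the coordinate vectors `u` and `v`. -/
def coordMetric (g : Metric n M) (e : OpenPartialHomeomorph M (EuclideanSpace ℝ (Fin n)))
    (y u v : EuclideanSpace ℝ (Fin n)) : ℝ :=
  g.inner (e.symm y) (mfderiv 𝓘(ℝ, EuclideanSpace ℝ (Fin n)) (𝓡 n) e.symm y u)
    (mfderiv 𝓘(ℝ, EuclideanSpace ℝ (Fin n)) (𝓡 n) e.symm y v)

/-- The Christoffel symbols of the first kind of the Levi-Civita connection in the chart `e`: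
`Γ(u, v; w) = (∂_u g(v, w) + ∂_v g(u, w) - ∂_w g(u, v)) / 2` for constant coordinate vectors
`u`, `v`, `w`, that is, the value of `g (∇_u v, w)`. -/
def christoffel (g : Metric n M) (e : OpenPartialHomeomorph M (EuclideanSpace ℝ (Fin n)))
    (y u v w : EuclideanSpace ℝ (Fin n)) : ℝ :=
  (fderiv ℝ (fun z => coordMetric g e z v w) y u
    + fderiv ℝ (fun z => coordMetric g e z u w) y v
    - fderiv ℝ (fun z => coordMetric g e z u v) y w) / 2

/-- A (complete, affinely parametrized) geodesic `c : ℝ → M`: a `C²` curve which satisfies the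
geodesic equation `∇_{c'} c' = 0` in every chart `e`. The equation for `x = e ∘ c` is paired with an
arbitrary coordinate vector `w`, which is equivalent since the metric is nondegenerate. -/
def IsGeodesic (g : Metric n M) (c : ℝ → M) : Prop :=
  ContMDiff 𝓘(ℝ, ℝ) (𝓡 n) 2 c ∧
    ∀ e ∈ atlas (EuclideanSpace ℝ (Fin n)) M, ∀ t : ℝ, c t ∈ e.source →
      ∀ w : EuclideanSpace ℝ (Fin n),
        coordMetric g e (e (c t)) (deriv (deriv (fun s => e (c s))) t) w
          + christoffel g e (e (c t)) (deriv (fun s => e (c s)) t)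
              (deriv (fun s => e (c s)) t) w = 0

/-- The initial velocity of a curve, as a point of the tangent bundle. -/
def initialVelocity (c : ℝ → M) : TangentBundle (𝓡 n) M :=
  ⟨c 0, mfderiv 𝓘(ℝ, ℝ) (𝓡 n) c 0 (1 : ℝ)⟩

open Classical in
/-- The exponential map `exp_p : T_p M → M`, where `T_p M` is identified with the model space as
usual in Mathlib: `exp_p v = c 1`, where `c` is the geodesic with initial velocity `(p, v)`.
On a geodesically complete Hausdorff manifold (in particular on a closed one) this geodesic exists
and is unique; the value `p` for vectors without such a geodesic is a placeholder. -/
def expMap (g : Metric n M) (p : M) (v : EuclideanSpace ℝ (Fin n)) : M :=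
  if h : ∃ c : ℝ → M, IsGeodesic g c ∧
      initialVelocity c = ⟨p, v⟩
  then h.choose 1 else p

/-- `(M, g)` (complete) has no conjugate points: every exponential map `exp_p` is nonsingular, i.e.
its differential is injective at each `v ∈ T_p M`. -/
def NoConjugatePoints (g : Metric n M) : Prop :=
  ∀ (p : M) (v : EuclideanSpace ℝ (Fin n)),
    Function.Injective (mfderiv 𝓘(ℝ, EuclideanSpace ℝ (Fin n)) (𝓡 n) (expMap g p) v)

/-- The open ball of radius `r` about `0` in `T_p M`, for the inner product `g_p`. -/
def tangentBall (g : Metric n M) (p : M) (r : ℝ≥0) : Set (EuclideanSpace ℝ (Fin n)) :=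
  {v | Real.sqrt (g.inner p v v) < r}

/-- `exp_p` restricts to a diffeomorphism from the open ball of radius `r` in `T_p M` onto an open
subset of `M`. -/
def ExpIsDiffeoOnBall (g : Metric n M) (p : M) (r : ℝ≥0) : Prop :=
  ∃ Φ : PartialDiffeomorph 𝓘(ℝ, EuclideanSpace ℝ (Fin n)) (𝓡 n)
      (EuclideanSpace ℝ (Fin n)) M ∞,
    Φ.source = tangentBall g p r ∧ Set.EqOn (expMap g p) Φ (tangentBall g p r)

/-- The injectivity radius at `p` of a complete manifold: the supremum of the radii `r` such that
`exp_p` is a diffeomorphism on the open ball of radius `r` in `T_p M`. -/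
def injectivityRadiusAt (g : Metric n M) (p : M) : ℝ≥0∞ :=
  sSup {ρ : ℝ≥0∞ | ∃ r : ℝ≥0, ρ = r ∧ ExpIsDiffeoOnBall g p r}

/-- The injectivity radius of a complete Riemannian manifold: the infimum over all points. -/
def injectivityRadius (g : Metric n M) : ℝ≥0∞ :=
  ⨅ p : M, injectivityRadiusAt g p

/-- A local isometry between Riemannian manifolds of equal dimension: a smooth map whose
differential preserves the metrics. (By the inverse function theorem it is a local
diffeomorphism.) -/
def IsLocalIsometry {N : Type u} [TopologicalSpace N]
    [ChartedSpace (EuclideanSpace ℝ (Fin n)) N] [IsManifold (𝓡 n) ∞ N]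
    (gN : Metric n N) (gM : Metric n M) (f : N → M) : Prop :=
  ContMDiff (𝓡 n) (𝓡 n) ∞ f ∧
    ∀ (x : N) (u v : TangentSpace (𝓡 n) x),
      gM.inner (f x) (mfderiv (𝓡 n) (𝓡 n) f x u) (mfderiv (𝓡 n) (𝓡 n) f x v) = gN.inner x u v

end

end RiemGeom

end

/-!
The exponential map `f = exp_{x₀} : ℝⁿ → M` of a closed manifold without conjugate points is the
universal covering (Hadamard–Cartan). Indeed it is a local diffeomorphism, and by the Gauss lemma a
lift through `f` of a curve of speed at most `L` moves away from the origin at speed at most `L` in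
the norm of `g_{x₀}` (`tnorm_lift_le`). Hence the lifts stay in compact sets, segments in charts
can be lifted, and `f` is a covering map (`isCoveringMap_expMap`).

The deck group of `f` is anti-isomorphic to `π₁(M)`, so it is residually finite. Let `B` be the
closed ball of radius `r₀ + R` about the origin, where the ball of radius `r₀` is already mapped
onto `M`. Only finitely many deck transformations `γ` satisfy `γ B ∩ B ≠ ∅`, so there is a normal
subgroup `H` of finite index which contains none of them but the identity; `N = ℝⁿ / H` is then a
finite covering of `M` into which every deck translate of `B` embeds (`exists_finite_covering`).
It carries the manifold structure and the metric that are pulled back from `M` (`CoverSpace`,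
`coverMetric`).

Finally, `exp_q` for `q ∈ N` lifts to a continuous map `Ψ : ℝⁿ → ℝⁿ` with `f ∘ Ψ = exp_{p q}`. Both
`f` and `exp_{p q}` are universal coverings, so `Ψ` is injective. After a deck transformation
`Ψ 0` lies in the ball of radius `r₀`, and then `Ψ` maps the ball of radius `R` into `B`, by the
bound on lifts of geodesics. Since `B` embeds into `N`, `exp_q` is injective on the ball of radius
`R` (`injOn_expMap_of_covering`), and a nonsingular injective map is a diffeomorphism onto an open
set.

What has to be provided on the way is the smoothness and global existence of the geodesic flow. The
flow of a smooth vector field depends smoothly on the initial value by the implicit function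
theorem in a space of continuous curves. The geodesic equation is transported between charts, and
through local isometries and local diffeomorphisms, by the invariance of the Euler–Lagrange
equation of the energy.
-/

noncomputable section

namespace RiemGeom

set_option maxSynthPendingDepth 3
set_option linter.unusedSectionVars false

open Set Filter Topology

/-! ### Smooth dependence of solutions of ordinary differential equations on the initial value -/

section ODE

/-- Pointwise application of a continuous family of linear maps to a continuous function. -/
def pointwiseApply (K V W : Type*) [TopologicalSpace K] [CompactSpace K]
    [NormedAddCommGroup V] [NormedSpace ℝ V] [NormedAddCommGroup W] [NormedSpace ℝ W] :
    C(K, V →L[ℝ] W) →L[ℝ] C(K, V) →L[ℝ] C(K, W) :=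
  LinearMap.mkContinuous₂
    (LinearMap.mk₂ ℝ (fun (A : C(K, V →L[ℝ] W)) (β : C(K, V)) =>
        (⟨fun t => A t (β t), A.continuous.clm_apply β.continuous⟩ : C(K, W)))
      (fun A A' β => by ext t; simp) (fun c A β => by ext t; simp)
      (fun A β β' => by ext t; simp) (fun c A β => by ext t; simp)) 1
    (fun A β => by
      rw [ContinuousMap.norm_le _ (by positivity)]
      intro t
      calc ‖A t (β t)‖ ≤ ‖A t‖ * ‖β t‖ := (A t).le_opNorm _
        _ ≤ 1 * ‖A‖ * ‖β‖ := by
          rw [one_mul]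
          exact mul_le_mul (A.norm_coe_le_norm t) (β.norm_coe_le_norm t) (norm_nonneg _)
            (norm_nonneg A))

/-- The derivative of `α ↦ f ∘ α` on a space of continuous functions is pointwise application
of `f' ∘ α`. -/
lemma hasFDerivAt_postcomp {K V W : Type*} [TopologicalSpace K] [CompactSpace K]
    [NormedAddCommGroup V] [NormedSpace ℝ V] [NormedAddCommGroup W] [NormedSpace ℝ W]
    (f : C(V, W)) (f' : C(V, V →L[ℝ] W)) (hf : ∀ x, HasFDerivAt f (f' x) x) (α : C(K, V)) :
    HasFDerivAt (fun α : C(K, V) => f.comp α) (pointwiseApply K V W (f'.comp α)) α := by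
  rw [hasFDerivAt_iff_isLittleO_nhds_zero, Asymptotics.isLittleO_iff]
  intro c hc
  have hU := (isCompact_range α.continuous).uniformContinuousAt_of_continuousAt f'
    (fun a _ => f'.continuous.continuousAt) (Metric.dist_mem_uniformity hc)
  obtain ⟨δ, hδ, hδU⟩ := Metric.mem_uniformity_dist.1 hU
  filter_upwards [Metric.ball_mem_nhds (0 : C(K, V)) hδ] with β hβ
  rw [mem_ball_zero_iff] at hβ
  rw [ContinuousMap.norm_le _ (by positivity)]
  intro t
  have hmv := (convex_ball (α t) δ).norm_image_sub_le_of_norm_hasFDerivWithin_le'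
    (f := f) (f' := f') (φ := f' (α t)) (C := c) (x := α t) (y := α t + β t)
    (fun x _ => (hf x).hasFDerivWithinAt)
    (fun x hx => by
      have := hδU (a := α t) (b := x) (by rw [dist_comm]; exact hx) ⟨t, rfl⟩
      rw [← dist_eq_norm, dist_comm]; exact le_of_lt this)
    (Metric.mem_ball_self hδ)
    (by rw [Metric.mem_ball, dist_eq_norm, add_sub_cancel_left]
        exact (β.norm_coe_le_norm t).trans_lt hβ)
  rw [add_sub_cancel_left] at hmv
  exact hmv.trans (mul_le_mul_of_nonneg_left (β.norm_coe_le_norm t) hc.le)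

/-- Composition with a `C^k` map is a `C^k` operator on spaces of continuous functions. -/
lemma contDiff_postcomp {K : Type*} [TopologicalSpace K] [CompactSpace K] {V : Type u}
    [NormedAddCommGroup V] [NormedSpace ℝ V] (k : ℕ) :
    ∀ {W : Type u} [NormedAddCommGroup W] [NormedSpace ℝ W] (f : C(V, W)),
      ContDiff ℝ k f → ContDiff ℝ k (fun α : C(K, V) => f.comp α) := by
  induction k with
  | zero =>
    intro W _ _ f _
    exact contDiff_zero.2 (ContinuousMap.continuous_postcomp f)
  | succ k ih =>
    intro W _ _ f hf
    push_cast at hf ⊢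
    obtain ⟨f', hf', hff'⟩ := contDiff_succ_iff_hasFDerivAt.1 hf
    let F' : C(V, V →L[ℝ] W) := ⟨f', hf'.continuous⟩
    have hL : ContDiff ℝ k (fun A : C(K, V →L[ℝ] W) => pointwiseApply K V W A) := by fun_prop
    exact contDiff_succ_iff_hasFDerivAt.2 ⟨fun α => pointwiseApply K V W (F'.comp α),
      hL.comp (ih F' hf'), hasFDerivAt_postcomp f F' hff'⟩

variable {V : Type u} [NormedAddCommGroup V] [NormedSpace ℝ V]

lemma continuous_integral_iccExtend (β : C(Icc (-1 : ℝ) 1, V)) :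
    Continuous fun t : ℝ => ∫ s in (0 : ℝ)..t, ContinuousMap.IccExtend (by norm_num) β s :=
  intervalIntegral.continuous_primitive
    (fun a b => (ContinuousMap.IccExtend _ β).continuous.intervalIntegrable a b) 0

variable (V) in
/-- The operator taking a continuous function on `[-1, 1]` to its primitive vanishing at `0`. -/
def primitiveCLM : C(Icc (-1 : ℝ) 1, V) →L[ℝ] C(Icc (-1 : ℝ) 1, V) :=
  LinearMap.mkContinuous
    { toFun := fun β =>
        ⟨fun t => ∫ s in (0 : ℝ)..t, ContinuousMap.IccExtend (by norm_num) β s,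
          (continuous_integral_iccExtend β).comp continuous_subtype_val⟩
      map_add' := fun β β' => by
        ext t
        exact intervalIntegral.integral_add
          ((ContinuousMap.IccExtend _ β).continuous.intervalIntegrable _ _)
          ((ContinuousMap.IccExtend _ β').continuous.intervalIntegrable _ _)
      map_smul' := fun c β => by
        ext t
        exact intervalIntegral.integral_smul c _ } 1
    (fun β => by
      rw [ContinuousMap.norm_le _ (by positivity)]
      intro t
      have ht : |(t : ℝ) - 0| ≤ 1 := by rw [sub_zero]; exact abs_le.2 t.2
      calc ‖∫ s in (0 : ℝ)..t, ContinuousMap.IccExtend (by norm_num) β s‖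
          ≤ ‖β‖ * |(t : ℝ) - 0| := intervalIntegral.norm_integral_le_of_norm_le_const
            (fun s _ => β.norm_coe_le_norm _)
        _ ≤ 1 * ‖β‖ := by rw [one_mul]; exact mul_le_of_le_one_right (norm_nonneg _) ht)

variable (V) in
/-- The inclusion of constant functions. -/
def constCLM : V →L[ℝ] C(Icc (-1 : ℝ) 1, V) :=
  LinearMap.mkContinuous
    { toFun := fun v => ContinuousMap.const _ v
      map_add' := fun _ _ => rfl
      map_smul' := fun _ _ => rfl } 1
    (fun v => by
      rw [ContinuousMap.norm_le _ (by positivity)]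
      intro t
      rw [one_mul]
      exact le_rfl)

/-- Local flow of a globally defined smooth vector field, smooth in the initial value. The
solutions on a rescaled time interval solve an implicit equation in the Banach space
`C([-1, 1], V)`, to which the implicit function theorem applies. -/
lemma exists_flow_of_contDiff [CompleteSpace V] {f : V → V} (k : ℕ) (hk : k ≠ 0)
    (hf : ContDiff ℝ k f)
    (z₀ : V) {U : Set V} (hU : U ∈ 𝓝 z₀) :
    ∃ ε > 0, ∃ Φ : V → ℝ → V, (∀ z ∈ Metric.ball z₀ ε, Φ z 0 = z ∧
      ∀ t ∈ Ioo (-ε) ε, HasDerivAt (Φ z) (f (Φ z t)) t ∧ Φ z t ∈ U) ∧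
      ∀ t ∈ Ioo (-ε) ε, ContDiffOn ℝ k (fun z => Φ z t) (Metric.ball z₀ ε) := by
  let fc : C(V, V) := ⟨f, hf.continuous⟩
  have hN : ContDiff ℝ k (fun α : C(Icc (-1 : ℝ) 1, V) => fc.comp α) := contDiff_postcomp k fc hf
  have hk' : (k : WithTop ℕ∞) ≠ 0 := by exact_mod_cast hk
  -- The zeros `α` of `G ((z, τ), ·)` are the solutions of `α' = τ • f ∘ α`, `α 0 = z`.
  let G : (V × ℝ) × C(Icc (-1 : ℝ) 1, V) → C(Icc (-1 : ℝ) 1, V) := fun x =>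
    x.2 - constCLM V x.1.1 - x.1.2 • primitiveCLM V (fc.comp x.2)
  have hG : ContDiff ℝ k G := by
    refine (contDiff_snd.sub ((constCLM V).contDiff.comp (contDiff_fst.comp contDiff_fst))).sub ?_
    exact (contDiff_snd.comp contDiff_fst).smul
      ((primitiveCLM V).contDiff.comp (hN.comp contDiff_snd))
  -- At `τ = 0` the solutions are constant and the partial derivative of `G` in `α` is the identity.
  let u : (V × ℝ) × C(Icc (-1 : ℝ) 1, V) := ((z₀, 0), constCLM V z₀)
  have hGu : G u = 0 := by simp [G, u]
  have hinv : fderiv ℝ G u ∘L .inr ℝ (V × ℝ) C(Icc (-1 : ℝ) 1, V) = .id ℝ _ := by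
    have h1 : HasFDerivAt (fun α : C(Icc (-1 : ℝ) 1, V) => G (u.1, α))
        (fderiv ℝ G u ∘L .inr ℝ (V × ℝ) C(Icc (-1 : ℝ) 1, V)) u.2 :=
      ((hG.differentiable hk') u).hasFDerivAt.comp u.2 (hasFDerivAt_prodMk_right u.1 u.2)
    have h2 : HasFDerivAt (fun α : C(Icc (-1 : ℝ) 1, V) => G (u.1, α)) (.id ℝ _) u.2 := by
      have : (fun α : C(Icc (-1 : ℝ) 1, V) => G (u.1, α)) = fun α => α - constCLM V z₀ := by
        funext α; simp [G, u]
      rw [this]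
      exact (hasFDerivAt_id _).sub_const _
    exact h1.unique h2
  have hiv : (fderiv ℝ G u ∘L .inr ℝ (V × ℝ) C(Icc (-1 : ℝ) 1, V)).IsInvertible := by
    rw [hinv]; exact ⟨ContinuousLinearEquiv.refl ℝ _, rfl⟩
  have hGa : ContDiffAt ℝ k G u := hG.contDiffAt
  set ψ := hGa.implicitFunction hk' hiv with hψ
  have e1 : ∀ᶠ x in 𝓝 (z₀, (0 : ℝ)), G (x, ψ x) = 0 := by
    have := hGa.eventually_apply_implicitFunction hk' hiv
    rwa [hGu] at this
  have hψc : ContDiffAt ℝ k ψ (z₀, 0) := hGa.contDiffAt_implicitFunction hk' hiv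
  have e2 : ∀ᶠ x in 𝓝 (z₀, (0 : ℝ)), ContDiffAt ℝ k ψ x :=
    hψc.eventually (by exact_mod_cast ENat.natCast_ne_top k)
  have hψ0 : ψ (z₀, 0) = constCLM V z₀ := hGa.implicitFunction_apply_self hk' hiv
  obtain ⟨ρ, hρ, hρU⟩ := Metric.mem_nhds_iff.1 hU
  have e3 : ∀ᶠ x in 𝓝 (z₀, (0 : ℝ)), ψ x ∈ Metric.ball (constCLM V z₀) ρ :=
    hψc.continuousAt.eventually_mem (by rw [hψ0]; exact Metric.ball_mem_nhds _ hρ)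
  obtain ⟨δ, hδ, hδb⟩ := Metric.eventually_nhds_iff.1 ((e1.and e2).and e3)
  have key : ∀ z ∈ Metric.ball z₀ (δ / 2), G ((z, δ / 2), ψ (z, δ / 2)) = 0 ∧
      ContDiffAt ℝ k ψ (z, δ / 2) ∧ ψ (z, δ / 2) ∈ Metric.ball (constCLM V z₀) ρ := by
    intro z hz
    have hd : dist (z, δ / 2) (z₀, (0 : ℝ)) < δ := by
      rw [Prod.dist_eq, max_lt_iff]
      refine ⟨lt_trans hz (half_lt_self hδ), ?_⟩
      rw [Real.dist_eq, sub_zero, abs_of_pos (half_pos hδ)]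
      exact half_lt_self hδ
    exact ⟨(hδb hd).1.1, (hδb hd).1.2, (hδb hd).2⟩
  have hδ2 : 0 < δ / 2 := half_pos hδ
  have hmem : ∀ t ∈ Ioo (-(δ / 2)) (δ / 2), t / (δ / 2) ∈ Ioo (-1 : ℝ) 1 := by
    intro t ht
    constructor
    · rw [lt_div_iff₀ hδ2]; linarith [ht.1]
    · rw [div_lt_iff₀ hδ2]; linarith [ht.2]
  -- Solutions for `τ = δ / 2` on `[-1, 1]` are solutions of the original equation after rescaling.
  refine ⟨δ / 2, hδ2, fun z t => ContinuousMap.IccExtend (by norm_num) (ψ (z, δ / 2))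
    (t / (δ / 2)), ?_, ?_⟩
  · intro z hz
    obtain ⟨hz1, -, hz3⟩ := key z hz
    have heq : ∀ s : ℝ, ∀ hs : s ∈ Icc (-1 : ℝ) 1,
        ContinuousMap.IccExtend (by norm_num) (ψ (z, δ / 2)) s = z + (δ / 2) •
          ∫ r in (0 : ℝ)..s, f (ContinuousMap.IccExtend (by norm_num) (ψ (z, δ / 2)) r) := by
      intro s hs
      have h := congrArg (fun β : C(Icc (-1 : ℝ) 1, V) => β ⟨s, hs⟩) hz1
      have h' : ψ (z, δ / 2) ⟨s, hs⟩ - z - (δ / 2) •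
          ∫ r in (0 : ℝ)..s, f (ContinuousMap.IccExtend (by norm_num) (ψ (z, δ / 2)) r) = 0 := h
      have h2 : ContinuousMap.IccExtend (by norm_num) (ψ (z, δ / 2)) s = ψ (z, δ / 2) ⟨s, hs⟩ :=
        Set.IccExtend_of_mem _ _ hs
      rw [h2, ← sub_eq_zero, ← h', sub_sub]
    refine ⟨?_, fun t ht => ⟨?_, ?_⟩⟩
    · simp only [zero_div]
      rw [heq 0 (by norm_num)]; simp
    · have hs := hmem t ht
      have hcont : Continuous fun r : ℝ =>
          f (ContinuousMap.IccExtend (by norm_num) (ψ (z, δ / 2)) r) :=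
        hf.continuous.comp (ContinuousMap.IccExtend _ _).continuous
      have hd : HasDerivAt (fun s : ℝ => z + (δ / 2) •
          ∫ r in (0 : ℝ)..s, f (ContinuousMap.IccExtend (by norm_num) (ψ (z, δ / 2)) r))
          ((δ / 2) • f (ContinuousMap.IccExtend (by norm_num) (ψ (z, δ / 2)) (t / (δ / 2))))
          (t / (δ / 2)) :=
        ((hcont.integral_hasStrictDerivAt 0 _).hasDerivAt.const_smul _).const_add _
      have hd2 : HasDerivAt (fun s : ℝ => ContinuousMap.IccExtend (by norm_num) (ψ (z, δ / 2)) s)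
          ((δ / 2) • f (ContinuousMap.IccExtend (by norm_num) (ψ (z, δ / 2)) (t / (δ / 2))))
          (t / (δ / 2)) := by
        refine hd.congr_of_eventuallyEq ?_
        filter_upwards [Ioo_mem_nhds hs.1 hs.2] with s hs'
        exact heq s (Ioo_subset_Icc_self hs')
      have hd3 := hd2.scomp t ((hasDerivAt_id t).div_const (δ / 2))
      rw [smul_smul, one_div, inv_mul_cancel₀ hδ2.ne', one_smul] at hd3
      exact hd3
    · apply hρU
      rw [Metric.mem_ball] at hz3 ⊢
      refine lt_of_le_of_lt ?_ hz3
      exact ContinuousMap.dist_apply_le_dist (f := ψ (z, δ / 2)) (g := constCLM V z₀)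
        (Set.projIcc (-1 : ℝ) 1 (by norm_num) (t / (δ / 2)))
  · intro t ht z hz
    have h1 : ContDiffAt ℝ k (fun z : V => ψ (z, δ / 2)) z :=
      (key z hz).2.1.comp z (contDiffAt_id.prodMk contDiffAt_const)
    exact ((ContinuousMap.evalCLM ℝ (Set.projIcc (-1 : ℝ) 1 (by norm_num)
      (t / (δ / 2)))).contDiff.contDiffAt.comp z h1).contDiffWithinAt

/-- Local flow of a smooth vector field, smooth in the initial value. -/
theorem exists_flow [FiniteDimensional ℝ V] {f : V → V} (k : ℕ)
    {z₀ : V} {U : Set V} (hU : U ∈ 𝓝 z₀) (hf : ContDiffOn ℝ ∞ f U) :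
    ∃ ε > 0, ∃ Φ : V → ℝ → V, (∀ z ∈ Metric.ball z₀ ε, Φ z 0 = z ∧
      ∀ t ∈ Ioo (-ε) ε, HasDerivAt (Φ z) (f (Φ z t)) t ∧ Φ z t ∈ U) ∧
      ∀ t ∈ Ioo (-ε) ε, ContDiffOn ℝ k (fun z => Φ z t) (Metric.ball z₀ ε) := by
  have : CompleteSpace V := FiniteDimensional.complete ℝ V
  obtain ⟨ρ, hρ, hρU⟩ := Metric.mem_nhds_iff.1 hU
  -- Multiplying by a bump function makes the vector field globally smooth.
  let χ : ContDiffBump z₀ := ⟨ρ / 3, ρ / 2, by positivity, by linarith⟩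
  have hg : ContDiff ℝ ∞ (fun z => χ z • f z) := by
    rw [contDiff_iff_contDiffAt]
    intro z
    by_cases hz : z ∈ Metric.ball z₀ ρ
    · exact χ.contDiff.contDiffAt.smul
        ((hf.mono hρU).contDiffAt (Metric.isOpen_ball.mem_nhds hz))
    · have hz' : z ∈ (Metric.closedBall z₀ (ρ / 2))ᶜ := by
        intro h
        exact hz (lt_of_le_of_lt (Metric.mem_closedBall.1 h) (half_lt_self hρ))
      refine (contDiffAt_const (c := (0 : V))).congr_of_eventuallyEq ?_
      filter_upwards [Metric.isClosed_closedBall.isOpen_compl.mem_nhds hz'] with y hy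
      have : χ y = 0 := by
        by_contra h
        have : y ∈ Function.support χ := h
        rw [χ.support_eq] at this
        exact hy (Metric.ball_subset_closedBall this)
      rw [this, zero_smul]
  obtain ⟨ε, hε, Φ, h1, h2⟩ := exists_flow_of_contDiff (k + 1) (Nat.succ_ne_zero k)
    (hg.of_le (by exact_mod_cast le_top)) z₀ (Metric.ball_mem_nhds z₀ χ.rIn_pos)
  refine ⟨ε, hε, Φ, fun z hz => ⟨(h1 z hz).1, fun t ht => ?_⟩, fun t ht => (h2 t ht).of_le
    (by exact_mod_cast Nat.le_succ k)⟩
  obtain ⟨hd, hm⟩ := (h1 z hz).2 t ht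
  rw [χ.one_of_mem_closedBall (Metric.ball_subset_closedBall hm), one_smul] at hd
  refine ⟨hd, hρU (Metric.ball_subset_ball ?_ hm)⟩
  change ρ / 3 ≤ ρ
  linarith

end ODE

/-! ### The geodesic equation on an open subset of a vector space -/

section EulerLagrange

variable {E : Type*} [NormedAddCommGroup E] [NormedSpace ℝ E]

/-- The Euler-Lagrange covector `w ↦ G_y(a, w) + Γ_y(v, v; w)` of the metric `G` at the point `y`,
for the velocity `v` and the acceleration `a`. -/
def eulerLagrange (G : E → E → E → ℝ) (y a v w : E) : ℝ :=
  G y a w + (fderiv ℝ (fun z => G z v w) y v + fderiv ℝ (fun z => G z v w) y v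
    - fderiv ℝ (fun z => G z v v) y w) / 2

lemma hasFDerivAt_clm_apply₂ {G : E → E →L[ℝ] E →L[ℝ] ℝ} {y : E} (hG : DifferentiableAt ℝ G y)
    (v w : E) :
    HasFDerivAt (fun z => G z v w) (((fderiv ℝ G y).flip v).flip w) y :=
  (hG.hasFDerivAt.clm_apply (hasFDerivAt_const v y)).clm_apply (hasFDerivAt_const w y) |>.congr_fderiv
    (by ext u; simp)

lemma fderiv_clm_apply₂ {G : E → E →L[ℝ] E →L[ℝ] ℝ} {y : E} (hG : DifferentiableAt ℝ G y)
    (u v w : E) :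
    fderiv ℝ (fun z => G z v w) y u = fderiv ℝ G y u v w := by
  rw [(hasFDerivAt_clm_apply₂ hG v w).fderiv]; rfl

lemma eulerLagrange_clm {G : E → E →L[ℝ] E →L[ℝ] ℝ} {y : E} (hG : DifferentiableAt ℝ G y)
    (a v w : E) :
    eulerLagrange (fun z u u' => G z u u') y a v w
      = G y a w + fderiv ℝ G y v v w - fderiv ℝ G y w v v / 2 := by
  simp only [eulerLagrange, fderiv_clm_apply₂ hG]
  ring

/-- The derivative of a pulled-back metric. -/
lemma fderiv_pullback {G : E → E → E → ℝ} {H : E → E →L[ℝ] E →L[ℝ] ℝ} {φ : E → E} {y : E}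
    (hH : DifferentiableAt ℝ H (φ y)) (hφ : ContDiffAt ℝ 2 φ y)
    (hG : ∀ᶠ z in 𝓝 y, ∀ v w, G z v w = H (φ z) (fderiv ℝ φ z v) (fderiv ℝ φ z w)) (u v w : E) :
    fderiv ℝ (fun z => G z v w) y u =
      fderiv ℝ H (φ y) (fderiv ℝ φ y u) (fderiv ℝ φ y v) (fderiv ℝ φ y w)
      + H (φ y) (fderiv ℝ (fderiv ℝ φ) y u v) (fderiv ℝ φ y w)
      + H (φ y) (fderiv ℝ φ y v) (fderiv ℝ (fderiv ℝ φ) y u w) := by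
  have h1 : HasFDerivAt φ (fderiv ℝ φ y) y := (hφ.differentiableAt two_ne_zero).hasFDerivAt
  have h2 : HasFDerivAt (fderiv ℝ φ) (fderiv ℝ (fderiv ℝ φ) y) y :=
    ((hφ.fderiv_right (m := 1) (by norm_num)).differentiableAt one_ne_zero).hasFDerivAt
  have h3 : (fun z => G z v w) =ᶠ[𝓝 y]
      fun z => H (φ z) (fderiv ℝ φ z v) (fderiv ℝ φ z w) := by
    filter_upwards [hG] with z hz using hz v w
  rw [h3.fderiv_eq]
  have hv : HasFDerivAt (fun z => fderiv ℝ φ z v) ((fderiv ℝ (fderiv ℝ φ) y).flip v) y :=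
    (h2.clm_apply (hasFDerivAt_const v y)).congr_fderiv (by ext; simp)
  have hw : HasFDerivAt (fun z => fderiv ℝ φ z w) ((fderiv ℝ (fderiv ℝ φ) y).flip w) y :=
    (h2.clm_apply (hasFDerivAt_const w y)).congr_fderiv (by ext; simp)
  have hH' : HasFDerivAt (fun z => H (φ z)) ((fderiv ℝ H (φ y)).comp (fderiv ℝ φ y)) y :=
    hH.hasFDerivAt.comp y h1
  have hHv := hH'.clm_apply hv
  rw [(hHv.clm_apply hw).fderiv]
  simp
  ring

/-- The Euler-Lagrange covector is natural: it is compatible with pulling back metrics. -/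
lemma eulerLagrange_pullback {G : E → E → E → ℝ} {H : E → E →L[ℝ] E →L[ℝ] ℝ} {φ : E → E} {y : E}
    (hH : DifferentiableAt ℝ H (φ y)) (hsymm : ∀ v w, H (φ y) v w = H (φ y) w v)
    (hφ : ContDiffAt ℝ 2 φ y)
    (hG : ∀ᶠ z in 𝓝 y, ∀ v w, G z v w = H (φ z) (fderiv ℝ φ z v) (fderiv ℝ φ z w)) (a v w : E) :
    eulerLagrange G y a v w = eulerLagrange (fun z u u' => H z u u') (φ y)
      (fderiv ℝ φ y a + fderiv ℝ (fderiv ℝ φ) y v v) (fderiv ℝ φ y v) (fderiv ℝ φ y w) := by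
  have hs : fderiv ℝ (fderiv ℝ φ) y w v = fderiv ℝ (fderiv ℝ φ) y v w :=
    (hφ.isSymmSndFDerivAt (by simp)).eq w v
  rw [eulerLagrange_clm hH, eulerLagrange]
  simp only [fderiv_pullback hH hφ hG]
  rw [hG.self_of_nhds, hs, hsymm (fderiv ℝ (fderiv ℝ φ) y v w), map_add,
    add_apply]
  ring

/-- The curve `x` satisfies the geodesic equation of `G` at the time `t`. -/
def GeodesicEq (G : E → E → E → ℝ) (x : ℝ → E) (t : ℝ) : Prop :=
  ∀ w, eulerLagrange G (x t) (deriv (deriv x) t) (deriv x t) w = 0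

lemma deriv_deriv_comp {x : ℝ → E} {t : ℝ} {φ : E → E} (hx : ContDiffAt ℝ 2 x t)
    (hφ : ContDiffAt ℝ 2 φ (x t)) :
    deriv (fun s => φ (x s)) t = fderiv ℝ φ (x t) (deriv x t) ∧
    deriv (deriv fun s => φ (x s)) t = fderiv ℝ φ (x t) (deriv (deriv x) t)
      + fderiv ℝ (fderiv ℝ φ) (x t) (deriv x t) (deriv x t) := by
  have hx1 : ∀ᶠ s in 𝓝 t, HasDerivAt x (deriv x s) s := by
    filter_upwards [hx.eventually (by norm_num)] with s hs
    exact (hs.differentiableAt two_ne_zero).hasDerivAt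
  have hφ1 : ∀ᶠ s in 𝓝 t, HasFDerivAt φ (fderiv ℝ φ (x s)) (x s) := by
    filter_upwards [hx.continuousAt.eventually (hφ.eventually (by norm_num))] with s hs
    exact (hs.differentiableAt two_ne_zero).hasFDerivAt
  have h1 : ∀ᶠ s in 𝓝 t, deriv (fun s => φ (x s)) s = fderiv ℝ φ (x s) (deriv x s) := by
    filter_upwards [hx1, hφ1] with s h1 h2
    exact (h2.comp_hasDerivAt s h1).deriv
  refine ⟨h1.self_of_nhds, ?_⟩
  rw [EventuallyEq.deriv_eq h1]
  have h2 : HasFDerivAt (fderiv ℝ φ) (fderiv ℝ (fderiv ℝ φ) (x t)) (x t) :=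
    ((hφ.fderiv_right (m := 1) (by norm_num)).differentiableAt one_ne_zero).hasFDerivAt
  have h3 : HasDerivAt (deriv x) (deriv (deriv x) t) t := by
    have : ContDiffAt ℝ 1 (deriv x) t := by
      have := (hx.fderiv_right (m := 1) (by norm_num)).clm_apply
        (contDiffAt_const (c := (1 : ℝ)))
      exact this
    exact (this.differentiableAt one_ne_zero).hasDerivAt
  have := ((h2.comp_hasDerivAt t hx1.self_of_nhds).clm_apply h3).deriv
  simp only [Function.comp_def] at this
  rw [this, add_comm]

/-- Maps that pull the metric `H` back to `G` preserve solutions of the geodesic equation. -/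
lemma GeodesicEq.map {G : E → E → E → ℝ} {H : E → E →L[ℝ] E →L[ℝ] ℝ} {φ : E → E} {x : ℝ → E}
    {t : ℝ} (hH : DifferentiableAt ℝ H (φ (x t))) (hsymm : ∀ v w, H (φ (x t)) v w = H (φ (x t)) w v)
    (hφ : ContDiffAt ℝ 2 φ (x t)) (hx : ContDiffAt ℝ 2 x t)
    (hG : ∀ᶠ z in 𝓝 (x t), ∀ v w, G z v w = H (φ z) (fderiv ℝ φ z v) (fderiv ℝ φ z w))
    (hsurj : Function.Surjective (fderiv ℝ φ (x t))) :
    GeodesicEq G x t ↔ GeodesicEq (fun z u u' => H z u u') (fun s => φ (x s)) t := by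
  obtain ⟨h1, h2⟩ := deriv_deriv_comp hx hφ
  simp only [GeodesicEq, h1, h2, eulerLagrange_pullback hH hsymm hφ hG]
  refine ⟨fun h w => ?_, fun h w => h _⟩
  obtain ⟨w, rfl⟩ := hsurj w
  exact h w

/-- Solutions of the geodesic equation have constant speed. -/
lemma GeodesicEq.hasDerivAt_speed {G : E → E →L[ℝ] E →L[ℝ] ℝ} {x : ℝ → E} {t : ℝ}
    (hG : DifferentiableAt ℝ G (x t)) (hsymm : ∀ v w, G (x t) v w = G (x t) w v)
    (hx : ContDiffAt ℝ 2 x t) (h : GeodesicEq (fun z u v => G z u v) x t) :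
    HasDerivAt (fun s => G (x s) (deriv x s) (deriv x s)) 0 t := by
  have h1 : HasDerivAt x (deriv x t) t := (hx.differentiableAt two_ne_zero).hasDerivAt
  have h3 : HasDerivAt (deriv x) (deriv (deriv x) t) t := by
    have : ContDiffAt ℝ 1 (deriv x) t :=
      (hx.fderiv_right (m := 1) (by norm_num)).clm_apply (contDiffAt_const (c := (1 : ℝ)))
    exact (this.differentiableAt one_ne_zero).hasDerivAt
  have h2 : HasDerivAt (fun s => G (x s)) (fderiv ℝ G (x t) (deriv x t)) t :=
    hG.hasFDerivAt.comp_hasDerivAt t h1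
  have h4 : HasDerivAt (fun s => G (x s) (deriv x s)) (fderiv ℝ G (x t) (deriv x t) (deriv x t)
      + G (x t) (deriv (deriv x) t)) t := h2.clm_apply h3
  refine (h4.clm_apply h3).congr_deriv ?_
  have h5 := h (deriv x t)
  rw [eulerLagrange_clm hG] at h5
  rw [add_apply]
  rw [hsymm (deriv x t)]
  linarith

variable [FiniteDimensional ℝ E]

/-- A positive definite bilinear form identifies the space with its dual. -/
lemma isInvertible_of_pos {B : E →L[ℝ] E →L[ℝ] ℝ} (hB : ∀ v, v ≠ 0 → 0 < B v v) :
    B.IsInvertible := by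
  have hinj : Function.Injective B := by
    rw [injective_iff_map_eq_zero]
    intro v hv
    by_contra h
    have := hB v h
    rw [hv] at this
    exact lt_irrefl _ this
  have hfr : Module.finrank ℝ E = Module.finrank ℝ (E →L[ℝ] ℝ) := by
    rw [← (LinearMap.toContinuousLinearMap (𝕜 := ℝ) (E := E) (F' := ℝ)).finrank_eq,
      Module.finrank_linearMap, Module.finrank_self, mul_one]
  refine ⟨(LinearEquiv.ofInjectiveOfFinrankEq B.toLinearMap hinj hfr).toContinuousLinearEquiv, ?_⟩
  ext v w
  rfl

/-- In coordinates the geodesic equation has the form `x'' = A(x, x')` for a smooth map `A`. -/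
lemma exists_spray {G : E → E →L[ℝ] E →L[ℝ] ℝ} {Ω : Set E} (hΩ : IsOpen Ω)
    (hG : ContDiffOn ℝ ∞ G Ω) (hpos : ∀ y ∈ Ω, ∀ v, v ≠ 0 → 0 < G y v v) :
    ∃ A : E × E → E, ContDiffOn ℝ ∞ A (Ω ×ˢ univ) ∧ ∀ y ∈ Ω, ∀ a v,
      (∀ w, eulerLagrange (fun z u u' => G z u u') y a v w = 0) ↔ a = A (y, v) := by
  let C : E × E → E →L[ℝ] ℝ := fun p =>
    fderiv ℝ G p.1 p.2 p.2 - (2⁻¹ : ℝ) • ((fderiv ℝ G p.1).flip p.2).flip p.2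
  refine ⟨fun p => -((G p.1).inverse (C p)), ?_, ?_⟩
  · have hfst : ContDiffOn ℝ ∞ (fun p : E × E => p.1) (Ω ×ˢ univ) := contDiff_fst.contDiffOn
    have hsnd : ContDiffOn ℝ ∞ (fun p : E × E => p.2) (Ω ×ˢ univ) := contDiff_snd.contDiffOn
    have hmap : MapsTo (fun p : E × E => p.1) (Ω ×ˢ univ) Ω := fun p hp => hp.1
    have hDG : ContDiffOn ℝ ∞ (fun p : E × E => fderiv ℝ G p.1) (Ω ×ˢ univ) :=
      (hG.fderiv_of_isOpen hΩ (by norm_cast)).comp hfst hmap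
    have hflip : ContDiffOn ℝ ∞ (fun p : E × E => (fderiv ℝ G p.1).flip) (Ω ×ˢ univ) :=
      (ContinuousLinearMap.flipₗᵢ ℝ E E (E →L[ℝ] ℝ)).contDiff.comp_contDiffOn hDG
    have hflip2 : ContDiffOn ℝ ∞ (fun p : E × E => ((fderiv ℝ G p.1).flip p.2).flip)
        (Ω ×ˢ univ) :=
      (ContinuousLinearMap.flipₗᵢ ℝ E E ℝ).contDiff.comp_contDiffOn (hflip.clm_apply hsnd)
    have hC : ContDiffOn ℝ ∞ C (Ω ×ˢ univ) :=
      ((hDG.clm_apply hsnd).clm_apply hsnd).sub ((hflip2.clm_apply hsnd).const_smul _)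
    have hinv : ContDiffOn ℝ ∞ (fun p : E × E => (G p.1).inverse) (Ω ×ˢ univ) := by
      intro p hp
      obtain ⟨e, he⟩ := isInvertible_of_pos (hpos p.1 hp.1)
      have h1 : ContDiffAt ℝ ∞ ContinuousLinearMap.inverse (G p.1) := by
        rw [← he]; exact contDiffAt_map_inverse e
      exact h1.comp_contDiffWithinAt p ((hG.comp hfst hmap) p hp)
    exact (hinv.clm_apply hC).neg
  · intro y hy a v
    have hd : DifferentiableAt ℝ G y :=
      ((hG.contDiffAt (hΩ.mem_nhds hy)).differentiableAt (by simp))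
    obtain ⟨e, he⟩ := isInvertible_of_pos (hpos y hy)
    have h1 : ∀ w, eulerLagrange (fun z u u' => G z u u') y a v w = (e a + C (y, v)) w := by
      intro w
      rw [eulerLagrange_clm hd, ← he]
      simp [C]
      ring
    simp only [h1]
    rw [← he, ContinuousLinearMap.inverse_equiv]
    constructor
    · intro h
      have h2 : e a + C (y, v) = 0 := ContinuousLinearMap.ext h
      have h3 : e a = -C (y, v) := eq_neg_of_add_eq_zero_left h2
      change a = -(e.symm (C (y, v)))
      rw [← map_neg, ← h3, e.symm_apply_apply]
    · intro h w
      have h2 : e a = -C (y, v) := by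
        rw [h]
        change e (-(e.symm (C (y, v)))) = _
        rw [map_neg, e.apply_symm_apply]
      rw [h2, neg_add_cancel]
      rfl

/-- Local uniqueness of solutions of the geodesic equation. -/
lemma geodesicEq_unique {G : E → E →L[ℝ] E →L[ℝ] ℝ} {Ω : Set E} (hΩ : IsOpen Ω)
    (hG : ContDiffOn ℝ ∞ G Ω) (hpos : ∀ y ∈ Ω, ∀ v, v ≠ 0 → 0 < G y v v) {x₁ x₂ : ℝ → E} {t : ℝ}
    (hx₁ : ContDiffAt ℝ 2 x₁ t) (hx₂ : ContDiffAt ℝ 2 x₂ t)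
    (h₁ : ∀ᶠ s in 𝓝 t, GeodesicEq (fun z u v => G z u v) x₁ s)
    (h₂ : ∀ᶠ s in 𝓝 t, GeodesicEq (fun z u v => G z u v) x₂ s)
    (hmem : x₁ t ∈ Ω) (h0 : x₁ t = x₂ t) (h0' : deriv x₁ t = deriv x₂ t) :
    x₁ =ᶠ[𝓝 t] x₂ := by
  obtain ⟨A, hA, hAeq⟩ := exists_spray hΩ hG hpos
  have key : ∀ {x : ℝ → E}, ContDiffAt ℝ 2 x t → x t ∈ Ω →
      (∀ᶠ s in 𝓝 t, GeodesicEq (fun z u v => G z u v) x s) →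
      ∀ᶠ s in 𝓝 t, HasDerivAt (fun s => (x s, deriv x s)) (deriv x s, A (x s, deriv x s)) s := by
    intro x hx hxt hg
    filter_upwards [hx.eventually (by norm_num), hx.continuousAt.eventually_mem (hΩ.mem_nhds hxt),
      hg] with s h1 h2 h3
    have h4 : HasDerivAt (deriv x) (deriv (deriv x) s) s := by
      have : ContDiffAt ℝ 1 (deriv x) s :=
        (h1.fderiv_right (m := 1) (by norm_num)).clm_apply (contDiffAt_const (c := (1 : ℝ)))
      exact (this.differentiableAt one_ne_zero).hasDerivAt
    rw [← (hAeq (x s) h2 _ _).1 h3]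
    exact (h1.differentiableAt two_ne_zero).hasDerivAt.prodMk h4
  let F : E × E → E × E := fun p => (p.2, A p)
  have hF : ContDiffAt ℝ 1 F (x₁ t, deriv x₁ t) :=
    contDiffAt_snd.prodMk ((hA.contDiffAt ((hΩ.prod isOpen_univ).mem_nhds
      ⟨hmem, mem_univ _⟩)).of_le (by norm_cast))
  obtain ⟨K, s, hs, hK⟩ := hF.exists_lipschitzOnWith
  have hcont : ∀ {x : ℝ → E}, ContDiffAt ℝ 2 x t →
      ContinuousAt (fun s => (x s, deriv x s)) t := by
    intro x hx
    have : ContDiffAt ℝ 1 (deriv x) t :=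
      (hx.fderiv_right (m := 1) (by norm_num)).clm_apply (contDiffAt_const (c := (1 : ℝ)))
    exact hx.continuousAt.prodMk this.continuousAt
  have := ODE_solution_unique_of_eventually (v := fun _ => F) (s := fun _ => s) (K := K)
    (f := fun s => (x₁ s, deriv x₁ s)) (g := fun s => (x₂ s, deriv x₂ s)) (t₀ := t)
    (Eventually.of_forall fun _ => hK)
    ((key hx₁ hmem h₁).and ((hcont hx₁).eventually_mem hs))
    ((key hx₂ (h0 ▸ hmem) h₂).and ((hcont hx₂).eventually_mem (by rw [← h0, ← h0']; exact hs)))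
    (by simp [h0, h0'])
  filter_upwards [this] with s hs
  exact congrArg Prod.fst hs

omit [FiniteDimensional ℝ E] in
/-- A solution of the first order system associated with the geodesic equation is a geodesic. -/
lemma geodesicEq_of_hasDerivAt {G : E → E →L[ℝ] E →L[ℝ] ℝ} {Ω : Set E}
    {A : E × E → E} (hA : ContDiffOn ℝ ∞ A (Ω ×ˢ univ))
    (hAeq : ∀ y ∈ Ω, ∀ a v,
      (∀ w, eulerLagrange (fun z u u' => G z u u') y a v w = 0) ↔ a = A (y, v))
    {z : ℝ → E × E} {t : ℝ}
    (hz : ∀ᶠ s in 𝓝 t, HasDerivAt z ((z s).2, A (z s)) s ∧ (z s).1 ∈ Ω) :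
    ContDiffAt ℝ 2 (fun s => (z s).1) t ∧ deriv (fun s => (z s).1) t = (z t).2 ∧
      GeodesicEq (fun z u v => G z u v) (fun s => (z s).1) t := by
  have h1 : ∀ᶠ s in 𝓝 t, HasDerivAt (fun s => (z s).1) (z s).2 s := by
    filter_upwards [hz] with s hs
    exact (hasFDerivAt_fst (p := z s)).comp_hasDerivAt s hs.1
  have h2 : ∀ᶠ s in 𝓝 t, HasDerivAt (fun s => (z s).2) (A (z s)) s := by
    filter_upwards [hz] with s hs
    exact (hasFDerivAt_snd (p := z s)).comp_hasDerivAt s hs.1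
  have hd1 : deriv (fun s => (z s).1) =ᶠ[𝓝 t] fun s => (z s).2 := by
    filter_upwards [h1] with s hs using hs.deriv
  have hd2 : deriv (deriv fun s => (z s).1) t = A (z t) := by
    rw [hd1.deriv_eq, h2.self_of_nhds.deriv]
  refine ⟨?_, hd1.self_of_nhds, ?_⟩
  · obtain ⟨u, hu, hut, htu⟩ := eventually_nhds_iff.1 (hz.and (h1.and h2))
    have hzc : ContinuousOn z u := fun s hs => (hu s hs).1.1.continuousAt.continuousWithinAt
    have hAc : ContinuousOn (fun s => A (z s)) u :=
      hA.continuousOn.comp hzc fun s hs => ⟨(hu s hs).1.2, mem_univ _⟩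
    have hz2 : ContDiffOn ℝ 1 (fun s => (z s).2) u := by
      rw [show (1 : WithTop ℕ∞) = 0 + 1 from rfl, contDiffOn_succ_iff_deriv_of_isOpen hut]
      refine ⟨fun s hs => (hu s hs).2.2.differentiableAt.differentiableWithinAt, by simp, ?_⟩
      exact contDiffOn_zero.2 (hAc.congr fun s hs => (hu s hs).2.2.deriv)
    have hz1 : ContDiffOn ℝ 2 (fun s => (z s).1) u := by
      rw [show (2 : WithTop ℕ∞) = 1 + 1 by norm_num, contDiffOn_succ_iff_deriv_of_isOpen hut]
      refine ⟨fun s hs => (hu s hs).2.1.differentiableAt.differentiableWithinAt, by simp, ?_⟩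
      exact hz2.congr fun s hs => (hu s hs).2.1.deriv
    exact hz1.contDiffAt (hut.mem_nhds htu)
  · intro w
    rw [hd2, hd1.self_of_nhds]
    exact (hAeq _ hz.self_of_nhds.2 _ _).2 rfl w

end EulerLagrange

/-! ### Pulled-back metrics and the invariance of the geodesic equation -/

/-- The model space of `n`-dimensional manifolds. -/
abbrev Euc (n : ℕ) := EuclideanSpace ℝ (Fin n)

section Pullback

variable {n : ℕ} {M : Type u} [TopologicalSpace M] [ChartedSpace (Euc n) M]
  {N : Type*} [TopologicalSpace N] [ChartedSpace (Euc n) N]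
  {P : Type*} [TopologicalSpace P] [ChartedSpace (Euc n) P]

variable (n) in
/-- The differential of a map between `n`-dimensional manifolds, with all tangent spaces
identified with the model space. -/
def tderiv (f : M → N) (x : M) : Euc n →L[ℝ] Euc n := mfderiv (𝓡 n) (𝓡 n) f x

variable (n) in
/-- The velocity of a curve, with the tangent space identified with the model space. -/
def velocity (c : ℝ → M) (t : ℝ) : Euc n := mfderiv 𝓘(ℝ, ℝ) (𝓡 n) c t (1 : ℝ)

lemma tderiv_comp {f : M → N} {h : N → P} {x : M} (hh : MDifferentiableAt (𝓡 n) (𝓡 n) h (f x))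
    (hf : MDifferentiableAt (𝓡 n) (𝓡 n) f x) :
    tderiv n (h ∘ f) x = (tderiv n h (f x)).comp (tderiv n f x) :=
  mfderiv_comp x hh hf

lemma tderiv_congr {f f' : M → N} {x : M} (h : f =ᶠ[𝓝 x] f') : tderiv n f x = tderiv n f' x := by
  ext1 v
  exact congrArg (fun L : TangentSpace (𝓡 n) x →L[ℝ] TangentSpace (𝓡 n) (f x) => (L v : Euc n))
    h.mfderiv_eq

lemma tderiv_id (x : M) : tderiv n (id : M → M) x = ContinuousLinearMap.id ℝ (Euc n) :=
  mfderiv_id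

lemma tderiv_eq_fderiv (φ : Euc n → Euc n) (y : Euc n) : tderiv n φ y = fderiv ℝ φ y :=
  mfderiv_eq_fderiv

lemma velocity_comp {f : M → N} {c : ℝ → M} {t : ℝ}
    (hf : MDifferentiableAt (𝓡 n) (𝓡 n) f (c t)) (hc : MDifferentiableAt 𝓘(ℝ, ℝ) (𝓡 n) c t) :
    velocity n (f ∘ c) t = tderiv n f (c t) (velocity n c t) := by
  have h := mfderiv_comp t hf hc
  exact congrArg (fun L : TangentSpace 𝓘(ℝ, ℝ) t →L[ℝ] TangentSpace (𝓡 n) (f (c t)) =>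
    (L (1 : ℝ) : Euc n)) h

lemma velocity_congr {c c' : ℝ → M} {t : ℝ} (h : c =ᶠ[𝓝 t] c') : velocity n c t = velocity n c' t :=
  congrArg (fun L : TangentSpace 𝓘(ℝ, ℝ) t →L[ℝ] TangentSpace (𝓡 n) (c t) =>
    (L (1 : ℝ) : Euc n)) h.mfderiv_eq

lemma velocity_eq_deriv (x : ℝ → Euc n) (t : ℝ) : velocity n x t = deriv x t := by
  have h : velocity n x t = fderiv ℝ x t 1 :=
    congrArg (fun L : ℝ →L[ℝ] Euc n => L 1) (mfderiv_eq_fderiv (f := x) (x := t))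
  rw [h]; rfl

lemma velocity_comp_scale {c : ℝ → M} {t a b : ℝ}
    (hc : MDifferentiableAt 𝓘(ℝ, ℝ) (𝓡 n) c (a * t + b)) :
    velocity n (fun s => c (a * s + b)) t = a • velocity n c (a * t + b) := by
  have hd : HasDerivAt (fun s : ℝ => a * s + b) a t := by
    simpa using ((hasDerivAt_id t).const_mul a).add_const b
  have h := mfderiv_comp t (f := fun s : ℝ => a * s + b) (g := c) hc
    hd.differentiableAt.mdifferentiableAt
  have h2 : (mfderiv 𝓘(ℝ, ℝ) 𝓘(ℝ, ℝ) (fun s : ℝ => a * s + b) t : ℝ →L[ℝ] ℝ) 1 = a := by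
    have h0 : (mfderiv 𝓘(ℝ, ℝ) 𝓘(ℝ, ℝ) (fun s : ℝ => a * s + b) t : ℝ →L[ℝ] ℝ) 1
        = fderiv ℝ (fun s : ℝ => a * s + b) t 1 :=
      congrArg (fun L : ℝ →L[ℝ] ℝ => L 1) mfderiv_eq_fderiv
    rw [h0, hd.hasFDerivAt.fderiv]
    exact one_mul a
  have h3 : velocity n (fun s => c (a * s + b)) t = (mfderiv 𝓘(ℝ, ℝ) (𝓡 n) c (a * t + b) :
      ℝ →L[ℝ] Euc n) ((mfderiv 𝓘(ℝ, ℝ) 𝓘(ℝ, ℝ) (fun s : ℝ => a * s + b) t : ℝ →L[ℝ] ℝ) 1) :=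
    congrArg (fun L : TangentSpace 𝓘(ℝ, ℝ) t →L[ℝ] TangentSpace (𝓡 n) (c (a * t + b)) =>
      (L (1 : ℝ) : Euc n)) h
  rw [h3, h2]
  have h4 : ∀ D : ℝ →L[ℝ] Euc n, D a = a • D 1 := fun D => by
    rw [← map_smul, smul_eq_mul, mul_one]
  exact h4 _

variable [IsManifold (𝓡 n) ∞ M] [IsManifold (𝓡 n) ∞ N]

/-- The inner product of a Riemannian metric, with the tangent space identified with the model
space. -/
def metricAt (g : Metric n M) (x : M) : Euc n →L[ℝ] Euc n →L[ℝ] ℝ := g.inner x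

lemma metricAt_symm (g : Metric n M) (x : M) (u v : Euc n) :
    metricAt g x u v = metricAt g x v u := g.symm x u v

lemma metricAt_pos (g : Metric n M) (x : M) (v : Euc n) (hv : v ≠ 0) : 0 < metricAt g x v v :=
  g.pos x v hv

lemma metricAt_nonneg (g : Metric n M) (x : M) (v : Euc n) : 0 ≤ metricAt g x v v := by
  rcases eq_or_ne v 0 with rfl | hv
  · simp
  · exact (metricAt_pos g x v hv).le

/-- The pullback of the Riemannian metric `g` under a map `f` from the model space, at the
point `y`. -/
def pullMetric (g : Metric n M) (f : Euc n → M) (y : Euc n) : Euc n →L[ℝ] Euc n →L[ℝ] ℝ :=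
  (metricAt g (f y)).bilinearComp (tderiv n f y) (tderiv n f y)

lemma pullMetric_apply (g : Metric n M) (f : Euc n → M) (y u v : Euc n) :
    pullMetric g f y u v = metricAt g (f y) (tderiv n f y u) (tderiv n f y v) := rfl

lemma coordMetric_eq (g : Metric n M) (e : OpenPartialHomeomorph M (Euc n)) :
    coordMetric g e = fun y u v => pullMetric g e.symm y u v := rfl

lemma pullMetric_symm (g : Metric n M) (f : Euc n → M) (y u v : Euc n) :
    pullMetric g f y u v = pullMetric g f y v u := metricAt_symm _ _ _ _

lemma pullMetric_pos (g : Metric n M) {f : Euc n → M} {y : Euc n}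
    (hf : Function.Injective (tderiv n f y)) (v : Euc n) (hv : v ≠ 0) :
    0 < pullMetric g f y v v :=
  metricAt_pos g _ _ fun h => hv (hf (h.trans (map_zero _).symm))

lemma contMDiffOn_tderiv_apply {f : Euc n → M} {Ω : Set (Euc n)} (hΩ : IsOpen Ω)
    (hf : ContMDiffOn (𝓡 n) (𝓡 n) ∞ f Ω) (v : Euc n) :
    ContMDiffOn (𝓡 n) (𝓡 n).tangent ∞
      (fun y => (⟨f y, tderiv n f y v⟩ : TangentBundle (𝓡 n) M)) Ω := by
  have h1 := hf.contMDiffOn_tangentMapWithin (m := ∞) (by norm_cast) hΩ.uniqueMDiffOn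
  have h2 : ContMDiffOn (𝓡 n) (𝓡 n).tangent ∞
      (fun y : Euc n => (⟨y, v⟩ : TangentBundle (𝓡 n) (Euc n))) Ω := by
    intro y hy
    rw [Bundle.contMDiffWithinAt_totalSpace]
    refine ⟨contMDiffWithinAt_id, ?_⟩
    simp
    exact contMDiffWithinAt_const
  refine (h1.comp h2 fun y hy => hy).congr fun y hy => ?_
  simp only [tangentMapWithin, Function.comp]
  rw [mfderivWithin_of_isOpen hΩ hy]
  rfl

/-- The pullback of a smooth metric under a smooth map is smooth. -/
lemma contDiffOn_pullMetric (g : Metric n M) {f : Euc n → M} {Ω : Set (Euc n)} (hΩ : IsOpen Ω)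
    (hf : ContMDiffOn (𝓡 n) (𝓡 n) ∞ f Ω) : ContDiffOn ℝ ∞ (pullMetric g f) Ω := by
  rw [contDiffOn_clm_apply]
  intro u
  rw [contDiffOn_clm_apply]
  intro v
  rw [← contMDiffOn_iff_contDiffOn]
  intro y hy
  have h := ContMDiffWithinAt.clm_bundle_apply₂ (F₁ := Euc n) (F₂ := Euc n) (F₃ := ℝ)
    (E₁ := fun x : M => TangentSpace (𝓡 n) x) (E₂ := fun x : M => TangentSpace (𝓡 n) x)
    (E₃ := Bundle.Trivial M ℝ)
    ((g.contMDiff.contMDiffAt (x := f y)).comp_contMDiffWithinAt y (hf y hy))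
    (contMDiffOn_tderiv_apply hΩ hf u y hy) (contMDiffOn_tderiv_apply hΩ hf v y hy)
  rw [Bundle.contMDiffWithinAt_totalSpace] at h
  exact h.2

/-- Pulling back is functorial. -/
lemma pullMetric_comp (g : Metric n M) {f : Euc n → M} {φ : Euc n → Euc n} {y : Euc n}
    (hf : MDifferentiableAt (𝓡 n) (𝓡 n) f (φ y)) (hφ : DifferentiableAt ℝ φ y) (u v : Euc n) :
    pullMetric g (f ∘ φ) y u v = pullMetric g f (φ y) (fderiv ℝ φ y u) (fderiv ℝ φ y v) := by
  rw [pullMetric_apply, tderiv_comp hf hφ.mdifferentiableAt, tderiv_eq_fderiv]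
  rfl

lemma pullMetric_congr (g : Metric n M) {f f' : Euc n → M} {y : Euc n} (h : f =ᶠ[𝓝 y] f') :
    pullMetric g f y = pullMetric g f' y := by
  rw [pullMetric, pullMetric, tderiv_congr h, h.self_of_nhds]

end Pullback

/-! ### Geodesics in charts -/

section Geodesic

variable {n : ℕ} {M : Type u} [TopologicalSpace M] [ChartedSpace (Euc n) M]

lemma GeodesicEq.congr_metric {E : Type*} [NormedAddCommGroup E] [NormedSpace ℝ E]
    {G G' : E → E → E → ℝ} {x : ℝ → E} {t : ℝ} (h : ∀ᶠ z in 𝓝 (x t), G z = G' z) :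
    GeodesicEq G x t ↔ GeodesicEq G' x t := by
  have h1 : ∀ v w, fderiv ℝ (fun z => G z v w) (x t) = fderiv ℝ (fun z => G' z v w) (x t) :=
    fun v w => EventuallyEq.fderiv_eq (by filter_upwards [h] with z hz; rw [hz])
  simp only [GeodesicEq, eulerLagrange, h1, h.self_of_nhds]

lemma GeodesicEq.congr_curve {E : Type*} [NormedAddCommGroup E] [NormedSpace ℝ E]
    {G : E → E → E → ℝ} {x x' : ℝ → E} {t : ℝ} (h : x =ᶠ[𝓝 t] x') :
    GeodesicEq G x t ↔ GeodesicEq G x' t := by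
  simp only [GeodesicEq, h.deriv_eq, h.deriv.deriv_eq, h.self_of_nhds]

section Charts

variable [IsManifold (𝓡 n) ∞ M] {e : OpenPartialHomeomorph M (Euc n)}

lemma contMDiffOn_chart (he : e ∈ atlas (Euc n) M) :
    ContMDiffOn (𝓡 n) (𝓡 n) ∞ e e.source :=
  contMDiffOn_of_mem_maximalAtlas (IsManifold.subset_maximalAtlas he)

lemma contMDiffOn_chart_symm (he : e ∈ atlas (Euc n) M) :
    ContMDiffOn (𝓡 n) (𝓡 n) ∞ e.symm e.target :=
  contMDiffOn_symm_of_mem_maximalAtlas (IsManifold.subset_maximalAtlas he)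

lemma contMDiffAt_chart (he : e ∈ atlas (Euc n) M) {x : M} (hx : x ∈ e.source) :
    ContMDiffAt (𝓡 n) (𝓡 n) ∞ e x :=
  (contMDiffOn_chart he).contMDiffAt (e.open_source.mem_nhds hx)

lemma contMDiffAt_chart_symm (he : e ∈ atlas (Euc n) M) {y : Euc n} (hy : y ∈ e.target) :
    ContMDiffAt (𝓡 n) (𝓡 n) ∞ e.symm y :=
  (contMDiffOn_chart_symm he).contMDiffAt (e.open_target.mem_nhds hy)

lemma tderiv_chart_symm_comp (he : e ∈ atlas (Euc n) M) {x : M} (hx : x ∈ e.source) :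
    (tderiv n e.symm (e x)).comp (tderiv n e x) = ContinuousLinearMap.id ℝ (Euc n) := by
  rw [← tderiv_comp (((contMDiffAt_chart_symm he (e.map_source hx))).mdifferentiableAt (by simp))
    ((contMDiffAt_chart he hx).mdifferentiableAt (by simp)), ← tderiv_id x]
  refine tderiv_congr ?_
  filter_upwards [e.open_source.mem_nhds hx] with z hz using e.left_inv hz

lemma tderiv_chart_comp_symm (he : e ∈ atlas (Euc n) M) {y : Euc n} (hy : y ∈ e.target) :
    (tderiv n e (e.symm y)).comp (tderiv n e.symm y) = ContinuousLinearMap.id ℝ (Euc n) := by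
  rw [← tderiv_comp (((contMDiffAt_chart he (e.map_target hy))).mdifferentiableAt (by simp))
    ((contMDiffAt_chart_symm he hy).mdifferentiableAt (by simp)), ← tderiv_id y]
  refine tderiv_congr ?_
  filter_upwards [e.open_target.mem_nhds hy] with z hz using e.right_inv hz

lemma tderiv_chart_bijective (he : e ∈ atlas (Euc n) M) {x : M} (hx : x ∈ e.source) :
    Function.Bijective (tderiv n e x) := by
  have h1 := tderiv_chart_symm_comp he hx
  have h2 := tderiv_chart_comp_symm he (e.map_source hx)
  rw [e.left_inv hx] at h2
  exact Function.bijective_iff_has_inverse.2 ⟨tderiv n e.symm (e x),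
    fun v => DFunLike.congr_fun h1 v, fun v => DFunLike.congr_fun h2 v⟩

lemma tderiv_chart_symm_bijective (he : e ∈ atlas (Euc n) M) {y : Euc n} (hy : y ∈ e.target) :
    Function.Bijective (tderiv n e.symm y) := by
  have h1 := tderiv_chart_comp_symm he hy
  have h2 := tderiv_chart_symm_comp he (e.map_target hy)
  rw [e.right_inv hy] at h2
  exact Function.bijective_iff_has_inverse.2 ⟨tderiv n e (e.symm y),
    fun v => DFunLike.congr_fun h1 v, fun v => DFunLike.congr_fun h2 v⟩

lemma deriv_chart_comp (he : e ∈ atlas (Euc n) M) {c : ℝ → M} {t : ℝ} (ht : c t ∈ e.source)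
    (hc : MDifferentiableAt 𝓘(ℝ, ℝ) (𝓡 n) c t) :
    deriv (fun s => e (c s)) t = tderiv n e (c t) (velocity n c t) := by
  rw [← velocity_eq_deriv]
  exact velocity_comp ((contMDiffAt_chart he ht).mdifferentiableAt (by simp)) hc

lemma contDiffAt_chart_comp (he : e ∈ atlas (Euc n) M) {c : ℝ → M} {t : ℝ} (ht : c t ∈ e.source)
    {k : ℕ∞} (hc : ContMDiffAt 𝓘(ℝ, ℝ) (𝓡 n) k c t) :
    ContDiffAt ℝ k (fun s => e (c s)) t :=
  contMDiffAt_iff_contDiffAt.1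
    (ContMDiffAt.comp t ((contMDiffAt_chart he ht).of_le (by exact_mod_cast le_top)) hc)

end Charts

variable [IsManifold (𝓡 n) ∞ M]

/-- The pointwise form of `IsGeodesic`: near `t` the curve `c` is twice continuously differentiable,
and it satisfies the geodesic equation at the time `t`, in every chart around `c t`. -/
def IsGeodesicAt (g : Metric n M) (c : ℝ → M) (t : ℝ) : Prop :=
  ContMDiffAt 𝓘(ℝ, ℝ) (𝓡 n) 2 c t ∧
    ∀ e ∈ atlas (Euc n) M, c t ∈ e.source → GeodesicEq (coordMetric g e) (fun s => e (c s)) t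

lemma isGeodesic_iff {g : Metric n M} {c : ℝ → M} : IsGeodesic g c ↔ ∀ t, IsGeodesicAt g c t :=
  ⟨fun h t => ⟨h.1.contMDiffAt, fun e he ht => h.2 e he t ht⟩,
    fun h => ⟨fun t => (h t).1, fun e he t ht => (h t).2 e he ht⟩⟩

lemma IsGeodesicAt.congr {g : Metric n M} {c c' : ℝ → M} {t : ℝ} (h : IsGeodesicAt g c t)
    (hcc : c' =ᶠ[𝓝 t] c) : IsGeodesicAt g c' t := by
  refine ⟨h.1.congr_of_eventuallyEq hcc, fun e he ht => ?_⟩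
  rw [hcc.self_of_nhds] at ht
  refine (GeodesicEq.congr_curve ?_).2 (h.2 e he ht)
  filter_upwards [hcc] with s hs
  rw [hs]

lemma IsGeodesicAt.mdifferentiableAt {g : Metric n M} {c : ℝ → M} {t : ℝ}
    (h : IsGeodesicAt g c t) : MDifferentiableAt 𝓘(ℝ, ℝ) (𝓡 n) c t :=
  h.1.mdifferentiableAt (by simp)

/-- Through a smooth map `f` with invertible differential, the geodesics of `g` correspond to
the geodesics of the pulled-back metric. -/
lemma isGeodesicAt_comp_iff (g : Metric n M) {f : Euc n → M} {Ω : Set (Euc n)} (hΩ : IsOpen Ω)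
    (hf : ContMDiffOn (𝓡 n) (𝓡 n) ∞ f Ω) {x : ℝ → Euc n} {t : ℝ} (hx : ContDiffAt ℝ 2 x t)
    (hxt : x t ∈ Ω) (hsurj : Function.Surjective (tderiv n f (x t))) :
    IsGeodesicAt g (fun s => f (x s)) t ↔ GeodesicEq (fun y u v => pullMetric g f y u v) x t := by
  have hfa : ∀ z ∈ Ω, ContMDiffAt (𝓡 n) (𝓡 n) ∞ f z := fun z hz =>
    hf.contMDiffAt (hΩ.mem_nhds hz)
  have hC : ContMDiffAt 𝓘(ℝ, ℝ) (𝓡 n) 2 (fun s => f (x s)) t :=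
    ContMDiffAt.comp t ((hfa _ hxt).of_le (by norm_cast)) hx.contMDiffAt
  have key : ∀ e ∈ atlas (Euc n) M, f (x t) ∈ e.source →
      (GeodesicEq (fun y u v => pullMetric g f y u v) x t ↔
        GeodesicEq (coordMetric g e) (fun s => e (f (x s))) t) := by
    intro e he ht
    have hφ : ∀ z ∈ Ω, f z ∈ e.source → ContDiffAt ℝ ∞ (fun z => e (f z)) z := fun z hz hz' =>
      contMDiffAt_iff_contDiffAt.1 (ContMDiffAt.comp z (contMDiffAt_chart he hz') (hfa z hz))
    have hH : DifferentiableAt ℝ (pullMetric g e.symm) (e (f (x t))) :=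
      ((contDiffOn_pullMetric g e.open_target (contMDiffOn_chart_symm he)).contDiffAt
        (e.open_target.mem_nhds (e.map_source ht))).differentiableAt (by simp)
    refine GeodesicEq.map (φ := fun z => e (f z)) (H := pullMetric g e.symm) hH
      (fun v w => pullMetric_symm g _ _ _ _)
      ((hφ _ hxt ht).of_le (by norm_cast)) hx ?_ ?_
    · filter_upwards [hΩ.mem_nhds hxt,
        (hfa _ hxt).continuousAt.eventually_mem (e.open_source.mem_nhds ht),
        (hfa _ hxt).continuousAt.eventually (e.eventually_left_inverse ht) |>.eventually_nhds]
        with z hz hz' hz'' v w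
      rw [← pullMetric_comp g (((contMDiffAt_chart_symm he (e.map_source hz'))).mdifferentiableAt
        (by simp)) ((hφ z hz hz').differentiableAt (by simp))]
      have : f =ᶠ[𝓝 z] e.symm ∘ (fun z => e (f z)) := by
        filter_upwards [hz''] with y hy using hy.symm
      rw [pullMetric_congr g this]
    · have : fderiv ℝ (fun z => e (f z)) (x t) = (tderiv n e (f (x t))).comp (tderiv n f (x t)) := by
        rw [← tderiv_comp ((contMDiffAt_chart he ht).mdifferentiableAt (by simp))
          ((hfa _ hxt).mdifferentiableAt (by simp)), tderiv_eq_fderiv]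
        rfl
      rw [this]
      exact (tderiv_chart_bijective he ht).2.comp hsurj
  constructor
  · intro h
    exact (key _ (chart_mem_atlas (Euc n) (f (x t))) (mem_chart_source (Euc n) _)).2
      (h.2 _ (chart_mem_atlas (Euc n) (f (x t))) (mem_chart_source (Euc n) _))
  · intro h
    exact ⟨hC, fun e he ht => (key e he ht).1 h⟩

/-- Local isometries map geodesics to geodesics. -/
lemma IsGeodesicAt.map {N : Type u} [TopologicalSpace N] [ChartedSpace (Euc n) N]
    [IsManifold (𝓡 n) ∞ N] {gN : Metric n N} {g : Metric n M} {p : N → M}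
    (hp : IsLocalIsometry gN g p) {c : ℝ → N} {t : ℝ} (h : IsGeodesicAt gN c t) :
    IsGeodesicAt g (fun s => p (c s)) t := by
  set e := chartAt (Euc n) (c t)
  have he : e ∈ atlas (Euc n) N := chart_mem_atlas (Euc n) (c t)
  have ht : c t ∈ e.source := mem_chart_source (Euc n) (c t)
  have hs := contMDiffOn_chart_symm he
  have hf : ContMDiffOn (𝓡 n) (𝓡 n) ∞ (p ∘ e.symm) e.target := hp.1.comp_contMDiffOn hs
  have hpm : ∀ y ∈ e.target, ∀ u v, pullMetric g (p ∘ e.symm) y u v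
      = pullMetric gN e.symm y u v := by
    intro y hy u v
    rw [pullMetric_apply, tderiv_comp (hp.1.contMDiffAt.mdifferentiableAt (by simp))
      ((contMDiffAt_chart_symm he hy).mdifferentiableAt (by simp))]
    exact hp.2 (e.symm y) (tderiv n e.symm y u) (tderiv n e.symm y v)
  have hinj : Function.Injective (tderiv n (p ∘ e.symm) (e (c t))) := by
    rw [injective_iff_map_eq_zero]
    intro v hv
    by_contra hv0
    have h1 := pullMetric_pos gN (tderiv_chart_symm_bijective he (e.map_source ht)).1 v hv0
    rw [← hpm _ (e.map_source ht), pullMetric_apply, hv, map_zero] at h1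
    exact lt_irrefl _ h1
  have hx : ContDiffAt ℝ 2 (fun s => e (c s)) t := contDiffAt_chart_comp (k := 2) he ht h.1
  have h2 := (isGeodesicAt_comp_iff g e.open_target hf hx (e.map_source ht)
    ((tderiv n (p ∘ e.symm) (e (c t))).toLinearMap.injective_iff_surjective.1 hinj)).2
    ((GeodesicEq.congr_metric ?_).2 (h.2 e he ht))
  · refine h2.congr ?_
    filter_upwards [h.1.continuousAt.eventually (e.eventually_left_inverse ht)] with s hs
    simp [hs]
  · filter_upwards [e.open_target.mem_nhds (e.map_source ht)] with z hz
    funext u v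
    exact hpm z hz u v

end Geodesic

/-! ### Constant speed and uniqueness of geodesics -/

section GeodesicFlow

variable {n : ℕ} {M : Type u} [TopologicalSpace M] [ChartedSpace (Euc n) M]
  [IsManifold (𝓡 n) ∞ M]

lemma coordMetric_contDiffOn (g : Metric n M) {e : OpenPartialHomeomorph M (Euc n)}
    (he : e ∈ atlas (Euc n) M) : ContDiffOn ℝ ∞ (pullMetric g e.symm) e.target :=
  contDiffOn_pullMetric g e.open_target (contMDiffOn_chart_symm he)

lemma coordMetric_pos (g : Metric n M) {e : OpenPartialHomeomorph M (Euc n)}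
    (he : e ∈ atlas (Euc n) M) : ∀ y ∈ e.target, ∀ v, v ≠ 0 → 0 < pullMetric g e.symm y v v :=
  fun _ hy => pullMetric_pos g (tderiv_chart_symm_bijective he hy).1

lemma tderiv_chart_symm_apply {e : OpenPartialHomeomorph M (Euc n)}
    (he : e ∈ atlas (Euc n) M) {x : M} (hx : x ∈ e.source) (v : Euc n) :
    tderiv n e.symm (e x) (tderiv n e x v) = v :=
  DFunLike.congr_fun (tderiv_chart_symm_comp he hx) v

lemma tderiv_chart_apply_symm {e : OpenPartialHomeomorph M (Euc n)}
    (he : e ∈ atlas (Euc n) M) {y : Euc n} (hy : y ∈ e.target) (v : Euc n) :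
    tderiv n e (e.symm y) (tderiv n e.symm y v) = v :=
  DFunLike.congr_fun (tderiv_chart_comp_symm he hy) v

lemma pullMetric_chart (g : Metric n M) {e : OpenPartialHomeomorph M (Euc n)}
    (he : e ∈ atlas (Euc n) M) {x : M} (hx : x ∈ e.source) (u v : Euc n) :
    pullMetric g e.symm (e x) (tderiv n e x u) (tderiv n e x v) = metricAt g x u v := by
  rw [pullMetric_apply, tderiv_chart_symm_apply he hx, tderiv_chart_symm_apply he hx,
    e.left_inv hx]

/-- The square of the speed of a curve. -/
def speedSq (g : Metric n M) (c : ℝ → M) (t : ℝ) : ℝ :=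
  metricAt g (c t) (velocity n c t) (velocity n c t)

lemma speedSq_eq_pullMetric (g : Metric n M) {e : OpenPartialHomeomorph M (Euc n)}
    (he : e ∈ atlas (Euc n) M) {c : ℝ → M} {t : ℝ} (ht : c t ∈ e.source)
    (hc : MDifferentiableAt 𝓘(ℝ, ℝ) (𝓡 n) c t) :
    speedSq g c t = pullMetric g e.symm (e (c t)) (deriv (fun s => e (c s)) t)
      (deriv (fun s => e (c s)) t) := by
  rw [deriv_chart_comp he ht hc, pullMetric_chart g he ht, speedSq]

lemma eventually_mdifferentiableAt {c : ℝ → M} {t : ℝ}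
    (hc : ContMDiffAt 𝓘(ℝ, ℝ) (𝓡 n) 2 c t) :
    ∀ᶠ s in 𝓝 t, MDifferentiableAt 𝓘(ℝ, ℝ) (𝓡 n) c s := by
  have : IsManifold (𝓡 n) 2 M := IsManifold.of_le (n := ∞) (by norm_cast)
  filter_upwards [(contMDiffAt_iff_contMDiffAt_nhds (by norm_num)).1 hc] with s hs
    using hs.mdifferentiableAt (by simp)

/-- Geodesics have constant speed. -/
lemma IsGeodesicAt.hasDerivAt_speedSq {g : Metric n M} {c : ℝ → M} {t : ℝ}
    (h : IsGeodesicAt g c t) : HasDerivAt (speedSq g c) 0 t := by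
  set e := chartAt (Euc n) (c t)
  have he : e ∈ atlas (Euc n) M := chart_mem_atlas (Euc n) (c t)
  have ht : c t ∈ e.source := mem_chart_source (Euc n) (c t)
  have h1 := GeodesicEq.hasDerivAt_speed (G := pullMetric g e.symm) (x := fun s => e (c s)) (t := t)
    (((coordMetric_contDiffOn g he).contDiffAt
      (e.open_target.mem_nhds (e.map_source ht))).differentiableAt (by simp))
    (fun v w => pullMetric_symm g _ _ _ _) (contDiffAt_chart_comp (k := 2) he ht h.1) (h.2 e he ht)
  refine h1.congr_of_eventuallyEq ?_
  filter_upwards [eventually_mdifferentiableAt h.1,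
    h.1.continuousAt.eventually_mem (e.open_source.mem_nhds ht)] with s hs hs'
  exact speedSq_eq_pullMetric g he hs' hs

lemma speedSq_eq_of_isGeodesicAt {g : Metric n M} {c : ℝ → M} {a b s t : ℝ}
    (h : ∀ r ∈ Ioo a b, IsGeodesicAt g c r) (hs : s ∈ Ioo a b) (ht : t ∈ Ioo a b) :
    speedSq g c s = speedSq g c t := by
  refine isOpen_Ioo.is_const_of_deriv_eq_zero isPreconnected_Ioo
    (fun r hr => (h r hr).hasDerivAt_speedSq.differentiableAt.differentiableWithinAt)
    (fun r hr => (h r hr).hasDerivAt_speedSq.deriv) hs ht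

/-- Two geodesics with the same velocity at some time agree near that time. -/
lemma isGeodesicAt_eventuallyEq {g : Metric n M} {c₁ c₂ : ℝ → M} {t : ℝ}
    (h₁ : ∀ᶠ s in 𝓝 t, IsGeodesicAt g c₁ s) (h₂ : ∀ᶠ s in 𝓝 t, IsGeodesicAt g c₂ s)
    (h0 : c₁ t = c₂ t) (h1 : velocity n c₁ t = velocity n c₂ t) : c₁ =ᶠ[𝓝 t] c₂ := by
  set e := chartAt (Euc n) (c₁ t)
  have he : e ∈ atlas (Euc n) M := chart_mem_atlas (Euc n) (c₁ t)
  have ht₁ : c₁ t ∈ e.source := mem_chart_source (Euc n) (c₁ t)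
  have ht₂ : c₂ t ∈ e.source := h0 ▸ ht₁
  have hc₁ := h₁.self_of_nhds
  have hc₂ := h₂.self_of_nhds
  have hm₁ := hc₁.1.continuousAt.eventually_mem (e.open_source.mem_nhds ht₁)
  have hm₂ := hc₂.1.continuousAt.eventually_mem (e.open_source.mem_nhds ht₂)
  have key := geodesicEq_unique (x₁ := fun s => e (c₁ s)) (x₂ := fun s => e (c₂ s)) (t := t)
    e.open_target (coordMetric_contDiffOn g he)
    (coordMetric_pos g he) (contDiffAt_chart_comp (k := 2) he ht₁ hc₁.1)
    (contDiffAt_chart_comp (k := 2) he ht₂ hc₂.1)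
    (by filter_upwards [h₁, hm₁] with s hs hs' using hs.2 e he hs')
    (by filter_upwards [h₂, hm₂] with s hs hs' using hs.2 e he hs')
    (e.map_source ht₁) (by simp only [h0]) (by
      rw [deriv_chart_comp he ht₁ hc₁.mdifferentiableAt,
        deriv_chart_comp he ht₂ hc₂.mdifferentiableAt, h0, h1])
  filter_upwards [key, hm₁, hm₂] with s hs hs₁ hs₂ using e.injOn hs₁ hs₂ hs

/-- Two geodesics which agree near times arbitrarily close to `t` agree near `t`: by continuity, their
positions and velocities at `t` agree. -/
lemma isGeodesicAt_eventuallyEq_of_frequently [T2Space M] {g : Metric n M} {c₁ c₂ : ℝ → M} {t : ℝ}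
    (h₁ : ∀ᶠ s in 𝓝 t, IsGeodesicAt g c₁ s) (h₂ : ∀ᶠ s in 𝓝 t, IsGeodesicAt g c₂ s)
    (h : ∃ᶠ s in 𝓝 t, c₁ =ᶠ[𝓝 s] c₂) : c₁ =ᶠ[𝓝 t] c₂ := by
  have hc₁ := h₁.self_of_nhds
  have hc₂ := h₂.self_of_nhds
  have h0 : c₁ t = c₂ t := by
    by_contra hne
    obtain ⟨s, hs, hs'⟩ := (h.and_eventually
      ((hc₁.1.continuousAt.prodMk hc₂.1.continuousAt).eventually_mem
        (isClosed_diagonal.isOpen_compl.mem_nhds (by simpa using hne)))).exists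
    exact hs' hs.self_of_nhds
  set e := chartAt (Euc n) (c₁ t)
  have he : e ∈ atlas (Euc n) M := chart_mem_atlas (Euc n) (c₁ t)
  have ht₁ : c₁ t ∈ e.source := mem_chart_source (Euc n) (c₁ t)
  have ht₂ : c₂ t ∈ e.source := h0 ▸ ht₁
  have hd : ∀ {c : ℝ → M}, IsGeodesicAt g c t → c t ∈ e.source →
      ContinuousAt (deriv fun s => e (c s)) t := fun hc ht =>
    (((contDiffAt_chart_comp (k := 2) he ht hc.1).fderiv_right (m := 1) (by norm_num)).clm_apply
      (contDiffAt_const (c := (1 : ℝ)))).continuousAt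
  have h1 : deriv (fun s => e (c₁ s)) t = deriv (fun s => e (c₂ s)) t := by
    by_contra hne
    obtain ⟨s, hs, hs'⟩ := (h.and_eventually
      (((hd hc₁ ht₁).prodMk (hd hc₂ ht₂)).eventually_mem
        (isClosed_diagonal.isOpen_compl.mem_nhds (by simpa using hne)))).exists
    refine hs' (EventuallyEq.deriv_eq ?_)
    filter_upwards [hs] with r hr
    rw [hr]
  rw [deriv_chart_comp he ht₁ hc₁.mdifferentiableAt,
    deriv_chart_comp he ht₂ hc₂.mdifferentiableAt, ← h0] at h1
  exact isGeodesicAt_eventuallyEq h₁ h₂ h0 ((tderiv_chart_bijective he ht₁).1 h1)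

/-- A geodesic is determined by its position and velocity at one time. -/
lemma isGeodesicAt_eqOn [T2Space M] {g : Metric n M} {c₁ c₂ : ℝ → M} {s : Set ℝ}
    (hso : IsOpen s) (hs : IsPreconnected s) (h₁ : ∀ r ∈ s, IsGeodesicAt g c₁ r)
    (h₂ : ∀ r ∈ s, IsGeodesicAt g c₂ r) {t : ℝ} (ht : t ∈ s) (h0 : c₁ t = c₂ t)
    (h1 : velocity n c₁ t = velocity n c₂ t) : ∀ r ∈ s, c₁ =ᶠ[𝓝 r] c₂ := by
  have e₁ : ∀ r ∈ s, ∀ᶠ s in 𝓝 r, IsGeodesicAt g c₁ s := fun r hr => by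
    filter_upwards [hso.mem_nhds hr] using h₁
  have e₂ : ∀ r ∈ s, ∀ᶠ s in 𝓝 r, IsGeodesicAt g c₂ s := fun r hr => by
    filter_upwards [hso.mem_nhds hr] using h₂
  refine hs.subset_of_closure_inter_subset (u := {r | c₁ =ᶠ[𝓝 r] c₂}) ?_ ?_ ?_
  · exact isOpen_iff_mem_nhds.2 fun r hr => eventually_eventually_nhds.2 hr
  · exact ⟨t, ht, isGeodesicAt_eventuallyEq (e₁ t ht) (e₂ t ht) h0 h1⟩
  · rintro r ⟨hr, hrs⟩
    exact isGeodesicAt_eventuallyEq_of_frequently (e₁ r hrs) (e₂ r hrs)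
      (mem_closure_iff_frequently.1 hr)

lemma IsGeodesicAt.comp_affine {g : Metric n M} {c : ℝ → M} {a b t : ℝ}
    (h : IsGeodesicAt g c (a * t + b)) : IsGeodesicAt g (fun s => c (a * s + b)) t := by
  have haff : ContDiff ℝ 2 (fun s : ℝ => a * s + b) := by fun_prop
  refine ⟨ContMDiffAt.comp (x := t) (f := fun s : ℝ => a * s + b) (g := c) h.1
    haff.contMDiff.contMDiffAt, fun e he ht => ?_⟩
  have hx := contDiffAt_chart_comp (k := 2) he ht h.1
  have h2 := h.2 e he ht
  have hH : DifferentiableAt ℝ (pullMetric g e.symm) (e (c (a * t + b))) :=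
    ((coordMetric_contDiffOn g he).contDiffAt
      (e.open_target.mem_nhds (e.map_source ht))).differentiableAt (by simp)
  have hs : ∀ (f : ℝ → Euc n) (s : ℝ), deriv (fun r => f (a * r + b)) s
      = a • deriv f (a * s + b) := by
    intro f s
    have := deriv_comp_mul_left a (fun r => f (r + b)) s
    rw [this, deriv_comp_add_const]
  intro w
  have h3 := h2 w
  have h4 : deriv (deriv fun s => e (c (a * s + b))) t
      = a • a • deriv (deriv fun s => e (c s)) (a * t + b) := by
    have : (deriv fun s => e (c (a * s + b))) = fun s => a • deriv (fun s => e (c s)) (a * s + b) :=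
      funext fun s => hs (fun s => e (c s)) s
    rw [this, deriv_fun_const_smul_field, hs (deriv fun s => e (c s)) t]
  rw [coordMetric_eq, h4, hs (fun s => e (c s)) t]
  rw [coordMetric_eq] at h3
  simp only [eulerLagrange_clm hH] at h3 ⊢
  simp only [map_smul, smul_apply, smul_eq_mul] at h3 ⊢
  linear_combination a ^ 2 * h3

/-- Two geodesics which agree to first order at the time `t₁` can be concatenated there. -/
lemma glue_isGeodesicAt {g : Metric n M} {c d : ℝ → M} {t₁ : ℝ}
    (hc : ∀ᶠ s in 𝓝 t₁, IsGeodesicAt g c s) (hd : ∀ᶠ s in 𝓝 t₁, IsGeodesicAt g d s)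
    (h0 : c t₁ = d t₁) (h1 : velocity n c t₁ = velocity n d t₁) :
    ∃ b : ℝ → M, (∀ t ≤ t₁, b =ᶠ[𝓝 t] c) ∧ ∀ t, t₁ ≤ t → b =ᶠ[𝓝 t] d := by
  have hcd := isGeodesicAt_eventuallyEq hc hd h0 h1
  refine ⟨fun t => if t < t₁ then c t else d t, fun t ht => ?_, fun t ht => ?_⟩
  · rcases ht.lt_or_eq with ht | rfl
    · filter_upwards [Iio_mem_nhds ht] with s hs
      exact if_pos hs
    · filter_upwards [hcd] with s hs
      simp [hs]
  · rcases ht.lt_or_eq with ht | rfl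
    · filter_upwards [Ioi_mem_nhds ht] with s hs
      exact if_neg (not_lt.2 (le_of_lt hs))
    · filter_upwards [hcd] with s hs
      simp [hs]

end GeodesicFlow

/-! ### Local existence of geodesics and smooth dependence on the initial vector -/

/-- Near a point, a continuous family of inner products dominates the norm. -/
lemma exists_mul_norm_sq_le {E : Type*} [NormedAddCommGroup E] [NormedSpace ℝ E]
    [FiniteDimensional ℝ E] {X : Type*} [TopologicalSpace X] {G : X → E →L[ℝ] E →L[ℝ] ℝ} {y₀ : X}
    (hG : ContinuousAt G y₀) (hpos : ∀ v, v ≠ 0 → 0 < G y₀ v v) :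
    ∃ c > 0, ∀ᶠ y in 𝓝 y₀, ∀ w, c * ‖w‖ ^ 2 ≤ G y w w := by
  obtain ⟨m, hm, hmle⟩ : ∃ m > 0, ∀ w ∈ Metric.sphere (0 : E) 1, m ≤ G y₀ w w := by
    rcases (Metric.sphere (0 : E) 1).eq_empty_or_nonempty with h | h
    · exact ⟨1, one_pos, fun w hw => by simp [h] at hw⟩
    · obtain ⟨w, hw, hmin⟩ := (isCompact_sphere (0 : E) 1).exists_isMinOn h
        (f := fun w => G y₀ w w) (by fun_prop)
      exact ⟨G y₀ w w, hpos w (by rintro rfl; simp at hw), fun w' hw' => hmin hw'⟩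
  refine ⟨m / 2, half_pos hm, ?_⟩
  have h : ∀ᶠ y in 𝓝 y₀, ‖G y - G y₀‖ < m / 2 := by
    have := (Metric.tendsto_nhds.1 hG) (m / 2) (half_pos hm)
    simpa only [dist_eq_norm] using this
  filter_upwards [h] with y hy w
  have h1 : m * ‖w‖ ^ 2 ≤ G y₀ w w := by
    rcases eq_or_ne w 0 with rfl | hw
    · simp
    · have hn : ‖w‖ ≠ 0 := norm_ne_zero_iff.2 hw
      have := hmle (‖w‖⁻¹ • w) (by simp [norm_smul, hn])
      simp only [map_smul, smul_apply, smul_eq_mul] at this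
      have h2 : G y₀ w w = ‖w‖ ^ 2 * (‖w‖⁻¹ * (‖w‖⁻¹ * G y₀ w w)) := by field_simp
      rw [h2, mul_comm]
      gcongr
  have h2 : |(G y - G y₀) w w| ≤ m / 2 * ‖w‖ ^ 2 := by
    calc |(G y - G y₀) w w| ≤ ‖G y - G y₀‖ * ‖w‖ * ‖w‖ := (G y - G y₀).le_opNorm₂ w w
      _ ≤ m / 2 * ‖w‖ * ‖w‖ := by gcongr
      _ = _ := by ring
  have h3 : (G y - G y₀) w w = G y w w - G y₀ w w := by simp
  rw [h3] at h2
  linarith [(abs_le.1 h2).1]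

section GeodesicFlow

variable {n : ℕ} {M : Type u} [TopologicalSpace M] [ChartedSpace (Euc n) M]
  [IsManifold (𝓡 n) ∞ M]

/-- The family of tangent vectors `b v` at the points `a v` depends `C^k` on `v` near `v₀`. This is
expressed in all charts rather than as smoothness of a map to the tangent bundle, since geodesics
are constructed in charts. -/
def SmoothFamilyAt (k : ℕ) (a : Euc n → M) (b : Euc n → Euc n) (v₀ : Euc n) : Prop :=
  ContinuousAt a v₀ ∧ ∀ e ∈ atlas (Euc n) M, a v₀ ∈ e.source →
    ContDiffAt ℝ k (fun v => (e (a v), tderiv n e (a v) (b v))) v₀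

/-- The smoothness of a family of tangent vectors can be checked in a single chart. -/
lemma SmoothFamilyAt.of_chart {k : ℕ} {a : Euc n → M} {b : Euc n → Euc n} {v₀ : Euc n}
    (ha : ContinuousAt a v₀) {e : OpenPartialHomeomorph M (Euc n)} (he : e ∈ atlas (Euc n) M)
    (hv₀ : a v₀ ∈ e.source)
    (h : ContDiffAt ℝ k (fun v => (e (a v), tderiv n e (a v) (b v))) v₀) :
    SmoothFamilyAt k a b v₀ := by
  refine ⟨ha, fun e' he' hv₀' => ?_⟩
  set φ : Euc n → Euc n := fun y => e' (e.symm y)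
  have hφ : ContDiffAt ℝ ∞ φ (e (a v₀)) := contMDiffAt_iff_contDiffAt.1
    (ContMDiffAt.comp (e (a v₀)) (contMDiffAt_chart he' (by rwa [e.left_inv hv₀]))
      (contMDiffAt_chart_symm he (e.map_source hv₀)))
  have h1 : ContDiffAt ℝ k (fun v => e (a v)) v₀ := h.fst
  have h2 : ContDiffAt ℝ k (fun v => tderiv n e (a v) (b v)) v₀ := h.snd
  have h3 : ContDiffAt ℝ k (fun v => fderiv ℝ φ (e (a v))) v₀ :=
    ContDiffAt.comp v₀ (g := fderiv ℝ φ) (f := fun v => e (a v))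
      (hφ.fderiv_right (m := k) (by exact_mod_cast le_top)) h1
  have h4 : ContDiffAt ℝ k (fun v => φ (e (a v))) v₀ :=
    ContDiffAt.comp v₀ (g := φ) (f := fun v => e (a v)) (hφ.of_le (by exact_mod_cast le_top)) h1
  refine (h4.prodMk (h3.clm_apply h2)).congr_of_eventuallyEq ?_
  filter_upwards [ha.eventually_mem (e.open_source.mem_nhds hv₀),
    ha.eventually_mem (e'.open_source.mem_nhds hv₀')] with v hv hv'
  have h5 : fderiv ℝ φ (e (a v)) = (tderiv n e' (a v)).comp (tderiv n e.symm (e (a v))) := by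
    rw [← tderiv_eq_fderiv]
    have := tderiv_comp (n := n) (f := e.symm) (h := e') (x := e (a v))
      ((contMDiffAt_chart he' (by rwa [e.left_inv hv])).mdifferentiableAt (by simp))
      ((contMDiffAt_chart_symm he (e.map_source hv)).mdifferentiableAt (by simp))
    rw [e.left_inv hv] at this
    exact this
  simp only [h5, ContinuousLinearMap.comp_apply, tderiv_chart_symm_apply he hv, φ, e.left_inv hv]

lemma SmoothFamilyAt.contMDiffAt {k : ℕ} {a : Euc n → M} {b : Euc n → Euc n} {v₀ : Euc n}
    (h : SmoothFamilyAt k a b v₀) : ContMDiffAt (𝓡 n) (𝓡 n) k a v₀ := by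
  set e := chartAt (Euc n) (a v₀)
  have he : e ∈ atlas (Euc n) M := chart_mem_atlas (Euc n) (a v₀)
  have hv₀ : a v₀ ∈ e.source := mem_chart_source (Euc n) (a v₀)
  have h1 : ContDiffAt ℝ k (fun v => e (a v)) v₀ := (h.2 e he hv₀).fst
  refine (ContMDiffAt.comp (x := v₀) (g := e.symm) (f := fun v => e (a v))
    ((contMDiffAt_chart_symm he (e.map_source hv₀)).of_le (by exact_mod_cast le_top))
    h1.contMDiffAt).congr_of_eventuallyEq ?_
  filter_upwards [h.1.eventually_mem (e.open_source.mem_nhds hv₀)] with v hv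
  exact (e.left_inv hv).symm

lemma SmoothFamilyAt.congr {k : ℕ} {a a' : Euc n → M} {b b' : Euc n → Euc n} {v₀ : Euc n}
    (h : SmoothFamilyAt k a b v₀) (hab : ∀ᶠ v in 𝓝 v₀, a v = a' v ∧ b v = b' v) :
    SmoothFamilyAt k a' b' v₀ := by
  refine ⟨h.1.congr (hab.mono fun v hv => hv.1), fun e he hv₀ => ?_⟩
  rw [← hab.self_of_nhds.1] at hv₀
  refine (h.2 e he hv₀).congr_of_eventuallyEq ?_
  filter_upwards [hab] with v hv
  rw [hv.1, hv.2]

/-- For initial vectors near the vector `v` at `p`, the geodesics exist on the time interval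
`(-2, 2)` and their velocity at time `1` depends `C^k` on the initial vector. In order to iterate
the flow, this is formulated for arbitrary `C^k` families `(a, b)` of initial vectors passing
through `(p, v)`. -/
def FlowsAt (g : Metric n M) (k : ℕ) (p : M) (v : Euc n) : Prop :=
  ∀ (a : Euc n → M) (b : Euc n → Euc n) (v₀ : Euc n), a v₀ = p → b v₀ = v →
    SmoothFamilyAt k a b v₀ → ∃ c : Euc n → ℝ → M,
      (∀ᶠ w in 𝓝 v₀, (∀ t ∈ Ioo (-2 : ℝ) 2, IsGeodesicAt g (c w) t) ∧ c w 0 = a w ∧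
        velocity n (c w) 0 = b w) ∧
      SmoothFamilyAt k (fun w => c w 1) (fun w => velocity n (c w) 1) v₀

/-- A solution of the first order geodesic system in a chart is a geodesic. -/
lemma isGeodesicAt_of_chart {g : Metric n M} {e : OpenPartialHomeomorph M (Euc n)}
    (he : e ∈ atlas (Euc n) M) {A : Euc n × Euc n → Euc n}
    (hA : ContDiffOn ℝ ∞ A (e.target ×ˢ univ))
    (hAeq : ∀ y ∈ e.target, ∀ a v,
      (∀ w, eulerLagrange (fun z u u' => pullMetric g e.symm z u u') y a v w = 0) ↔ a = A (y, v))
    {z : ℝ → Euc n × Euc n} {t : ℝ}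
    (hz : ∀ᶠ s in 𝓝 t, HasDerivAt z ((z s).2, A (z s)) s ∧ (z s).1 ∈ e.target) :
    IsGeodesicAt g (fun s => e.symm (z s).1) t ∧
      velocity n (fun s => e.symm (z s).1) t = tderiv n e.symm (z t).1 (z t).2 := by
  obtain ⟨h1, h2, h3⟩ := geodesicEq_of_hasDerivAt hA hAeq hz
  have hmem := hz.self_of_nhds.2
  refine ⟨(isGeodesicAt_comp_iff g e.open_target (contMDiffOn_chart_symm he) h1 hmem
    (tderiv_chart_symm_bijective he hmem).2).2 h3, ?_⟩
  rw [← h2, ← velocity_eq_deriv]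
  exact velocity_comp (f := e.symm) (c := fun s => (z s).1)
    ((contMDiffAt_chart_symm he hmem).mdifferentiableAt (by simp))
    (h1.differentiableAt (by simp)).mdifferentiableAt

/-- Local existence of geodesics and their smooth dependence on the initial vector. -/
lemma exists_flowsAt (g : Metric n M) (k : ℕ) (p₀ : M) :
    ∃ U ∈ 𝓝 p₀, ∃ δ > 0, ∀ p ∈ U, ∀ v, metricAt g p v v < δ → FlowsAt g k p v := by
  set e := chartAt (Euc n) p₀
  have he : e ∈ atlas (Euc n) M := chart_mem_atlas (Euc n) p₀
  have hp₀ : p₀ ∈ e.source := mem_chart_source (Euc n) p₀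
  obtain ⟨A, hA, hAeq⟩ := exists_spray e.open_target (coordMetric_contDiffOn g he)
    (coordMetric_pos g he)
  have hF : ContDiffOn ℝ ∞ (fun z : Euc n × Euc n => (z.2, A z)) (e.target ×ˢ univ) :=
    contDiff_snd.contDiffOn.prodMk hA
  obtain ⟨ε, hε, Φ, hΦ, hΦs⟩ := exists_flow k (z₀ := (e p₀, (0 : Euc n)))
    ((e.open_target.prod isOpen_univ).mem_nhds ⟨e.map_source hp₀, mem_univ _⟩) hF
  obtain ⟨c, hc, hcle⟩ := exists_mul_norm_sq_le (y₀ := e p₀) (G := pullMetric g e.symm)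
    ((coordMetric_contDiffOn g he).continuousOn.continuousAt
      (e.open_target.mem_nhds (e.map_source hp₀)))
    (coordMetric_pos g he _ (e.map_source hp₀))
  -- Geodesics on `(-2, 2)` with initial vector `v` are those on `(-ε, ε)` with initial vector
  -- `s⁻¹ • v`, run at the speed `s`.
  set s : ℝ := ε / 2 with hs
  have hs0 : 0 < s := half_pos hε
  have hpe : ContinuousAt e p₀ := e.continuousAt hp₀
  refine ⟨{p | p ∈ e.source ∧ (∀ w, c * ‖w‖ ^ 2 ≤ pullMetric g e.symm (e p) w w) ∧
    e p ∈ Metric.ball (e p₀) ε}, ?_, c * (ε * s) ^ 2, by positivity, ?_⟩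
  · filter_upwards [e.open_source.mem_nhds hp₀, hpe.eventually hcle,
      hpe.eventually_mem (Metric.ball_mem_nhds _ hε)] with p h1 h2 h3 using ⟨h1, h2, h3⟩
  rintro p ⟨hp, hpc, hpε⟩ v hv a b v₀ rfl rfl hab
  have hsm := hab.2 e he hp
  set z : Euc n → Euc n × Euc n := fun w => (e (a w), s⁻¹ • tderiv n e (a w) (b w)) with hz
  have hzs : ContDiffAt ℝ k z v₀ := hsm.fst.prodMk (hsm.snd.const_smul s⁻¹)
  have hz0 : z v₀ ∈ Metric.ball (e p₀, (0 : Euc n)) ε := by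
    rw [← ball_prod_same]
    refine ⟨hpε, ?_⟩
    have h1 := hpc (tderiv n e (a v₀) (b v₀))
    rw [pullMetric_chart g he hp] at h1
    have h2 : ‖tderiv n e (a v₀) (b v₀)‖ ^ 2 < (ε * s) ^ 2 :=
      lt_of_mul_lt_mul_left (h1.trans_lt hv) hc.le
    have h3 := lt_of_pow_lt_pow_left₀ 2 (by positivity) h2
    rw [mem_ball_zero_iff, norm_smul, norm_inv, Real.norm_of_nonneg hs0.le,
      inv_mul_lt_iff₀ hs0, mul_comm]
    exact h3
  have hgood : ∀ᶠ w in 𝓝 v₀, a w ∈ e.source ∧ z w ∈ Metric.ball (e p₀, (0 : Euc n)) ε :=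
    (hab.1.eventually_mem (e.open_source.mem_nhds hp)).and
      (hzs.continuousAt.eventually_mem (Metric.isOpen_ball.mem_nhds hz0))
  have hIoo : ∀ t ∈ Ioo (-2 : ℝ) 2, s * t + 0 ∈ Ioo (-ε) ε := by
    rintro t ⟨h1, h2⟩
    constructor <;> rw [hs] <;> nlinarith
  have hgeo : ∀ w, z w ∈ Metric.ball (e p₀, (0 : Euc n)) ε → ∀ t ∈ Ioo (-ε) ε,
      IsGeodesicAt g (fun r => e.symm (Φ (z w) r).1) t ∧
        velocity n (fun r => e.symm (Φ (z w) r).1) t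
          = tderiv n e.symm (Φ (z w) t).1 (Φ (z w) t).2 := by
    intro w hw t ht
    refine isGeodesicAt_of_chart he hA hAeq (z := Φ (z w)) ?_
    filter_upwards [isOpen_Ioo.mem_nhds ht] with r hr
    exact ⟨((hΦ _ hw).2 r hr).1, ((hΦ _ hw).2 r hr).2.1⟩
  have hvel : ∀ w, z w ∈ Metric.ball (e p₀, (0 : Euc n)) ε → ∀ t ∈ Ioo (-2 : ℝ) 2,
      velocity n (fun r => e.symm (Φ (z w) (s * r + 0)).1) t
        = s • tderiv n e.symm (Φ (z w) (s * t + 0)).1 (Φ (z w) (s * t + 0)).2 := by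
    intro w hw t ht
    have := hgeo w hw _ (hIoo t ht)
    rw [← this.2]
    exact velocity_comp_scale (c := fun r => e.symm (Φ (z w) r).1) this.1.mdifferentiableAt
  refine ⟨fun w t => e.symm (Φ (z w) (s * t + 0)).1, ?_, ?_⟩
  · filter_upwards [hgood] with w hw
    have h0 : s * 0 + 0 = (0 : ℝ) := by ring
    refine ⟨fun t ht => (hgeo w hw.2 _ (hIoo t ht)).1.comp_affine, ?_, ?_⟩
    · simp only [h0, (hΦ _ hw.2).1]
      exact e.left_inv hw.1
    · rw [hvel w hw.2 0 (by norm_num), h0, (hΦ _ hw.2).1]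
      simp only [hz, map_smul, smul_smul, mul_inv_cancel₀ hs0.ne', one_smul]
      exact tderiv_chart_symm_apply he hw.1 _
  · have h1mem : (1 : ℝ) ∈ Ioo (-2 : ℝ) 2 := by norm_num
    have hΦ1 : ContDiffAt ℝ k (fun w => Φ (z w) (s * 1 + 0)) v₀ :=
      ContDiffAt.comp v₀ (g := fun y => Φ y (s * 1 + 0)) (f := z)
        ((hΦs _ (hIoo 1 h1mem)).contDiffAt (Metric.isOpen_ball.mem_nhds hz0)) hzs
    have hmem : ∀ w, z w ∈ Metric.ball (e p₀, (0 : Euc n)) ε →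
        (Φ (z w) (s * 1 + 0)).1 ∈ e.target := fun w hw =>
      ((hΦ _ hw).2 _ (hIoo 1 h1mem)).2.1
    refine SmoothFamilyAt.of_chart (e := e) ?_ he (e.map_target (hmem _ hz0)) ?_
    · exact ContinuousAt.comp (g := e.symm) (f := fun w => (Φ (z w) (s * 1 + 0)).1)
        (e.symm.continuousAt (hmem _ hz0)) hΦ1.continuousAt.fst
    · refine (hΦ1.fst.prodMk (hΦ1.snd.const_smul s)).congr_of_eventuallyEq ?_
      filter_upwards [hgood] with w hw
      have hm := hmem w hw.2
      simp only [hvel w hw.2 1 h1mem, map_smul, tderiv_chart_apply_symm he hm, e.right_inv hm]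

variable [CompactSpace M]

/-- On a compact manifold, geodesics with small initial vectors exist for a uniform time. -/
lemma exists_uniform_flowsAt (g : Metric n M) (k : ℕ) :
    ∃ δ > 0, ∀ p v, metricAt g p v v < δ → FlowsAt g k p v := by
  have := isCompact_univ.induction_on
    (p := fun s : Set M => ∃ δ > 0, ∀ p ∈ s, ∀ v, metricAt g p v v < δ → FlowsAt g k p v)
    ⟨1, one_pos, by simp⟩ (fun s t hst ⟨δ, hδ, h⟩ => ⟨δ, hδ, fun p hp => h p (hst hp)⟩)
    (fun s t ⟨δ, hδ, h⟩ ⟨δ', hδ', h'⟩ => ⟨min δ δ', lt_min hδ hδ', fun p hp v hv =>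
      hp.elim (fun hp => h p hp v (hv.trans_le (min_le_left _ _)))
        fun hp => h' p hp v (hv.trans_le (min_le_right _ _))⟩)
    (fun p _ => by
      obtain ⟨U, hU, h⟩ := exists_flowsAt g k p
      exact ⟨U, mem_nhdsWithin_of_mem_nhds hU, h⟩)
  obtain ⟨δ, hδ, h⟩ := this
  exact ⟨δ, hδ, fun p v => h p (mem_univ p) v⟩

end GeodesicFlow

/-! ### Geodesic completeness and smoothness of the exponential map -/

section ExponentialMap

variable {n : ℕ} {M : Type u} [TopologicalSpace M] [ChartedSpace (Euc n) M]
  [IsManifold (𝓡 n) ∞ M]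

lemma FlowsAt.exists_geodesic {g : Metric n M} {k : ℕ} {p : M} {v : Euc n}
    (h : FlowsAt g k p v) :
    ∃ c : ℝ → M, (∀ t ∈ Ioo (-2 : ℝ) 2, IsGeodesicAt g c t) ∧ c 0 = p ∧ velocity n c 0 = v := by
  obtain ⟨c, hc, -⟩ := h (fun _ => p) (fun _ => v) 0 rfl rfl
    ⟨continuousAt_const, fun e he hp => contDiffAt_const⟩
  exact ⟨c 0, hc.self_of_nhds⟩

lemma initialVelocity_eq_iff {c : ℝ → M} {p : M} {v : Euc n} :
    initialVelocity c = (⟨p, v⟩ : TangentBundle (𝓡 n) M) ↔ c 0 = p ∧ velocity n c 0 = v := by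
  constructor
  · intro h
    exact ⟨congrArg Bundle.TotalSpace.proj h,
      congrArg (fun z : TangentBundle (𝓡 n) M => (z.2 : Euc n)) h⟩
  · rintro ⟨rfl, rfl⟩
    rfl

variable [T2Space M]

lemma IsGeodesic.eq_of_initial {g : Metric n M} {c d : ℝ → M} (hc : IsGeodesic g c)
    (hd : IsGeodesic g d) (h0 : c 0 = d 0) (h1 : velocity n c 0 = velocity n d 0) : c = d :=
  funext fun t => (isGeodesicAt_eqOn isOpen_univ isPreconnected_univ
    (fun r _ => isGeodesic_iff.1 hc r) (fun r _ => isGeodesic_iff.1 hd r) (mem_univ 0) h0 h1 t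
    (mem_univ t)).self_of_nhds

lemma expMap_eq {g : Metric n M} {c : ℝ → M} (hc : IsGeodesic g c) :
    expMap g (c 0) (velocity n c 0) = c 1 := by
  have hex : ∃ d : ℝ → M, IsGeodesic g d ∧
      initialVelocity d = (⟨c 0, velocity n c 0⟩ : TangentBundle (𝓡 n) M) := ⟨c, hc, rfl⟩
  have h := hex.choose_spec
  rw [initialVelocity_eq_iff] at h
  rw [expMap, dif_pos hex]
  exact congrFun (h.1.eq_of_initial hc h.2.1 h.2.2) 1

lemma isGeodesic_comp_mul {g : Metric n M} {c : ℝ → M} (hc : IsGeodesic g c) (a b : ℝ) :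
    IsGeodesic g (fun s => c (a * s + b)) :=
  isGeodesic_iff.2 fun _ => (isGeodesic_iff.1 hc _).comp_affine

lemma velocity_comp_mul {g : Metric n M} {c : ℝ → M} (hc : IsGeodesic g c) (a b t : ℝ) :
    velocity n (fun s => c (a * s + b)) t = a • velocity n c (a * t + b) :=
  velocity_comp_scale (isGeodesic_iff.1 hc _).mdifferentiableAt

lemma expMap_smul {g : Metric n M} {c : ℝ → M} (hc : IsGeodesic g c) (t : ℝ) :
    expMap g (c 0) (t • velocity n c 0) = c t := by
  have h := expMap_eq (isGeodesic_comp_mul hc t 0)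
  rw [velocity_comp_mul hc] at h
  simpa using h

variable [CompactSpace M]

/-- A geodesic with a small initial vector extends to arbitrarily large times. -/
lemma exists_geodesic_Ioo (g : Metric n M) {δ : ℝ}
    (hδ : ∀ p v, metricAt g p v v < δ → FlowsAt g 0 p v) {p : M} {v : Euc n}
    (hv : metricAt g p v v < δ) (m : ℕ) :
    ∃ c : ℝ → M, (∀ t ∈ Ioo (-2 : ℝ) (m + 2), IsGeodesicAt g c t) ∧ c 0 = p ∧
      velocity n c 0 = v := by
  induction m with
  | zero =>
    simpa using (hδ p v hv).exists_geodesic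
  | succ m ih =>
    obtain ⟨c, hc, hc0, hc1⟩ := ih
    have hm : (0 : ℝ) ≤ m := Nat.cast_nonneg m
    have h0 : (0 : ℝ) ∈ Ioo (-2 : ℝ) (m + 2) := ⟨by norm_num, by positivity⟩
    have h1 : (m + 1 : ℝ) ∈ Ioo (-2 : ℝ) (m + 2) := ⟨by linarith, by linarith⟩
    have hsp : speedSq g c (m + 1) < δ := by
      rw [speedSq_eq_of_isGeodesicAt hc h1 h0, speedSq, hc0, hc1]
      exact hv
    obtain ⟨d, hd, hd0, hd1⟩ := (hδ _ _ hsp).exists_geodesic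
    have hd' : ∀ t ∈ Ioo (m - 1 : ℝ) (m + 3), IsGeodesicAt g (fun s => d (1 * s + -(m + 1))) t :=
      fun t ht => (hd _ ⟨by linarith [ht.1], by linarith [ht.2]⟩).comp_affine
    have h1' : (m + 1 : ℝ) ∈ Ioo (m - 1 : ℝ) (m + 3) := ⟨by linarith, by linarith⟩
    have hz : (1 * (m + 1) + -(m + 1) : ℝ) = 0 := by ring
    obtain ⟨b, hb, hb'⟩ := glue_isGeodesicAt (t₁ := (m + 1 : ℝ))
      (c := c) (d := fun s => d (1 * s + -(m + 1)))
      (by filter_upwards [isOpen_Ioo.mem_nhds h1] using hc)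
      (by filter_upwards [isOpen_Ioo.mem_nhds h1'] using hd')
      (by simp only [hz, hd0]) (by
        rw [velocity_comp_scale (by rw [hz]; exact (hd 0 (by norm_num)).mdifferentiableAt), hz, hd1,
          one_smul])
    have hb0 := hb 0 (by positivity)
    refine ⟨b, fun t ht => ?_, hb0.self_of_nhds.trans hc0, (velocity_congr hb0).trans hc1⟩
    rcases le_total t (m + 1) with h | h
    · exact (hc t ⟨ht.1, by linarith⟩).congr (hb t h)
    · refine (hd' t ⟨by linarith, ?_⟩).congr (hb' t h)
      have := ht.2
      push_cast at this
      linarith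

/-- The geodesics on bounded intervals agree where they overlap, hence they can be joined to a
geodesic for all positive times. -/
lemma exists_geodesic_Ioi (g : Metric n M) {δ : ℝ}
    (hδ : ∀ p v, metricAt g p v v < δ → FlowsAt g 0 p v) {p : M} {v : Euc n}
    (hv : metricAt g p v v < δ) :
    ∃ c : ℝ → M, (∀ t ∈ Ioi (-2 : ℝ), IsGeodesicAt g c t) ∧ c 0 = p ∧ velocity n c 0 = v := by
  choose c hc hc0 hc1 using exists_geodesic_Ioo g hδ hv
  have key : ∀ m m' : ℕ, m ≤ m' → ∀ t ∈ Ioo (-2 : ℝ) (m + 2), c m =ᶠ[𝓝 t] c m' := by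
    intro m m' hm
    have hmm : (m : ℝ) ≤ m' := by exact_mod_cast hm
    exact isGeodesicAt_eqOn isOpen_Ioo isPreconnected_Ioo (hc m)
      (fun t ht => hc m' t ⟨ht.1, by linarith [ht.2]⟩)
      (t := 0) ⟨by norm_num, by positivity⟩ (by rw [hc0, hc0]) (by rw [hc1, hc1])
  -- The diagonal curve agrees near `t` with the member of the family of index `⌈t⌉₊ + 1`.
  have hloc : ∀ t ∈ Ioi (-2 : ℝ), (fun s => c ⌈s⌉₊ s) =ᶠ[𝓝 t] c (⌈t⌉₊ + 1) := by
    intro t ht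
    have ht1 : t < t + 1 := by linarith
    filter_upwards [Ioo_mem_nhds ht ht1] with s hs
    have hle : ⌈s⌉₊ ≤ ⌈t⌉₊ + 1 := by
      rw [Nat.ceil_le]
      push_cast
      linarith [hs.2, Nat.le_ceil t]
    exact (key _ _ hle s ⟨hs.1, by linarith [Nat.le_ceil s]⟩).self_of_nhds
  refine ⟨fun s => c ⌈s⌉₊ s, fun t ht => (hc (⌈t⌉₊ + 1) t ⟨ht, ?_⟩).congr (hloc t ht), ?_, ?_⟩
  · push_cast
    linarith [Nat.le_ceil t]
  · simp [hc0]
  · rw [velocity_congr (hloc 0 (by norm_num)), hc1]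

/-- Geodesic completeness of compact manifolds. For small initial vectors, a geodesic for positive
times is joined with the reverse of another one; the general case follows by rescaling time. -/
lemma exists_geodesic (g : Metric n M) (p : M) (v : Euc n) :
    ∃ c : ℝ → M, IsGeodesic g c ∧ c 0 = p ∧ velocity n c 0 = v := by
  obtain ⟨δ, hδ0, hδ⟩ := exists_uniform_flowsAt g 0
  have small : ∀ v, metricAt g p v v < δ →
      ∃ c : ℝ → M, IsGeodesic g c ∧ c 0 = p ∧ velocity n c 0 = v := by
    intro v hv
    obtain ⟨c, hc, hc0, hc1⟩ := exists_geodesic_Ioi g hδ hv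
    obtain ⟨d, hd, hd0, hd1⟩ := exists_geodesic_Ioi g hδ (p := p) (v := -v) (by simpa using hv)
    have h0 : (0 : ℝ) ∈ Ioi (-2 : ℝ) := by norm_num
    have h0' : (0 : ℝ) ∈ Iio (2 : ℝ) := by norm_num
    have hd' : ∀ t ∈ Iio (2 : ℝ), IsGeodesicAt g (fun s => d ((-1) * s + 0)) t := fun t ht =>
      (hd _ (by simp only [mem_Ioi, mem_Iio] at ht ⊢; linarith)).comp_affine
    obtain ⟨b, hb, hb'⟩ := glue_isGeodesicAt (t₁ := (0 : ℝ)) (c := fun s => d ((-1) * s + 0)) (d := c)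
      (by filter_upwards [isOpen_Iio.mem_nhds h0'] using hd')
      (by filter_upwards [isOpen_Ioi.mem_nhds h0] using hc) (by simp [hd0, hc0]) (by
        rw [velocity_comp_scale (by simpa using (hd 0 h0).mdifferentiableAt)]
        simp [hd1, hc1])
    refine ⟨b, isGeodesic_iff.2 fun t => ?_, (hb' 0 le_rfl).self_of_nhds.trans hc0,
      (velocity_congr (hb' 0 le_rfl)).trans hc1⟩
    rcases le_total t 0 with h | h
    · exact (hd' t (lt_of_le_of_lt h two_pos)).congr (hb t h)
    · exact (hc t (lt_of_lt_of_le (by norm_num) h)).congr (hb' t h)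
  obtain ⟨s, hs0, hs⟩ : ∃ s : ℝ, 0 < s ∧ metricAt g p (s • v) (s • v) < δ := by
    have : Tendsto (fun s : ℝ => metricAt g p (s • v) (s • v)) (𝓝[>] 0) (𝓝 0) := by
      have hc : Continuous fun s : ℝ => metricAt g p (s • v) (s • v) := by fun_prop
      simpa using (hc.tendsto 0).mono_left nhdsWithin_le_nhds
    obtain ⟨s, h1, h2⟩ := ((this.eventually (gt_mem_nhds hδ0)).and self_mem_nhdsWithin).exists
    exact ⟨s, h2, h1⟩
  obtain ⟨c, hc, hc0, hc1⟩ := small _ hs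
  refine ⟨fun t => c (s⁻¹ * t + 0), isGeodesic_comp_mul hc _ _, by simpa using hc0, ?_⟩
  rw [velocity_comp_mul hc]
  simp [hc1, smul_smul, hs0.ne']

/-- The geodesics starting at `p` are the images of the lines through the origin. -/
lemma isGeodesic_expMap (g : Metric n M) (p : M) (v : Euc n) :
    IsGeodesic g (fun t => expMap g p (t • v)) ∧ expMap g p 0 = p ∧
      velocity n (fun t => expMap g p (t • v)) 0 = v := by
  obtain ⟨c, hc, rfl, rfl⟩ := exists_geodesic g p v
  have h : (fun t => expMap g (c 0) (t • velocity n c 0)) = c := funext fun t => expMap_smul hc t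
  rw [h]
  exact ⟨hc, by simpa using expMap_smul hc 0, rfl⟩

/-- With `m` so large that `m⁻¹ • v₀` is small, `exp_p` near `v₀` is obtained from `v ↦ m⁻¹ • v` by
applying the time-one geodesic flow `m` times, which is `C^k` in each step. -/
lemma contMDiffAt_expMap (g : Metric n M) (p : M) (k : ℕ) (v₀ : Euc n) :
    ContMDiffAt (𝓡 n) (𝓡 n) k (expMap g p) v₀ := by
  obtain ⟨δ, hδ0, hδ⟩ := exists_uniform_flowsAt g k
  obtain ⟨m, hm0, hm⟩ : ∃ m : ℕ, 0 < m ∧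
      metricAt g p ((m : ℝ)⁻¹ • v₀) ((m : ℝ)⁻¹ • v₀) < δ := by
    have : Tendsto (fun m : ℕ => metricAt g p ((m : ℝ)⁻¹ • v₀) ((m : ℝ)⁻¹ • v₀)) atTop (𝓝 0) := by
      have hc : Continuous fun s : ℝ => metricAt g p (s • v₀) (s • v₀) := by fun_prop
      simpa [Function.comp_def] using (hc.tendsto 0).comp tendsto_inv_atTop_nhds_zero_nat
    obtain ⟨m, h1, h2⟩ := ((this.eventually (gt_mem_nhds hδ0)).and (eventually_gt_atTop 0)).exists
    exact ⟨m, h2, h1⟩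
  set γ : Euc n → ℝ → M := fun w t => expMap g p (t • (m : ℝ)⁻¹ • w) with hγ
  have hgeo : ∀ w, IsGeodesic g (γ w) := fun w => (isGeodesic_expMap g p _).1
  have key : ∀ j : ℕ, SmoothFamilyAt k (fun w => γ w j) (fun w => velocity n (γ w) j) v₀ := by
    intro j
    induction j with
    | zero =>
      have h0 : (fun w => γ w (0 : ℕ)) = fun _ => p := by
        funext w
        simpa [hγ] using (isGeodesic_expMap g p w).2.1
      have h1 : (fun w => velocity n (γ w) (0 : ℕ)) = fun w => (m : ℝ)⁻¹ • w := by
        funext w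
        simpa using (isGeodesic_expMap g p ((m : ℝ)⁻¹ • w)).2.2
      rw [h0, h1]
      exact ⟨continuousAt_const, fun e he hp => contDiffAt_const.prodMk
        ((tderiv n e p).contDiff.contDiffAt.comp v₀ (contDiffAt_id.const_smul _))⟩
    | succ j ih =>
      have hsp : speedSq g (γ v₀) j < δ := by
        have h0 : ∀ t : ℝ, t ∈ Ioo (-(j + 1) : ℝ) (j + 1) → IsGeodesicAt g (γ v₀) t :=
          fun t _ => isGeodesic_iff.1 (hgeo v₀) t
        rw [speedSq_eq_of_isGeodesicAt (t := 0) h0 ⟨by linarith [Nat.cast_nonneg (α := ℝ) j],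
          by linarith⟩ ⟨by linarith [Nat.cast_nonneg (α := ℝ) j], by positivity⟩, speedSq,
          (isGeodesic_expMap g p ((m : ℝ)⁻¹ • v₀)).2.2]
        have : γ v₀ 0 = p := by simpa [hγ] using (isGeodesic_expMap g p v₀).2.1
        rw [this]
        exact hm
      obtain ⟨c, hc, hcs⟩ := hδ _ _ hsp _ _ v₀ rfl rfl ih
      have hev : ∀ᶠ w in 𝓝 v₀, c w =ᶠ[𝓝 1] fun t => γ w (1 * t + j) := by
        filter_upwards [hc] with w hw
        refine isGeodesicAt_eqOn isOpen_Ioo isPreconnected_Ioo hw.1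
          (fun t _ => isGeodesic_iff.1 (isGeodesic_comp_mul (hgeo w) 1 j) t) (t := 0) (by norm_num)
          ?_ ?_ 1 (by norm_num)
        · simpa using hw.2.1
        · rw [velocity_comp_mul (hgeo w), hw.2.2]
          simp
      have hj : (1 * 1 + j : ℝ) = (j + 1 : ℕ) := by push_cast; ring
      refine SmoothFamilyAt.congr hcs ?_
      filter_upwards [hev] with w hw
      rw [hw.self_of_nhds, velocity_congr hw, velocity_comp_mul (hgeo w), hj, one_smul]
      exact ⟨congrArg (γ w) hj, rfl⟩
  have hfin := (key m).contMDiffAt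
  have hm' : (m : ℝ) ≠ 0 := by exact_mod_cast hm0.ne'
  simpa [hγ, smul_smul, hm'] using hfin

/-- The exponential map of a compact manifold is smooth. -/
lemma contMDiff_expMap (g : Metric n M) (p : M) : ContMDiff (𝓡 n) (𝓡 n) ∞ (expMap g p) :=
  contMDiff_infty.2 fun k => fun v => contMDiffAt_expMap g p k v

end ExponentialMap

/-! ### The Gauss lemma -/

section Gauss

variable {n : ℕ} {M : Type u} [TopologicalSpace M] [ChartedSpace (Euc n) M]
  [IsManifold (𝓡 n) ∞ M]

lemma contDiff_pullMetric (g : Metric n M) {F : Euc n → M} (hF : ContMDiff (𝓡 n) (𝓡 n) ∞ F) :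
    ContDiff ℝ ∞ (pullMetric g F) :=
  contDiffOn_univ.1 (contDiffOn_pullMetric g isOpen_univ hF.contMDiffOn)

variable [T2Space M] [CompactSpace M]

lemma tderiv_expMap_zero (g : Metric n M) (p : M) (v : Euc n) :
    tderiv n (expMap g p) 0 v = v := by
  have hF := contMDiff_expMap g p
  have hl : DifferentiableAt ℝ (fun t : ℝ => t • v) 0 := by fun_prop
  have h := velocity_comp (n := n) (f := expMap g p) (c := fun t : ℝ => t • v) (t := 0)
    (hF.contMDiffAt.mdifferentiableAt (by simp)) hl.mdifferentiableAt
  have h1 : deriv (fun t : ℝ => t • v) 0 = v := by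
    simpa using ((hasDerivAt_id (0 : ℝ)).smul_const v).deriv
  rw [velocity_eq_deriv, h1, zero_smul] at h
  rw [← h]
  exact (isGeodesic_expMap g p v).2.2

lemma pullMetric_expMap_zero (g : Metric n M) (p : M) :
    pullMetric g (expMap g p) 0 = metricAt g p := by
  ext u w
  rw [pullMetric_apply, tderiv_expMap_zero, tderiv_expMap_zero, (isGeodesic_expMap g p u).2.1]

/-- Lines through the origin are geodesics of the pullback of the metric under `exp_p`; this is
the geodesic equation along them. -/
lemma fderiv_pullMetric_expMap (g : Metric n M) (hg : NoConjugatePoints g) (p : M) (t : ℝ)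
    (v w : Euc n) :
    fderiv ℝ (pullMetric g (expMap g p)) (t • v) v v w
      = fderiv ℝ (pullMetric g (expMap g p)) (t • v) w v v / 2 := by
  have hF := contMDiff_expMap g p
  have hl : ContDiff ℝ 2 (fun t : ℝ => t • v) := by fun_prop
  have hd : ∀ s, deriv (fun t : ℝ => t • v) s = v := fun s => by
    simpa using ((hasDerivAt_id s).smul_const v).deriv
  have hgeo := (isGeodesicAt_comp_iff g isOpen_univ hF.contMDiffOn
    (x := fun t : ℝ => t • v) (t := t) hl.contDiffAt (mem_univ _)
    ((tderiv n (expMap g p) (t • v)).toLinearMap.injective_iff_surjective.1 (hg p (t • v)))).1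
    (isGeodesic_iff.1 (isGeodesic_expMap g p v).1 t) w
  have hdd : deriv (deriv fun t : ℝ => t • v) t = 0 := by
    rw [show (deriv fun t : ℝ => t • v) = fun _ => v from funext hd]
    simp
  rw [hdd, hd, eulerLagrange_clm ((contDiff_pullMetric g hF).differentiable (by simp) _)] at hgeo
  simp only [map_zero, zero_apply, zero_add] at hgeo
  linarith

lemma hasDerivAt_pullMetric_line (g : Metric n M) (p : M) (t : ℝ) (v w : Euc n) :
    HasDerivAt (fun t : ℝ => pullMetric g (expMap g p) (t • v) v w)
      (fderiv ℝ (pullMetric g (expMap g p)) (t • v) v v w) t := by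
  have hG := contDiff_pullMetric g (contMDiff_expMap g p)
  have h1 := hasFDerivAt_clm_apply₂ (hG.differentiable (by simp) (t • v)) v w
  have h2 : HasDerivAt (fun t : ℝ => t • v) v t := by
    simpa using (hasDerivAt_id t).smul_const v
  exact h1.comp_hasDerivAt t h2

/-- The radial part of the Gauss lemma: rays from the origin have constant speed. -/
lemma pullMetric_expMap_self (g : Metric n M) (hg : NoConjugatePoints g) (p : M) (u : Euc n) :
    pullMetric g (expMap g p) u u u = metricAt g p u u := by
  have h : ∀ t : ℝ, HasDerivAt (fun t : ℝ => pullMetric g (expMap g p) (t • u) u u) 0 t := by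
    intro t
    have := hasDerivAt_pullMetric_line g p t u u
    have h2 := fderiv_pullMetric_expMap g hg p t u u
    rwa [show fderiv ℝ (pullMetric g (expMap g p)) (t • u) u u u = 0 by linarith] at this
  have := is_const_of_deriv_eq_zero (fun t => (h t).differentiableAt) (fun t => (h t).deriv) 1 0
  simpa [pullMetric_expMap_zero] using this

/-- The Gauss lemma: the metric which is pulled back by `exp_p` agrees with `g_p` as soon as one of
the vectors is radial. -/
lemma gauss_lemma (g : Metric n M) (hg : NoConjugatePoints g) (p : M) (u w : Euc n) :
    pullMetric g (expMap g p) u u w = metricAt g p u w := by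
  set G := pullMetric g (expMap g p) with hGdef
  have hG : ContDiff ℝ ∞ G := contDiff_pullMetric g (contMDiff_expMap g p)
  -- Differentiating `G y y y = g_p(y, y)` at `y = t • u` in the direction `w`.
  have hvar : ∀ y, fderiv ℝ G y w y y + 2 * G y y w = 2 * metricAt g p y w := by
    intro y
    have h1 : HasFDerivAt G (fderiv ℝ G y) y := (hG.differentiable (by simp) y).hasFDerivAt
    have h2 := (h1.clm_apply (hasFDerivAt_id y)).clm_apply (hasFDerivAt_id y)
    have h3 : HasFDerivAt (fun y => metricAt g p y y) _ y :=
      ((metricAt g p).hasFDerivAt.clm_apply (hasFDerivAt_id y))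
    have h4 : (fun y => G y y y) = fun y => metricAt g p y y :=
      funext fun y => pullMetric_expMap_self g hg p y
    have h5 := DFunLike.congr_fun (h2.unique (h4 ▸ h3)) w
    simp at h5
    have h6 : G y w y = G y y w := pullMetric_symm _ _ _ _ _
    have h7 : metricAt g p w y = metricAt g p y w := metricAt_symm _ _ _ _
    rw [h6, h7] at h5
    linarith
  -- With the equation for radial geodesics this shows that `t * (G_{tu}(u, w) - g_p(u, w))` is
  -- constant, and it vanishes at `t = 0`.
  have hder : ∀ t : ℝ, HasDerivAt (fun t : ℝ => t * G (t • u) u w - t * metricAt g p u w) 0 t := by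
    intro t
    have h1 := ((hasDerivAt_id t).mul (hasDerivAt_pullMetric_line g p t u w)).sub
      ((hasDerivAt_id t).mul_const (metricAt g p u w))
    refine h1.congr_deriv ?_
    simp only [id, one_mul]
    rw [fderiv_pullMetric_expMap g hg]
    rcases eq_or_ne t 0 with rfl | ht
    · simp [pullMetric_expMap_zero]
    · have h2 := hvar (t • u)
      simp only [map_smul, smul_apply, smul_eq_mul] at h2
      have h3 : t * (t * fderiv ℝ G (t • u) w u u / 2 + G (t • u) u w - metricAt g p u w)
          = 0 := by linarith
      have h4 := (mul_eq_zero.1 h3).resolve_left ht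
      linarith
  have := is_const_of_deriv_eq_zero (fun t => (hder t).differentiableAt)
    (fun t => (hder t).deriv) 1 0
  simp at this
  linarith

end Gauss

/-! ### Lifts of curves through the exponential map -/

section LocalInverse

variable {n : ℕ} {M : Type u} [TopologicalSpace M] [ChartedSpace (Euc n) M]
  [IsManifold (𝓡 n) ∞ M]

/-- The inverse function theorem for maps from the model space to a manifold. -/
lemma exists_localInverse {F : Euc n → M} (hF : ContMDiff (𝓡 n) (𝓡 n) ∞ F) {x : Euc n}
    (hx : Function.Injective (tderiv n F x)) :
    ∃ q : OpenPartialHomeomorph (Euc n) M, x ∈ q.source ∧ EqOn F q q.source ∧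
      ContMDiffAt (𝓡 n) (𝓡 n) ∞ q.symm (F x) := by
  set e := chartAt (Euc n) (F x)
  have he : e ∈ atlas (Euc n) M := chart_mem_atlas (Euc n) (F x)
  have ht : F x ∈ e.source := mem_chart_source (Euc n) (F x)
  have hφ : ContDiffAt ℝ ∞ (fun y => e (F y)) x := contMDiffAt_iff_contDiffAt.1
    (ContMDiffAt.comp x (contMDiffAt_chart he ht) hF.contMDiffAt)
  have hder : fderiv ℝ (fun y => e (F y)) x = (tderiv n e (F x)).comp (tderiv n F x) := by
    rw [← tderiv_comp ((contMDiffAt_chart he ht).mdifferentiableAt (by simp))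
      (hF.contMDiffAt.mdifferentiableAt (by simp)), tderiv_eq_fderiv]
    rfl
  have hinj : Function.Injective (fderiv ℝ (fun y => e (F y)) x) := by
    rw [hder]
    exact (tderiv_chart_bijective he ht).1.comp hx
  let D : Euc n ≃L[ℝ] Euc n :=
    (LinearEquiv.ofInjectiveEndo (fderiv ℝ (fun y => e (F y)) x).toLinearMap
      hinj).toContinuousLinearEquiv
  have hD : HasFDerivAt (fun y => e (F y)) (D : Euc n →L[ℝ] Euc n) x := by
    have : (D : Euc n →L[ℝ] Euc n) = fderiv ℝ (fun y => e (F y)) x := by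
      ext1 v; rfl
    rw [this]
    exact (hφ.differentiableAt (by simp)).hasFDerivAt
  set q₀ := hφ.toOpenPartialHomeomorph (fun y => e (F y)) hD (by simp) with hq₀
  have hs : IsOpen (F ⁻¹' e.source) := e.open_source.preimage hF.continuous
  set q := (q₀.restrOpen (F ⁻¹' e.source) hs).trans e.symm with hq
  have hcoe : (q₀ : Euc n → Euc n) = fun y => e (F y) := rfl
  have hsrc : ∀ y ∈ q.source, F y ∈ e.source := by
    intro y hy
    simp [hq] at hy
    exact hy.1.2
  refine ⟨q, ?_, fun y hy => ?_, ?_⟩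
  · have h1 : x ∈ q₀.source := hφ.mem_toOpenPartialHomeomorph_source hD (by simp)
    simp [hq, hcoe, h1, ht, e.map_source ht]
  · simp only [hq, OpenPartialHomeomorph.coe_trans, Function.comp]
    exact (e.left_inv (hsrc y hy)).symm
  · have h1 : ContDiffAt ℝ ∞ q₀.symm (e (F x)) := hφ.to_localInverse hD (by simp)
    exact ContMDiffAt.comp (F x) (g := q₀.symm) (f := e) h1.contMDiffAt (contMDiffAt_chart he ht)

lemma isLocalHomeomorph_of_injective {F : Euc n → M} (hF : ContMDiff (𝓡 n) (𝓡 n) ∞ F)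
    (hinj : ∀ x, Function.Injective (tderiv n F x)) : IsLocalHomeomorph F :=
  IsLocalHomeomorph.mk F fun x =>
    let ⟨q, hq, hq', _⟩ := exists_localInverse hF (hinj x)
    ⟨q, hq, hq'⟩

/-- A continuous lift of a differentiable curve through a local diffeomorphism is
differentiable. -/
lemma exists_hasDerivWithinAt_lift {F : Euc n → M} (hF : ContMDiff (𝓡 n) (𝓡 n) ∞ F)
    (hinj : ∀ x, Function.Injective (tderiv n F x)) {c : ℝ → M} {x : ℝ → Euc n} {S : Set ℝ}
    {s : ℝ} (hs : s ∈ S) (hc : MDifferentiableAt 𝓘(ℝ, ℝ) (𝓡 n) c s) (hx : ContinuousWithinAt x S s)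
    (hxc : ∀ r ∈ S, F (x r) = c r) :
    ∃ d, HasDerivWithinAt x d S s ∧ tderiv n F (x s) d = velocity n c s := by
  obtain ⟨q, hq, hFq, hsm⟩ := exists_localInverse hF (hinj (x s))
  rw [hxc s hs] at hsm
  have hxs : q.symm (c s) = x s := by rw [← hxc s hs, hFq hq, q.left_inv hq]
  have hq' : MDifferentiableAt (𝓡 n) (𝓡 n) q.symm (c s) := hsm.mdifferentiableAt (by simp)
  have hmd : MDifferentiableAt 𝓘(ℝ, ℝ) (𝓡 n) (q.symm ∘ c) s := hq'.comp s hc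
  have hd : DifferentiableAt ℝ (q.symm ∘ c) s := hmd.differentiableAt
  have hct : c s ∈ q.target := by
    rw [← hxc s hs, hFq hq]
    exact q.map_source hq
  refine ⟨deriv (q.symm ∘ c) s, ?_, ?_⟩
  · refine hd.hasDerivAt.hasDerivWithinAt.congr_of_eventuallyEq ?_ hxs.symm
    filter_upwards [self_mem_nhdsWithin, hx.preimage_mem_nhdsWithin (q.open_source.mem_nhds hq)]
      with r hr hr'
    rw [Function.comp, ← hxc r hr, hFq hr', q.left_inv hr']
  · rw [← velocity_eq_deriv, ← hxs]
    have h := velocity_comp (n := n) (f := F) (c := q.symm ∘ c) (t := s)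
      (hF.contMDiffAt.mdifferentiableAt (by simp)) hmd
    refine h.symm.trans (velocity_congr ?_)
    filter_upwards [hc.continuousAt.eventually_mem (q.open_target.mem_nhds hct)] with r hr
    simp only [Function.comp]
    rw [hFq (q.map_target hr), q.right_inv hr]

end LocalInverse

section LiftBound

variable {n : ℕ} {M : Type u} [TopologicalSpace M] [ChartedSpace (Euc n) M]
  [IsManifold (𝓡 n) ∞ M]

/-- The norm on the tangent space at `p`. -/
def tnorm (g : Metric n M) (p : M) (v : Euc n) : ℝ := Real.sqrt (metricAt g p v v)

lemma tnorm_sq (g : Metric n M) (p : M) (v : Euc n) : tnorm g p v ^ 2 = metricAt g p v v :=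
  Real.sq_sqrt (metricAt_nonneg g p v)

lemma continuous_tnorm (g : Metric n M) (p : M) : Continuous (tnorm g p) := by
  unfold tnorm
  fun_prop

lemma isCompact_tnorm_le (g : Metric n M) (p : M) (r : ℝ) : IsCompact {v | tnorm g p v ≤ r} := by
  obtain ⟨c, hc, h⟩ := exists_mul_norm_sq_le (X := Unit) (y₀ := ())
    (G := fun _ => metricAt g p) continuousAt_const (metricAt_pos g p)
  have h := h.self_of_nhds
  refine Metric.isCompact_of_isClosed_isBounded
    (isClosed_le (continuous_tnorm g p) continuous_const) ?_
  refine isBounded_iff_forall_norm_le.2 ⟨Real.sqrt (r ^ 2 / c), fun v hv => ?_⟩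
  refine Real.le_sqrt_of_sq_le ?_
  rw [le_div_iff₀ hc, mul_comm]
  refine (h v).trans ?_
  rw [← tnorm_sq]
  exact pow_le_pow_left₀ (Real.sqrt_nonneg _) hv 2

/-- The Cauchy-Schwarz inequality for a positive semidefinite bilinear form. -/
lemma sq_le_of_nonneg {E : Type*} [NormedAddCommGroup E] [NormedSpace ℝ E]
    {B : E →L[ℝ] E →L[ℝ] ℝ} (hsymm : ∀ v w, B v w = B w v) (hB : ∀ v, 0 ≤ B v v) (v w : E) :
    B v w ^ 2 ≤ B v v * B w w := by
  have h : ∀ t : ℝ, 0 ≤ B w w * (t * t) + 2 * B v w * t + B v v := by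
    intro t
    have := hB (v + t • w)
    simp only [map_add, map_smul, add_apply, smul_apply, smul_eq_mul, hsymm w v] at this
    linarith
  have := discrim_le_zero h
  rw [discrim] at this
  linarith

variable [T2Space M] [CompactSpace M]

/-- A lift through `exp_p` of a curve of speed at most `L` moves away from the origin at a rate
of at most `L`, by the Gauss lemma. -/
lemma tnorm_lift_le {g : Metric n M} (hg : NoConjugatePoints g) {p : M} {c : ℝ → M}
    {x : ℝ → Euc n} {T L : ℝ} (hT : 0 ≤ T) (hL : 0 ≤ L)
    (hc : ∀ s ∈ Icc 0 T, MDifferentiableAt 𝓘(ℝ, ℝ) (𝓡 n) c s)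
    (hcL : ∀ s ∈ Icc 0 T, speedSq g c s ≤ L ^ 2) (hx : ContinuousOn x (Icc 0 T))
    (hxc : ∀ s ∈ Icc 0 T, expMap g p (x s) = c s) :
    tnorm g p (x T) ≤ tnorm g p (x 0) + L * T := by
  have hF := contMDiff_expMap g p
  have hex : ∀ s ∈ Icc 0 T, ∃ d, HasDerivWithinAt x d (Icc 0 T) s ∧
      metricAt g p (x s) d ^ 2 ≤ metricAt g p (x s) (x s) * L ^ 2 := by
    intro s hs
    obtain ⟨d, hd, hd'⟩ := exists_hasDerivWithinAt_lift hF (hg p) hs (hc s hs) (hx s hs) hxc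
    refine ⟨d, hd, ?_⟩
    rw [← gauss_lemma g hg]
    refine (sq_le_of_nonneg (B := pullMetric g (expMap g p) (x s))
      (fun v w => pullMetric_symm _ _ _ _ _) (fun v => metricAt_nonneg _ _ _) _ _).trans ?_
    rw [pullMetric_expMap_self g hg]
    refine mul_le_mul_of_nonneg_left ?_ (metricAt_nonneg _ _ _)
    rw [pullMetric_apply, hd', hxc s hs]
    exact hcL s hs
  choose! d hd hdL using hex
  -- The square root is regularized to make it differentiable at the origin.
  have key : ∀ ε > 0, Real.sqrt (metricAt g p (x T) (x T) + ε)
      ≤ Real.sqrt (metricAt g p (x 0) (x 0) + ε) + L * T := by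
    intro ε hε
    have hpos : ∀ s, 0 < metricAt g p (x s) (x s) + ε := fun s =>
      add_pos_of_nonneg_of_pos (metricAt_nonneg _ _ _) hε
    have hder : ∀ s ∈ Icc 0 T, HasDerivWithinAt (fun s => Real.sqrt (metricAt g p (x s) (x s) + ε))
        (2 * metricAt g p (x s) (d s) / (2 * Real.sqrt (metricAt g p (x s) (x s) + ε)))
        (Icc 0 T) s := by
      intro s hs
      have h1 : HasDerivWithinAt (fun s => metricAt g p (x s) (x s) + ε)
          (2 * metricAt g p (x s) (d s)) (Icc 0 T) s := by
        have h2 : HasDerivWithinAt (fun s => metricAt g p (x s)) (metricAt g p (d s)) (Icc 0 T) s :=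
          (metricAt g p).hasFDerivAt.comp_hasDerivWithinAt s (hd s hs)
        refine ((h2.clm_apply (hd s hs)).add_const ε).congr_deriv ?_
        rw [metricAt_symm g p (d s)]
        ring
      exact h1.sqrt (hpos s).ne'
    have hbound := (convex_Icc (0 : ℝ) T).norm_image_sub_le_of_norm_hasDerivWithin_le
      (C := L) hder (fun s hs => ?_) (left_mem_Icc.2 hT) (right_mem_Icc.2 hT)
    · rw [Real.norm_eq_abs, Real.norm_eq_abs, sub_zero, abs_of_nonneg hT] at hbound
      linarith [(abs_le.1 hbound).2]
    · have h0 := Real.sqrt_pos.2 (hpos s)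
      rw [mul_div_mul_left _ _ two_ne_zero, norm_div, Real.norm_eq_abs, Real.norm_eq_abs,
        abs_of_pos h0, div_le_iff₀ h0]
      refine abs_le_of_sq_le_sq ?_ (by positivity)
      rw [mul_pow, Real.sq_sqrt (hpos s).le]
      nlinarith [hdL s hs, sq_nonneg L]
  have hlim : ∀ a : ℝ, Tendsto (fun ε : ℝ => Real.sqrt (a + ε)) (𝓝[>] 0) (𝓝 (Real.sqrt a)) := by
    intro a
    have : Continuous fun ε : ℝ => Real.sqrt (a + ε) := by fun_prop
    simpa using (this.tendsto 0).mono_left nhdsWithin_le_nhds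
  exact le_of_tendsto_of_tendsto (hlim _) ((hlim _).add_const _)
    (by filter_upwards [self_mem_nhdsWithin] with ε hε using key ε hε)

end LiftBound

/-! ### Covering maps from path lifting -/

section PathLifting

variable {E X : Type*} [TopologicalSpace E] [TopologicalSpace X] {p : E → X}

/-- If all partial lifts of a path stay in a compact set, then the path can be lifted. -/
lemma exists_lift_of_isCompact [T2Space X] (hp : IsLocalHomeomorph p) {γ : ℝ → X}
    (hγ : ContinuousOn γ (Icc 0 1)) {ξ : E} (h0 : p ξ = γ 0) {K : Set E} (hK : IsCompact K)
    (hb : ∀ g : ℝ → E, ∀ t ∈ Icc (0 : ℝ) 1, ContinuousOn g (Icc 0 t) →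
      (∀ s ∈ Icc 0 t, p (g s) = γ s) → g 0 = ξ → g t ∈ K) :
    ∃ g : ℝ → E, ContinuousOn g (Icc 0 1) ∧ (∀ s ∈ Icc (0 : ℝ) 1, p (g s) = γ s) ∧ g 0 = ξ := by
  -- By compactness, local lifts from points of `K` exist for a uniform time `η`.
  obtain ⟨η, hη, hstep⟩ : ∃ η > 0, ∀ x ∈ K ×ˢ Icc (0 : ℝ) 1, p x.1 = γ x.2 →
      ∃ h : ℝ → E, ContinuousOn h (Icc x.2 (x.2 + η) ∩ Icc 0 1) ∧
        (∀ s ∈ Icc x.2 (x.2 + η) ∩ Icc 0 1, p (h s) = γ s) ∧ h x.2 = x.1 := by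
    refine (hK.prod isCompact_Icc).induction_on (p := fun S : Set (E × ℝ) =>
      ∃ η > 0, ∀ x ∈ S, p x.1 = γ x.2 →
      ∃ h : ℝ → E, ContinuousOn h (Icc x.2 (x.2 + η) ∩ Icc 0 1) ∧
        (∀ s ∈ Icc x.2 (x.2 + η) ∩ Icc 0 1, p (h s) = γ s) ∧ h x.2 = x.1)
      ⟨1, one_pos, by simp⟩ ?_ ?_ ?_
    · rintro S T hST ⟨η, hη, h⟩
      exact ⟨η, hη, fun x hx => h x (hST hx)⟩
    · have hmono : ∀ {η η' : ℝ}, η ≤ η' → ∀ t : ℝ,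
          Icc t (t + η) ∩ Icc (0 : ℝ) 1 ⊆ Icc t (t + η') ∩ Icc 0 1 := fun h t =>
        inter_subset_inter_left _ (Icc_subset_Icc_right (by linarith))
      rintro S T ⟨η, hη, h⟩ ⟨η', hη', h'⟩
      refine ⟨min η η', lt_min hη hη', fun x hx hpx => ?_⟩
      rcases hx with hx | hx
      · obtain ⟨f, hf, hf', hfx⟩ := h x hx hpx
        exact ⟨f, hf.mono (hmono (min_le_left _ _) _),
          fun s hs => hf' s (hmono (min_le_left _ _) _ hs), hfx⟩
      · obtain ⟨f, hf, hf', hfx⟩ := h' x hx hpx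
        exact ⟨f, hf.mono (hmono (min_le_right _ _) _),
          fun s hs => hf' s (hmono (min_le_right _ _) _ hs), hfx⟩
    · rintro ⟨x₀, t₀⟩ ⟨-, ht₀⟩
      by_cases hx₀ : p x₀ = γ t₀
      · obtain ⟨q, hq, rfl⟩ := hp x₀
        have htar : ∀ᶠ s in 𝓝[Icc 0 1] t₀, γ s ∈ q.target :=
          (hγ t₀ ht₀).eventually_mem (q.open_target.mem_nhds (hx₀ ▸ q.map_source hq))
        obtain ⟨η, hη, hηt⟩ := Metric.mem_nhdsWithin_iff.1 htar
        refine ⟨q.source ×ˢ Metric.ball t₀ (η / 2), mem_nhdsWithin_of_mem_nhds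
          (prod_mem_nhds (q.open_source.mem_nhds hq) (Metric.ball_mem_nhds _ (half_pos hη))),
          η / 2, half_pos hη, ?_⟩
        rintro ⟨x, t⟩ ⟨hx, ht⟩ hxt
        have hsub : ∀ s ∈ Icc t (t + η / 2) ∩ Icc 0 1, γ s ∈ q.target := by
          rintro s ⟨⟨hs1, hs2⟩, hs⟩
          refine hηt ⟨?_, hs⟩
          rw [Metric.mem_ball, Real.dist_eq, abs_lt] at ht ⊢
          constructor <;> linarith [ht.1, ht.2]
        refine ⟨fun s => q.symm (γ s), q.continuousOn_symm.comp (hγ.mono inter_subset_right) hsub,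
          fun s hs => q.right_inv (hsub s hs), ?_⟩
        simp only at hxt hx ⊢
        rw [← hxt, q.left_inv hx]
      · refine ⟨{x | p x.1 ≠ γ x.2}, ?_, 1, one_pos, fun x hx hpx => absurd hpx hx⟩
        have h1 : Tendsto (fun x : E × ℝ => (p x.1, γ x.2)) (𝓝[K ×ˢ Icc 0 1] (x₀, t₀))
            (𝓝 (p x₀, γ t₀)) := by
          refine Tendsto.prodMk_nhds ?_ ?_
          · exact (hp.continuous.comp continuous_fst).continuousAt.continuousWithinAt
          · exact (hγ t₀ ht₀).tendsto.comp (tendsto_nhdsWithin_iff.2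
              ⟨continuous_snd.continuousAt.continuousWithinAt,
                eventually_nhdsWithin_of_forall fun x hx => hx.2⟩)
        exact h1.eventually (isClosed_diagonal.isOpen_compl.mem_nhds (by simpa using hx₀))
  -- Hence a lift on `[0, m η]` can be extended by `η`, as its endpoint lies in `K`.
  have key : ∀ m : ℕ, ∃ g : ℝ → E, ContinuousOn g (Icc 0 (min (m * η) 1)) ∧
      (∀ s ∈ Icc (0 : ℝ) (min (m * η) 1), p (g s) = γ s) ∧ g 0 = ξ := by
    intro m
    induction m with
    | zero =>
      refine ⟨fun _ => ξ, continuousOn_const, fun s hs => ?_, rfl⟩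
      have : s = 0 := by simpa using hs
      rw [this, h0]
    | succ m ih =>
      obtain ⟨g, hg, hg', hg0⟩ := ih
      set T : ℝ := min (m * η) 1 with hT
      have hT0 : 0 ≤ T := le_min (by positivity) zero_le_one
      have hT1 : T ≤ 1 := min_le_right _ _
      obtain ⟨h, hh, hh', hhT⟩ := hstep (g T, T)
        ⟨hb g T ⟨hT0, hT1⟩ hg hg' hg0, hT0, hT1⟩ (hg' T ⟨hT0, le_rfl⟩)
      simp only at hh hh' hhT
      have hsub : Icc (0 : ℝ) (min ((m + 1 : ℕ) * η) 1) ⊆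
          Icc 0 T ∪ (Icc T (T + η) ∩ Icc 0 1) := by
        rintro s ⟨hs0, hs⟩
        rcases le_total s T with hsT | hsT
        · exact Or.inl ⟨hs0, hsT⟩
        · refine Or.inr ⟨⟨hsT, ?_⟩, hs0, hs.trans (min_le_right _ _)⟩
          rw [hT, ← min_add_add_right]
          refine le_min (hs.trans ((min_le_left _ _).trans_eq (by push_cast; ring))) ?_
          linarith [hs.trans (min_le_right _ _)]
      set f : ℝ → E := fun s => if s ≤ T then g s else h s with hf
      have hfg : EqOn f g (Icc 0 T) := fun s hs => if_pos hs.2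
      have hfh : EqOn f h (Icc T (T + η) ∩ Icc 0 1) := by
        intro s hs
        rcases hs.1.1.lt_or_eq with h1 | h1
        · exact if_neg (not_le.2 h1)
        · rw [← h1, hhT]
          exact if_pos le_rfl
      refine ⟨f, ((hg.congr hfg).union_of_isClosed (hh.congr hfh) isClosed_Icc
        (isClosed_Icc.inter isClosed_Icc)).mono hsub, fun s hs => ?_, ?_⟩
      · rcases hsub hs with h1 | h1
        · rw [hfg h1, hg' s h1]
        · rw [hfh h1, hh' s h1]
      · rw [hfg ⟨le_rfl, hT0⟩, hg0]
  obtain ⟨m, hm⟩ := exists_nat_ge (1 / η)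
  have := key m
  rwa [min_eq_right (by rwa [div_le_iff₀ hη] at hm)] at this

/-- A separated local homeomorphism which has local sections of uniform size through all points of
its fibres is a covering map. -/
lemma isCoveringMap_of_exists_section (hp : IsLocalHomeomorph p) (hsep : IsSeparatedMap p)
    (h : ∀ x : X, ∃ U : Set X, IsOpen U ∧ x ∈ U ∧ IsPreconnected U ∧ ∀ ξ : E, ∀ hξ : p ξ ∈ U,
      ∃ s : C(U, E), (∀ y, p (s y) = y) ∧ s ⟨p ξ, hξ⟩ = ξ) : IsCoveringMap p := by
  intro x
  obtain ⟨U, hU, hxU, hUc, hs⟩ := h x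
  -- The sheets over `U` are the images of the sections over `U`.
  let I := {s : C(U, E) // ∀ y, p (s y) = y}
  let _ : TopologicalSpace I := ⊥
  have : DiscreteTopology I := ⟨rfl⟩
  have : PreconnectedSpace U := isPreconnected_iff_preconnectedSpace.1 hUc
  let Ψ : U × I → E := fun z => z.2.1 z.1
  have hsec : ∀ s : I, IsOpenMap s.1 := fun s => by
    refine (IsLocalHomeomorph.of_comp (g := p) ?_ hp s.1.continuous).isOpenMap
    have : p ∘ s.1 = Subtype.val := funext s.2
    rw [this]
    exact hU.isOpenEmbedding_subtypeVal.isLocalHomeomorph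
  have hcont : Continuous Ψ := continuous_prod_of_discrete_right.2 fun s => s.1.continuous
  have hopen : IsOpenMap Ψ := by
    intro W hW
    have : Ψ '' W = ⋃ s : I, s.1 '' {y | (y, s) ∈ W} := by
      ext z
      simp only [mem_image, mem_iUnion, mem_ofPred_eq]
      constructor
      · rintro ⟨⟨y, s⟩, hys, rfl⟩
        exact ⟨s, y, hys, rfl⟩
      · rintro ⟨s, y, hys, rfl⟩
        exact ⟨(y, s), hys, rfl⟩
    rw [this]
    exact isOpen_iUnion fun s => hsec s _ (hW.preimage (by fun_prop))
  have hinj : Function.Injective Ψ := by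
    rintro ⟨y, s⟩ ⟨y', s'⟩ hyy
    have hyy : s.1 y = s'.1 y' := hyy
    have h1 : y = y' := Subtype.ext (by rw [← s.2 y, hyy, s'.2 y'])
    subst h1
    have h2 : (s.1 : U → E) = s'.1 := hsep.eq_of_comp_eq hp.isLocallyInjective s.1.continuous
      s'.1.continuous (funext fun z => (s.2 z).trans (s'.2 z).symm) y hyy
    exact Prod.ext rfl (Subtype.ext (DFunLike.coe_injective h2))
  have hrange : range Ψ = p ⁻¹' U := by
    ext ξ
    constructor
    · rintro ⟨⟨y, s⟩, rfl⟩
      change p (s.1 y) ∈ U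
      rw [s.2 y]
      exact y.2
    · intro hξ
      obtain ⟨s, hs1, hs2⟩ := hs ξ hξ
      exact ⟨(⟨p ξ, hξ⟩, ⟨s, hs1⟩), hs2⟩
  have hemb : IsOpenEmbedding Ψ := .of_continuous_injective_isOpenMap hcont hinj hopen
  let Φ : U × I ≃ₜ p ⁻¹' U := hemb.isEmbedding.toHomeomorph.trans (Homeomorph.setCongr hrange)
  have hΦ : ∀ z, ((Φ z : p ⁻¹' U) : E) = Ψ z := fun z => rfl
  refine IsEvenlyCovered.to_isEvenlyCovered_preimage (I := I)
    ⟨inferInstance, U, hxU, hU, hU.preimage hp.continuous, Φ.symm, fun ξ => ?_⟩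
  obtain ⟨z, rfl⟩ := Φ.surjective ξ
  rw [Φ.symm_apply_apply, hΦ]
  exact (z.2.2 z.1).symm

/-- A covering map with nonempty total space and connected base is surjective. -/
lemma surjective_of_isCoveringMap [Nonempty E] [PreconnectedSpace X] (hp : IsCoveringMap p) :
    Function.Surjective p := by
  have hclosed : IsClosed (range p) := by
    rw [← isOpen_compl_iff, isOpen_iff_mem_nhds]
    intro x hx
    obtain ⟨-, U, hxU, hU, -, H, hH⟩ := hp x
    filter_upwards [hU.mem_nhds hxU]
    rintro _ hy ⟨ξ, rfl⟩
    exact hx ⟨((H ⟨ξ, hy⟩).2 : p ⁻¹' {x}), (H ⟨ξ, hy⟩).2.2⟩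
  rw [← range_eq_univ]
  exact IsClopen.eq_univ ⟨hclosed, hp.isOpenMap.isOpen_range⟩ (range_nonempty p)

end PathLifting

/-! ### The theorem of Hadamard and Cartan -/

section Covering

variable {n : ℕ} {M : Type u} [TopologicalSpace M] [ChartedSpace (Euc n) M]
  [IsManifold (𝓡 n) ∞ M] [T2Space M] [CompactSpace M]

/-- Straight segments in a chart lift through the exponential map, since partial lifts stay in a
compact ball by `tnorm_lift_le`. -/
lemma exists_lift_segment {g : Metric n M} (hg : NoConjugatePoints g) (p : M)
    {e : OpenPartialHomeomorph M (Euc n)} (he : e ∈ atlas (Euc n) M) {y₀ : Euc n} {ρ C : ℝ}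
    (hρ : Metric.ball y₀ ρ ⊆ e.target) (hC : 0 ≤ C)
    (hbound : ∀ y ∈ Metric.ball y₀ ρ, ∀ w, pullMetric g e.symm y w w ≤ C * ‖w‖ ^ 2)
    {a b : Euc n} (ha : a ∈ Metric.ball y₀ ρ) (hb : b ∈ Metric.ball y₀ ρ) {ξ : Euc n}
    (hξ : expMap g p ξ = e.symm a) :
    ∃ x : ℝ → Euc n, ContinuousOn x (Icc 0 1) ∧
      (∀ s ∈ Icc (0 : ℝ) 1, expMap g p (x s) = e.symm (a + s • (b - a))) ∧ x 0 = ξ := by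
  have hF := contMDiff_expMap g p
  set σ : ℝ → Euc n := fun s => a + s • (b - a)
  have hσd : ∀ s, HasDerivAt σ (b - a) s := fun s =>
    (((hasDerivAt_id s).smul_const (b - a)).const_add a).congr_deriv (one_smul ℝ _)
  have hσ : ∀ s ∈ Icc (0 : ℝ) 1, σ s ∈ Metric.ball y₀ ρ := fun s hs =>
    (convex_ball y₀ ρ).add_smul_sub_mem ha hb hs
  set c : ℝ → M := fun s => e.symm (σ s)
  have hsymm : ∀ s ∈ Icc (0 : ℝ) 1, MDifferentiableAt (𝓡 n) (𝓡 n) e.symm (σ s) := fun s hs =>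
    (contMDiffAt_chart_symm he (hρ (hσ s hs))).mdifferentiableAt (by simp)
  have hσm : ∀ s, MDifferentiableAt 𝓘(ℝ, ℝ) (𝓡 n) σ s := fun s =>
    (hσd s).differentiableAt.mdifferentiableAt
  have hc : ∀ s ∈ Icc (0 : ℝ) 1, MDifferentiableAt 𝓘(ℝ, ℝ) (𝓡 n) c s := fun s hs =>
    (hsymm s hs).comp s (hσm s)
  set L : ℝ := Real.sqrt (C * ‖b - a‖ ^ 2)
  have hL : ∀ s ∈ Icc (0 : ℝ) 1, speedSq g c s ≤ L ^ 2 := by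
    intro s hs
    have hv : velocity n c s = tderiv n e.symm (σ s) (b - a) := by
      have h := velocity_comp (n := n) (f := e.symm) (c := σ) (hsymm s hs) (hσm s)
      rwa [velocity_eq_deriv, (hσd s).deriv] at h
    rw [Real.sq_sqrt (by positivity), speedSq, hv]
    exact hbound _ (hσ s hs) (b - a)
  refine exists_lift_of_isCompact (isLocalHomeomorph_of_injective hF (hg p)) (γ := c) (ξ := ξ)
    (fun s hs => (hc s hs).continuousAt.continuousWithinAt) (by simpa [c, σ] using hξ)
    (isCompact_tnorm_le g p (tnorm g p ξ + L)) ?_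
  intro x t ht hx hxc hx0
  have hsub : Icc 0 t ⊆ Icc (0 : ℝ) 1 := Icc_subset_Icc_right ht.2
  have := tnorm_lift_le hg ht.1 (Real.sqrt_nonneg _) (fun s hs => hc s (hsub hs))
    (fun s hs => hL s (hsub hs)) hx hxc
  rw [hx0] at this
  refine this.trans (add_le_add_right (mul_le_of_le_one_right (Real.sqrt_nonneg _) ht.2) _)

/-- The theorem of Hadamard and Cartan: without conjugate points, the exponential map is a
covering map. -/
theorem isCoveringMap_expMap {g : Metric n M} (hg : NoConjugatePoints g) (p : M) :
    IsCoveringMap (expMap g p) := by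
  have hF := contMDiff_expMap g p
  have hloc := isLocalHomeomorph_of_injective hF (hg p)
  have hsep : IsSeparatedMap (expMap g p) := T2Space.isSeparatedMap _
  refine isCoveringMap_of_exists_section hloc hsep fun m => ?_
  set e := chartAt (Euc n) m
  have he : e ∈ atlas (Euc n) M := chart_mem_atlas (Euc n) m
  have hm : m ∈ e.source := mem_chart_source (Euc n) m
  obtain ⟨C, hC, hCev⟩ : ∃ C : ℝ, 0 ≤ C ∧
      ∀ᶠ y in 𝓝 (e m), ∀ w, pullMetric g e.symm y w w ≤ C * ‖w‖ ^ 2 := by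
    have hcont : ContinuousAt (pullMetric g e.symm) (e m) :=
      (coordMetric_contDiffOn g he).continuousOn.continuousAt
        (e.open_target.mem_nhds (e.map_source hm))
    refine ⟨‖pullMetric g e.symm (e m)‖ + 1, by positivity, ?_⟩
    filter_upwards [hcont.norm.eventually (gt_mem_nhds (lt_add_one _))] with y hy w
    calc pullMetric g e.symm y w w ≤ ‖pullMetric g e.symm y w w‖ := le_abs_self _
      _ ≤ ‖pullMetric g e.symm y‖ * ‖w‖ * ‖w‖ := (pullMetric g e.symm y).le_opNorm₂ w w
      _ ≤ (‖pullMetric g e.symm (e m)‖ + 1) * ‖w‖ * ‖w‖ := by gcongr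
      _ = _ := by ring
  obtain ⟨ρ, hρ0, hρ⟩ := Metric.eventually_nhds_iff_ball.1
    (hCev.and (e.open_target.mem_nhds (e.map_source hm)))
  have hρt : Metric.ball (e m) ρ ⊆ e.target := fun y hy => (hρ y hy).2
  have hU : ∀ y, y ∈ e.symm '' Metric.ball (e m) ρ ↔ y ∈ e.source ∧ e y ∈ Metric.ball (e m) ρ := by
    intro y
    constructor
    · rintro ⟨z, hz, rfl⟩
      exact ⟨e.map_target (hρt hz), by rwa [e.right_inv (hρt hz)]⟩
    · rintro ⟨h1, h2⟩
      exact ⟨e y, h2, e.left_inv h1⟩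
  refine ⟨e.symm '' Metric.ball (e m) ρ,
    e.symm.isOpen_image_of_subset_source Metric.isOpen_ball hρt,
    (hU m).2 ⟨hm, Metric.mem_ball_self hρ0⟩,
    (convex_ball (e m) ρ).isPreconnected.image _ (e.continuousOn_symm.mono hρt), fun ξ hξ => ?_⟩
  set U := e.symm '' Metric.ball (e m) ρ
  have hξ' := (hU _).1 hξ
  set a : Euc n := e (expMap g p ξ)
  have hUmem : ∀ y : U, e y ∈ Metric.ball (e m) ρ := fun y => ((hU y).1 y.2).2
  -- The section through `ξ` takes `y` to the endpoint of the lift, starting at `ξ`, of the segment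
  -- from `exp_p ξ` to `y` in the chart.
  choose x hxc hx hx0 using fun y : U => exists_lift_segment hg p he hρt hC
    (fun y hy => (hρ y hy).1) hξ'.2 (hUmem y) (ξ := ξ) (e.left_inv hξ'.1).symm
  have hec : Continuous fun y : U => e y :=
    e.continuousOn.comp_continuous continuous_subtype_val fun y => ((hU y).1 y.2).1
  let f : C(unitInterval × U, M) := ⟨fun z => e.symm (a + (z.1 : ℝ) • (e z.2 - a)), by
    have := hec.comp continuous_snd (X := unitInterval × U)
    refine e.continuousOn_symm.comp_continuous (continuous_const.add
      ((continuous_subtype_val.comp continuous_fst).smul (this.sub continuous_const)))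
      fun z => hρt ?_
    exact (convex_ball _ ρ).add_smul_sub_mem hξ'.2 (hUmem z.2) z.1.2⟩
  have hcl : Continuous fun z : unitInterval × U => x z.2 z.1 := by
    refine hloc.continuous_lift hsep f (g := fun z : unitInterval × U => x z.2 z.1)
      (funext fun z => hx z.2 z.1 z.1.2) ?_ fun y => ?_
    · have : (fun y : U => x y ((0 : unitInterval) : ℝ)) = fun _ => ξ := funext fun y => hx0 y
      exact this ▸ continuous_const
    · exact (hxc y).comp_continuous continuous_subtype_val fun t => t.2
  refine ⟨⟨fun y => x y 1, hcl.comp (Continuous.prodMk_right (1 : unitInterval))⟩, fun y => ?_, ?_⟩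
  · have := hx y 1 (right_mem_Icc.2 zero_le_one)
    simp only [ContinuousMap.coe_mk]
    rw [this, one_smul, add_sub_cancel, e.left_inv ((hU y).1 y.2).1]
  · -- The lift of the constant segment is constant.
    have hconst : (fun t : unitInterval => x ⟨expMap g p ξ, hξ⟩ t) = fun _ => ξ := by
      refine hsep.eq_of_comp_eq hloc.isLocallyInjective
        ((hxc _).comp_continuous continuous_subtype_val fun t => t.2) continuous_const
        (funext fun t => ?_) 0 (by simpa using hx0 _)
      have := hx ⟨expMap g p ξ, hξ⟩ t t.2
      simp only [Function.comp]
      rw [this]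
      simp only [a, sub_self, smul_zero, add_zero, e.left_inv hξ'.1]
    exact congrFun hconst 1

end Covering

universe v w

/-! ### Finite coverings from residual finiteness -/

section DeckGroup

variable {E : Type v} {X : Type w} [TopologicalSpace E] [TopologicalSpace X] {f : E → X}

instance homeomorphMulAction : MulAction (E ≃ₜ E) E where
  smul φ x := φ x
  one_smul _ := rfl
  mul_smul _ _ _ := rfl

/-- The group of deck transformations of a map. -/
def deckGroup (f : E → X) : Subgroup (E ≃ₜ E) where
  carrier := {φ | ∀ x, f (φ x) = f x}
  mul_mem' {φ ψ} hφ hψ x := (hφ (ψ x)).trans (hψ x)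
  one_mem' _ := rfl
  inv_mem' {φ} hφ x := by
    have h := hφ (φ⁻¹ x)
    rw [← h]
    exact congrArg f (φ.apply_symm_apply x)

lemma deckGroup_apply (γ : deckGroup f) (x : E) : f (γ • x) = f x := γ.2 x

instance : ContinuousConstSMul (deckGroup f) E := ⟨fun γ => γ.1.continuous⟩

/-- The deck group of a simply connected covering acts transitively on the fibres. -/
lemma exists_deckGroup_smul_eq [SimplyConnectedSpace E] [LocallyPathConnectedSpace E]
    (hf : IsCoveringMap f) {a b : E} (hab : f a = f b) : ∃ γ : deckGroup f, γ • a = b := by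
  have key : ∀ a b : E, f a = f b → ∃ F : C(E, E), F a = b ∧ f ∘ F = f := fun a b hab =>
    (hf.existsUnique_continuousMap_lifts ⟨f, hf.continuous⟩ a b hab.symm).exists
  obtain ⟨F, hFa, hF⟩ := key a b hab
  obtain ⟨G, hGb, hG⟩ := key b a hab.symm
  have h1 : (G : E → E) ∘ F = id := hf.eq_of_comp_eq (G.continuous.comp F.continuous)
    continuous_id (by rw [← Function.comp_assoc, hG, hF, Function.comp_id]) a
    (by simp [hFa, hGb])
  have h2 : (F : E → E) ∘ G = id := hf.eq_of_comp_eq (F.continuous.comp G.continuous)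
    continuous_id (by rw [← Function.comp_assoc, hF, hG, Function.comp_id]) b
    (by simp [hFa, hGb])
  exact ⟨⟨⟨⟨F, G, congrFun h1, congrFun h2⟩, F.continuous, G.continuous⟩, congrFun hF⟩, hFa⟩

/-- A simply connected covering is the quotient by its deck group. -/
lemma isQuotientCoveringMap_deckGroup [SimplyConnectedSpace E] [LocallyPathConnectedSpace E]
    (hf : IsCoveringMap f) (hsurj : Function.Surjective f) :
    IsQuotientCoveringMap f (deckGroup f) := by
  refine (isQuotientCoveringMap_iff_isCoveringMap_and _ _).2
    ⟨hf, hsurj, inferInstance, ⟨fun γ δ x h => ?_⟩, fun {a b} => ⟨fun h => ?_, ?_⟩⟩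
  · exact Subtype.ext (DFunLike.coe_injective (hf.eq_of_comp_eq γ.1.continuous δ.1.continuous
      (funext fun y => (γ.2 y).trans (δ.2 y).symm) x h))
  · obtain ⟨γ, hγ⟩ := exists_deckGroup_smul_eq hf h.symm
    exact ⟨γ, hγ⟩
  · rintro ⟨γ, rfl⟩
    exact deckGroup_apply γ b

/-- Residual finiteness passes to groups which inject into a residually finite group. -/
lemma residuallyFinite_of_injective {G G' : Type*} [Group G] [Group G']
    [Group.ResiduallyFinite G'] (φ : G →* G') (hφ : Function.Injective φ) :
    Group.ResiduallyFinite G := by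
  rw [Group.residuallyFinite_iff_forall_finiteIndexNormalSubgroup]
  intro x hx
  exact hφ ((Group.eq_one_iff_forall_finiteIndexNormalSubroup (φ x) fun H => hx (H.comap φ)).trans
    (map_one φ).symm)

/-- In a residually finite group, a finite set of nontrivial elements is avoided by a normal
subgroup of finite index. -/
lemma exists_normal_finiteIndex_avoiding {G : Type*} [Group G] [Group.ResiduallyFinite G]
    {S : Set G} (hS : S.Finite) :
    ∃ H : Subgroup G, H.Normal ∧ H.FiniteIndex ∧ ∀ x ∈ H, x ∈ S → x = 1 := by
  have : Finite S := hS
  have hex : ∀ x : S, ∃ H : Subgroup G, H.Normal ∧ H.FiniteIndex ∧ ((x : G) ∈ H → (x : G) = 1) := by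
    intro x
    by_cases hx : (x : G) = 1
    · exact ⟨⊤, inferInstance, inferInstance, fun _ => hx⟩
    · obtain ⟨H, hH⟩ := Group.exists_finiteIndexNormalSubgroup_notMem (x : G) hx
      exact ⟨H.toSubgroup, H.isNormal', H.isFiniteIndex', fun h => absurd h hH⟩
  choose H hH hH' hH'' using hex
  refine ⟨⨅ x, H x, Subgroup.normal_iInf_normal hH, Subgroup.finiteIndex_iInf hH', ?_⟩
  intro x hx hxS
  exact hH'' ⟨x, hxS⟩ (Subgroup.mem_iInf.1 hx ⟨x, hxS⟩)

/-- Only finitely many group elements move a compact set to a set which meets it. -/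
lemma finite_setOf_smul_inter {G : Type*} [Group G] [MulAction G E] [T2Space X]
    (hf : IsQuotientCoveringMap f G) {B : Set E} (hB : IsCompact B) :
    {γ : G | ∃ x ∈ B, γ • x ∈ B}.Finite := by
  have hcs := hf.toContinuousConstSMul
  have key : {γ : G | ∃ z ∈ B ×ˢ B, γ • z.1 = z.2}.Finite := by
    refine (hB.prod hB).induction_on
      (p := fun s : Set (E × E) => {γ : G | ∃ z ∈ s, γ • z.1 = z.2}.Finite) ?_ ?_ ?_ ?_
    · simp
    · exact fun s t hst ht => ht.subset fun γ ⟨z, hz, h⟩ => ⟨z, hst hz, h⟩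
    · refine fun s t hs ht => (hs.union ht).subset ?_
      rintro γ ⟨z, hz | hz, h⟩
      exacts [Or.inl ⟨z, hz, h⟩, Or.inr ⟨z, hz, h⟩]
    · rintro ⟨x, y⟩ -
      by_cases hxy : f y = f x
      · obtain ⟨γ₀, rfl⟩ := hf.apply_eq_iff_mem_orbit.1 hxy
        obtain ⟨U, hU, hdisj⟩ := hf.disjoint x
        refine ⟨U ×ˢ ((γ₀⁻¹ • ·) ⁻¹' U), mem_nhdsWithin_of_mem_nhds (prod_mem_nhds hU ?_), ?_⟩
        · exact (continuous_const_smul γ₀⁻¹).continuousAt.preimage_mem_nhds (by simpa using hU)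
        · refine (finite_singleton γ₀).subset ?_
          rintro γ ⟨z, ⟨hz1, hz2⟩, h⟩
          have : γ₀⁻¹ * γ = 1 := hdisj _ ⟨(γ₀⁻¹ * γ) • z.1, ⟨z.1, hz1, rfl⟩, by
            rw [mul_smul, h]
            exact hz2⟩
          exact (inv_mul_eq_one.1 this).symm
      · refine ⟨{z | f z.2 ≠ f z.1}, mem_nhdsWithin_of_mem_nhds ?_, ?_⟩
        · exact (isOpen_ne_fun (hf.continuous.comp continuous_snd)
            (hf.continuous.comp continuous_fst)).mem_nhds hxy
        · convert finite_empty
          refine eq_empty_of_forall_notMem ?_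
          rintro γ ⟨z, hz, h⟩
          exact hz (by rw [← h, hf.map_smul])
  exact key.subset fun γ ⟨x, hx, hγx⟩ => ⟨(x, γ • x), ⟨hx, hγx⟩, rfl⟩

section Quotient

variable {G : Type*} [Group G] [MulAction G E] (hf : IsQuotientCoveringMap f G) (H : Subgroup G)

variable {H}

include hf in
lemma isQuotientCoveringMap_mk :
    IsQuotientCoveringMap (Quotient.mk (MulAction.orbitRel H E)) H := by
  have := hf.toContinuousConstSMul
  refine ⟨isQuotientMap_quotient_mk', ⟨fun h => continuous_const_smul (h : G)⟩, Quotient.eq'',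
    fun e => ?_⟩
  obtain ⟨U, hU, hdisj⟩ := hf.disjoint e
  exact ⟨U, hU, fun h hh => Subtype.ext (hdisj h hh)⟩

/-- The map to the base from the intermediate covering space associated with the subgroup `H`. -/
def orbitMap : Quotient (MulAction.orbitRel H E) → X :=
  Quotient.lift f fun _ _ ⟨h, hh⟩ => hh ▸ hf.map_smul (h : G)

lemma isLocalHomeomorph_orbitMap : IsLocalHomeomorph (orbitMap (H := H) hf) := by
  have h1 := (isQuotientCoveringMap_mk (H := H) hf)
  have h2 := IsLocalHomeomorphOn.of_comp_right (g := orbitMap (H := H) hf)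
    (f := Quotient.mk (MulAction.orbitRel H E)) (s := univ)
    (hf.isCoveringMap.isLocalHomeomorph.isLocalHomeomorphOn)
    h1.isCoveringMap.isLocalHomeomorph.isLocalHomeomorphOn
  rw [image_univ, h1.surjective.range_eq] at h2
  exact isLocalHomeomorph_iff_isLocalHomeomorphOn_univ.2 h2

include hf in
lemma t2Space_orbitSpace [T2Space X] : T2Space (Quotient (MulAction.orbitRel H E)) := by
  have hπ := isQuotientCoveringMap_mk (H := H) hf
  have hcs := hf.toContinuousConstSMul
  have hp := (isLocalHomeomorph_orbitMap (H := H) hf).continuous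
  refine ⟨fun a b hab => ?_⟩
  by_cases hpab : orbitMap hf a = orbitMap hf b
  · obtain ⟨x, rfl⟩ := hπ.surjective a
    obtain ⟨y, rfl⟩ := hπ.surjective b
    obtain ⟨γ, rfl⟩ := hf.apply_eq_iff_mem_orbit.1 hpab
    obtain ⟨U, hU, hdisj⟩ := hf.disjoint y
    have hopen := hπ.isCoveringMap.isOpenMap
    have hmem : y ∈ interior U := mem_interior_iff_mem_nhds.2 hU
    refine ⟨_, _, hopen _ (isOpen_interior.preimage (continuous_const_smul γ⁻¹)),
      hopen _ (isOpen_interior (s := U)), ⟨γ • y, by simpa using hmem, rfl⟩, ⟨y, hmem, rfl⟩, ?_⟩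
    rw [Set.disjoint_left]
    rintro _ ⟨z, hz, rfl⟩ ⟨z', hz', hzz⟩
    obtain ⟨h, rfl⟩ := hπ.apply_eq_iff_mem_orbit.1 hzz
    have hz1 : γ⁻¹ • z ∈ U := interior_subset hz
    have hz2 : (h : G) • z ∈ U := interior_subset hz'
    have h1 : (h : G) * γ = 1 := hdisj _ ⟨(h : G) • z, ⟨γ⁻¹ • z, hz1, by
      simp only [smul_smul, mul_assoc, mul_inv_cancel, mul_one]⟩, hz2⟩
    refine hab ?_
    refine hπ.apply_eq_iff_mem_orbit.2 ⟨h⁻¹, ?_⟩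
    have h2 : γ = ((h⁻¹ : H) : G) := by
      rw [Subgroup.coe_inv]
      exact (inv_eq_of_mul_eq_one_right h1).symm
    change ((h⁻¹ : H) : G) • y = γ • y
    rw [h2]
  · obtain ⟨U, V, hU, hV, ha, hb, hUV⟩ := t2_separation hpab
    exact ⟨_, _, hU.preimage hp, hV.preimage hp, ha, hb, hUV.preimage _⟩

include hf in
/-- The translates of `B` by representatives of the cosets of `H` cover the orbit space. -/
lemma compactSpace_orbitSpace [H.Normal] [H.FiniteIndex] {B : Set E} (hB : IsCompact B)
    (hBf : f '' B = univ) : CompactSpace (Quotient (MulAction.orbitRel H E)) := by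
  have hπ := isQuotientCoveringMap_mk (H := H) hf
  have hcs := hf.toContinuousConstSMul
  have : Finite (G ⧸ H) := H.finite_quotient_of_finiteIndex
  have hcomp : IsCompact (⋃ c : G ⧸ H, (Quotient.mk (MulAction.orbitRel H E)) ''
      ((c.out • ·) '' B)) :=
    isCompact_iUnion fun c => (hB.image (continuous_const_smul _)).image hπ.continuous
  refine ⟨?_⟩
  convert hcomp
  symm
  rw [eq_univ_iff_forall]
  intro a
  obtain ⟨x, rfl⟩ := hπ.surjective a
  obtain ⟨b, hb, hbx⟩ : f x ∈ f '' B := hBf ▸ mem_univ _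
  obtain ⟨γ, rfl⟩ := hf.apply_eq_iff_mem_orbit.1 hbx.symm
  obtain ⟨h, hh⟩ := QuotientGroup.mk_out_eq_mul H γ
  refine mem_iUnion.2 ⟨(γ : G ⧸ H), _, ⟨b, hb, rfl⟩, ?_⟩
  refine hπ.apply_eq_iff_mem_orbit.2 ⟨⟨γ * h * γ⁻¹, Subgroup.Normal.conj_mem ‹_› _ h.2 _⟩, ?_⟩
  change (γ * h * γ⁻¹) • γ • b = (γ : G ⧸ H).out • b
  rw [hh, smul_smul, inv_mul_cancel_right]

end Quotient

/-- A compact subset `B` of a simply connected covering space of a space with residually finite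
fundamental group embeds in some compact intermediate covering `N`, and so do its translates by
deck transformations `φ`. For `N` to be compact, `B` is required to be mapped onto the base. -/
theorem exists_finite_covering [T2Space E] [SimplyConnectedSpace E] [LocallyPathConnectedSpace E]
    [T2Space X] (hf : IsCoveringMap f) (hsurj : Function.Surjective f) (x₀ : X)
    [Group.ResiduallyFinite (FundamentalGroup X x₀)] {B : Set E} (hB : IsCompact B)
    (hBf : f '' B = univ) :
    ∃ (N : Type (max u v)) (_ : TopologicalSpace N) (π : E → N) (p : N → X),
      T2Space N ∧ CompactSpace N ∧ ConnectedSpace N ∧ IsCoveringMap π ∧ IsCoveringMap p ∧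
      Function.Surjective π ∧ p ∘ π = f ∧ ∀ a b : E, f a = f b → ∃ φ : E → E, Continuous φ ∧
        f ∘ φ = f ∧ φ a = b ∧ ∀ x y, π x = π y → φ x ∈ B → φ y ∈ B → x = y := by
  have hq := isQuotientCoveringMap_deckGroup hf hsurj
  obtain ⟨e₀, he₀⟩ := hsurj x₀
  have hRF : Group.ResiduallyFinite (deckGroup f) := by
    let ψ := (MulEquiv.inv' (deckGroup f)).trans
      (hq.fundamentalGroupEquiv (⟨e₀, he₀⟩ : f ⁻¹' {x₀})).symm
    exact residuallyFinite_of_injective ψ.toMonoidHom ψ.injective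
  obtain ⟨H, hHn, hHf, hH⟩ := exists_normal_finiteIndex_avoiding (finite_setOf_smul_inter hq hB)
  have hπ := isQuotientCoveringMap_mk (H := H) hq
  have hp := isLocalHomeomorph_orbitMap (H := H) hq
  have hT2 := t2Space_orbitSpace (H := H) hq
  have hC := compactSpace_orbitSpace (H := H) hq hB hBf
  let up : Quotient (MulAction.orbitRel H E) ≃ₜ ULift.{u} (Quotient (MulAction.orbitRel H E)) :=
    Homeomorph.ulift.symm
  have hsurj' : Function.Surjective (up ∘ Quotient.mk (MulAction.orbitRel H E)) :=
    up.surjective.comp hπ.surjective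
  have hpcov : IsCoveringMap (orbitMap (H := H) hq) := isLocalHomeomorph_iff_isCoveringMap.1 hp
  refine ⟨ULift.{u} (Quotient (MulAction.orbitRel H E)), inferInstance,
    up ∘ Quotient.mk (MulAction.orbitRel H E), orbitMap hq ∘ up.symm, inferInstance,
    up.compactSpace, hsurj'.connectedSpace (up.continuous.comp hπ.continuous),
    hπ.isCoveringMap.homeomorph_comp up, hpcov.comp_homeomorph up.symm, hsurj', ?_, ?_⟩
  · funext x
    simp only [Function.comp, up.symm_apply_apply]
    rfl
  · intro a b hab
    obtain ⟨γ, hγ⟩ := exists_deckGroup_smul_eq hf hab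
    refine ⟨fun x => γ • x, continuous_const_smul γ, funext fun x => deckGroup_apply γ x, hγ, ?_⟩
    intro x y hxy hx hy
    obtain ⟨h, rfl⟩ := hπ.apply_eq_iff_mem_orbit.1 (up.injective hxy)
    -- The conjugate of `h` by `γ` maps a point of `B` to a point of `B`.
    have h1 : γ * h * γ⁻¹ = 1 := by
      refine hH _ (hHn.conj_mem _ h.2 _) ⟨γ • y, hy, ?_⟩
      rw [smul_smul, inv_mul_cancel_right, mul_smul]
      exact hx
    have h2 : (h : deckGroup f) = 1 := by
      rwa [conj_eq_one_iff] at h1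
    change (h : deckGroup f) • y = y
    rw [h2, one_smul]

/-- The fibres of a covering map with compact total space are finite. -/
lemma finite_fiber_of_isCoveringMap [CompactSpace E] [T1Space X] (hf : IsCoveringMap f) (x : X) :
    (f ⁻¹' {x}).Finite := by
  have := (hf x).discreteTopology_fiber
  have : CompactSpace (f ⁻¹' {x}) :=
    isCompact_iff_compactSpace.1 (isClosed_singleton.preimage hf.continuous).isCompact
  have : Finite (f ⁻¹' {x}) := finite_of_compact_of_discrete
  exact Set.toFinite _

/-- A map over the base from a covering to a simply connected covering is injective: lifting the
covering map of the target provides a left inverse. -/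
lemma injective_of_comp_eq {E' : Type*} [TopologicalSpace E'] [SimplyConnectedSpace E]
    [LocallyPathConnectedSpace E] {f' : E' → X} (hf : IsCoveringMap f) (hf' : IsCoveringMap f')
    [PreconnectedSpace E'] {Ψ : E' → E} (hΨ : Continuous Ψ) (hcomp : f ∘ Ψ = f') :
    Function.Injective Ψ := by
  intro a b hab
  obtain ⟨G, ⟨hG1, hG2⟩, -⟩ := hf'.existsUnique_continuousMap_lifts ⟨f, hf.continuous⟩ (Ψ a) a
    (congrFun hcomp a).symm
  have h : (G : E → E') ∘ Ψ = id := hf'.eq_of_comp_eq (G.continuous.comp hΨ) continuous_id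
    (by rw [← Function.comp_assoc, hG2]; exact hcomp) a hG1
  rw [← id_eq a, ← id_eq b, ← h, Function.comp, Function.comp, hab]

end DeckGroup

/-! ### The pulled-back structure on a covering space -/

section CoverSpace

variable {n : ℕ} {M : Type u} [TopologicalSpace M] [ChartedSpace (Euc n) M]
  {N : Type u} [TopologicalSpace N] {p : N → M}

/-- The source of a local homeomorphism to a manifold, equipped with the manifold structure which
is pulled back from the target. -/
def CoverSpace (_ : IsLocalHomeomorph p) : Type u := N

variable (hp : IsLocalHomeomorph p)

instance : TopologicalSpace (CoverSpace hp) := inferInstanceAs (TopologicalSpace N)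
instance [T2Space N] : T2Space (CoverSpace hp) := inferInstanceAs (T2Space N)
instance [CompactSpace N] : CompactSpace (CoverSpace hp) := inferInstanceAs (CompactSpace N)
instance [ConnectedSpace N] : ConnectedSpace (CoverSpace hp) := inferInstanceAs (ConnectedSpace N)

/-- The local homeomorphism as a map on the pulled-back manifold. -/
def coverProj : CoverSpace hp → M := p

/-- The local homeomorphism, restricted to a chosen neighbourhood of `q` where it is injective. -/
def coverLocal (q : CoverSpace hp) : OpenPartialHomeomorph (CoverSpace hp) M :=
  (hp q).choose

lemma mem_coverLocal_source (q : CoverSpace hp) : q ∈ (coverLocal hp q).source :=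
  (hp q).choose_spec.1

lemma coverLocal_coe (q : CoverSpace hp) : (coverLocal hp q : CoverSpace hp → M) = coverProj hp :=
  (hp q).choose_spec.2.symm

lemma coverProj_coverLocal_symm (q : CoverSpace hp) {y : M} (hy : y ∈ (coverLocal hp q).target) :
    coverProj hp ((coverLocal hp q).symm y) = y := by
  rw [← coverLocal_coe hp q, (coverLocal hp q).right_inv hy]

/-- Around `q`, the chart of the base at the image of `q` is used as a chart, so that the projection
is the identity in these charts. -/
instance : ChartedSpace (Euc n) (CoverSpace hp) where
  atlas := range fun q => (coverLocal hp q).trans (chartAt (Euc n) (coverProj hp q))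
  chartAt q := (coverLocal hp q).trans (chartAt (Euc n) (coverProj hp q))
  mem_chart_source q := by
    simp [mem_coverLocal_source, coverLocal_coe]
  chart_mem_atlas q := mem_range_self q

lemma coverSpace_chartAt (q : CoverSpace hp) : chartAt (Euc n) q
    = (coverLocal hp q).trans (chartAt (Euc n) (coverProj hp q)) := rfl

lemma coverSpace_chartAt_apply (q x : CoverSpace hp) : chartAt (Euc n) q x
    = chartAt (Euc n) (coverProj hp q) (coverProj hp x) := by
  rw [coverSpace_chartAt, OpenPartialHomeomorph.coe_trans, coverLocal_coe]
  rfl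

lemma coverProj_mem_source {q x : CoverSpace hp} (hx : x ∈ (chartAt (Euc n) q).source) :
    coverProj hp x ∈ (chartAt (Euc n) (coverProj hp q)).source := by
  rw [coverSpace_chartAt, OpenPartialHomeomorph.trans_source, coverLocal_coe] at hx
  exact hx.2

lemma coverSpace_target_subset (q : CoverSpace hp) :
    (chartAt (Euc n) q).target ⊆ (chartAt (Euc n) (coverProj hp q)).target := by
  rw [coverSpace_chartAt, OpenPartialHomeomorph.trans_target]
  exact inter_subset_left

lemma coverProj_chartAt_symm {q : CoverSpace hp} {y : Euc n}
    (hy : y ∈ (chartAt (Euc n) q).target) :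
    coverProj hp ((chartAt (Euc n) q).symm y) = (chartAt (Euc n) (coverProj hp q)).symm y := by
  rw [coverSpace_chartAt, OpenPartialHomeomorph.trans_target] at hy
  exact coverProj_coverLocal_symm hp q hy.2

/-- The transition maps are restrictions of those of the base. -/
lemma coverSpace_transition {q q' : CoverSpace hp} {y : Euc n}
    (hy : y ∈ (chartAt (Euc n) q).target) :
    chartAt (Euc n) q' ((chartAt (Euc n) q).symm y)
      = chartAt (Euc n) (coverProj hp q') ((chartAt (Euc n) (coverProj hp q)).symm y) := by
  rw [coverSpace_chartAt_apply, coverProj_chartAt_symm hp hy]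

variable [IsManifold (𝓡 n) ∞ M]

instance : IsManifold (𝓡 n) ∞ (CoverSpace hp) := by
  refine isManifold_of_contDiffOn _ _ _ ?_
  rintro _ _ ⟨q, rfl⟩ ⟨q', rfl⟩
  have hq := chart_mem_atlas (Euc n) (coverProj hp q)
  have hq' := chart_mem_atlas (Euc n) (coverProj hp q')
  have key : ContDiffOn ℝ ∞ (fun y => chartAt (Euc n) q' ((chartAt (Euc n) q).symm y))
      ((chartAt (Euc n) q).symm.trans (chartAt (Euc n) q')).source := by
    intro y hy
    rw [OpenPartialHomeomorph.trans_source] at hy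
    obtain ⟨hy1, hy2⟩ := hy
    have hy1 : y ∈ (chartAt (Euc n) q).target := hy1
    have hy2 : (chartAt (Euc n) q).symm y ∈ (chartAt (Euc n) q').source := hy2
    have h1 := coverProj_mem_source hp hy2
    rw [coverProj_chartAt_symm hp hy1] at h1
    have h2 : ContDiffAt ℝ ∞ (fun y => chartAt (Euc n) (coverProj hp q')
        ((chartAt (Euc n) (coverProj hp q)).symm y)) y := contMDiffAt_iff_contDiffAt.1
      (ContMDiffAt.comp y (contMDiffAt_chart hq' h1)
        (contMDiffAt_chart_symm hq (coverSpace_target_subset hp q hy1)))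
    refine (h2.congr_of_eventuallyEq ?_).contDiffWithinAt
    filter_upwards [(chartAt (Euc n) q).open_target.mem_nhds hy1] with z hz
    exact coverSpace_transition hp hz
  exact key.mono fun y hy => hy.1

lemma contMDiff_coverProj : ContMDiff (𝓡 n) (𝓡 n) ∞ (coverProj hp) := by
  intro q
  rw [contMDiffAt_iff]
  refine ⟨hp.continuous.continuousAt, ?_⟩
  have hq : chartAt (Euc n) q q ∈ (chartAt (Euc n) q).target := mem_chart_target _ q
  refine ContDiffAt.contDiffWithinAt ?_
  refine contDiffAt_id.congr_of_eventuallyEq ?_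
  have : (extChartAt (𝓡 n) q) q = chartAt (Euc n) q q := by simp [mfld_simps]
  rw [this]
  filter_upwards [(chartAt (Euc n) q).open_target.mem_nhds hq] with y hy
  simp only [Function.comp, mfld_simps]
  rw [coverProj_chartAt_symm hp hy, OpenPartialHomeomorph.right_inv _
    (coverSpace_target_subset hp q hy)]

/-- The tangent spaces are identified with the model space through the preferred charts, and these
are the same on both sides. -/
lemma tderiv_coverProj (q : CoverSpace hp) :
    tderiv n (coverProj hp) q = ContinuousLinearMap.id ℝ (Euc n) := by
  have hq : chartAt (Euc n) q q ∈ (chartAt (Euc n) q).target := mem_chart_target _ q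
  have h1 : tderiv n (coverProj hp) q = fderivWithin ℝ (writtenInExtChartAt (𝓡 n) (𝓡 n) q
      (coverProj hp)) (range (𝓡 n)) (extChartAt (𝓡 n) q q) :=
    ((contMDiff_coverProj hp).contMDiffAt.mdifferentiableAt (by simp)).mfderiv
  rw [h1]
  have h2 : writtenInExtChartAt (𝓡 n) (𝓡 n) q (coverProj hp)
      =ᶠ[𝓝 (extChartAt (𝓡 n) q q)] id := by
    have : (extChartAt (𝓡 n) q) q = chartAt (Euc n) q q := by simp [mfld_simps]
    rw [this]
    filter_upwards [(chartAt (Euc n) q).open_target.mem_nhds hq] with y hy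
    simp only [writtenInExtChartAt, Function.comp, mfld_simps]
    rw [coverProj_chartAt_symm hp hy, OpenPartialHomeomorph.right_inv _
      (coverSpace_target_subset hp q hy)]
  have h3 : range (𝓡 n) = univ := by simp
  rw [h3, fderivWithin_univ, h2.fderiv_eq, fderiv_id]

/-- The trivializations of the tangent bundle of the pulled-back manifold are those of the base. -/
lemma coverSpace_trivialization_symm {q₀ q : CoverSpace hp}
    (hq : q ∈ (chartAt (Euc n) q₀).source) (v : Euc n) :
    ((trivializationAt (Euc n) (TangentSpace (𝓡 n)) q₀).symmL ℝ q v : Euc n)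
      = (trivializationAt (Euc n) (TangentSpace (𝓡 n) : M → Type _) (coverProj hp q₀)).symmL ℝ
          (coverProj hp q) v := by
  have h1 := congrArg (fun L : Euc n →L[ℝ] TangentSpace (𝓡 n) q => (L v : Euc n))
    (TangentBundle.symmL_trivializationAt_eq_core (I := 𝓡 n) hq)
  have h2 := congrArg (fun L : Euc n →L[ℝ] TangentSpace (𝓡 n) (coverProj hp q) => (L v : Euc n))
    (TangentBundle.symmL_trivializationAt_eq_core (I := 𝓡 n) (coverProj_mem_source hp hq))
  refine h1.trans (Eq.trans ?_ h2.symm)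
  simp only [tangentBundleCore_coordChange_achart]
  have h3 : range (𝓡 n) = univ := by simp
  rw [h3, fderivWithin_univ, fderivWithin_univ]
  have h4 : extChartAt (𝓡 n) (coverProj hp q₀) (coverProj hp q) = extChartAt (𝓡 n) q₀ q := by
    simp only [mfld_simps]
    rw [coverSpace_chartAt_apply]
  rw [h4]
  have h5 : (extChartAt (𝓡 n) q ∘ (extChartAt (𝓡 n) q₀).symm)
      =ᶠ[𝓝 (extChartAt (𝓡 n) q₀ q)] (extChartAt (𝓡 n) (coverProj hp q) ∘
        (extChartAt (𝓡 n) (coverProj hp q₀)).symm) := by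
    have : (extChartAt (𝓡 n) q₀) q = chartAt (Euc n) q₀ q := by simp [mfld_simps]
    rw [this]
    filter_upwards [(chartAt (Euc n) q₀).open_target.mem_nhds
      ((chartAt (Euc n) q₀).map_source hq)] with y hy
    simp only [Function.comp, mfld_simps]
    exact coverSpace_transition hp hy
  rw [h5.fderiv_eq]
  rfl

/-- The pulled-back Riemannian metric. As the differential of the projection is the identity of the
model space, its inner product at `q` is that of the base at the image of `q`. -/
def coverMetric (g : Metric n M) : Metric n (CoverSpace hp) where
  inner q := g.inner (coverProj hp q)
  symm q := g.symm (coverProj hp q)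
  pos q := g.pos (coverProj hp q)
  isVonNBounded q := g.isVonNBounded (coverProj hp q)
  contMDiff := by
    intro q₀
    rw [contMDiffAt_hom_bundle]
    refine ⟨contMDiffAt_id, ?_⟩
    have h := ((contMDiffAt_hom_bundle _).1 (g.contMDiff.contMDiffAt (x := coverProj hp q₀))).2
    refine (ContMDiffAt.comp q₀ h (contMDiff_coverProj hp).contMDiffAt).congr_of_eventuallyEq ?_
    filter_upwards [(chartAt (Euc n) q₀).open_source.mem_nhds (mem_chart_source _ q₀)] with q hq
    ext v w
    have hq' := coverProj_mem_source hp hq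
    -- The metric in the trivialization of the tangent bundle around `x₀`.
    have hb : ∀ (K : Type u) [TopologicalSpace K] [ChartedSpace (Euc n) K] [IsManifold (𝓡 n) ∞ K]
        (x₀ x : K), x ∈ (chartAt (Euc n) x₀).source →
        ∀ (φ : TangentSpace (𝓡 n) x →L[ℝ] TangentSpace (𝓡 n) x →L[ℝ] ℝ),
        ContinuousLinearMap.inCoordinates (Euc n) (TangentSpace (𝓡 n)) (Euc n →L[ℝ] ℝ)
          (fun x : K => TangentSpace (𝓡 n) x →L[ℝ] ℝ) x₀ x x₀ x φ v w
        = φ ((trivializationAt (Euc n) (TangentSpace (𝓡 n)) x₀).symmL ℝ x v)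
          ((trivializationAt (Euc n) (TangentSpace (𝓡 n)) x₀).symmL ℝ x w) := by
      intro K _ _ _ x₀ x hx φ
      have := inCoordinates_apply_eq₂ (𝕜 := ℝ) (F₁ := Euc n) (F₂ := Euc n) (F₃ := ℝ)
        (E₁ := fun x : K => TangentSpace (𝓡 n) x) (E₂ := fun x : K => TangentSpace (𝓡 n) x)
        (E₃ := Bundle.Trivial K ℝ) (x₀ := x₀) (x := x) (ϕ := φ) (v := v) (w := w) hx hx (mem_univ x)
      refine this.trans ?_
      rw [Bundle.Trivialization.symmL_apply _ hx, Bundle.Trivialization.symmL_apply _ hx]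
      simp
    refine (hb (CoverSpace hp) q₀ q hq _).trans ((hb M _ _ hq' _).trans ?_).symm
    exact (congrArg₂ (fun a b : Euc n => metricAt g (coverProj hp q) a b)
      (coverSpace_trivialization_symm hp hq v) (coverSpace_trivialization_symm hp hq w)).symm

end CoverSpace

/-! ### Local isometries and the injectivity radius -/

section LocalIsometry

variable {n : ℕ} {M : Type u} [TopologicalSpace M] [ChartedSpace (Euc n) M]
  [IsManifold (𝓡 n) ∞ M]

lemma isLocalIsometry_coverProj {N : Type u} [TopologicalSpace N] {p : N → M}
    (hp : IsLocalHomeomorph p) (g : Metric n M) :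
    IsLocalIsometry (coverMetric hp g) g (coverProj hp) := by
  refine ⟨contMDiff_coverProj hp, fun q v w => ?_⟩
  change metricAt g (coverProj hp q) (tderiv n (coverProj hp) q v) (tderiv n (coverProj hp) q w)
    = metricAt g (coverProj hp q) v w
  rw [tderiv_coverProj]
  rfl

variable {N : Type u} [TopologicalSpace N] [ChartedSpace (Euc n) N] [IsManifold (𝓡 n) ∞ N]

/-- A local isometry intertwines the exponential maps. -/
lemma IsLocalIsometry.comp_expMap [T2Space M] [CompactSpace M] [T2Space N] [CompactSpace N]
    {gN : Metric n N} {g : Metric n M} {p : N → M} (hp : IsLocalIsometry gN g p) (q : N)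
    (v : Euc n) : p (expMap gN q v) = expMap g (p q) (tderiv n p q v) := by
  obtain ⟨h1, h2, h3⟩ := isGeodesic_expMap gN q v
  have h4 : IsGeodesic g (fun t : ℝ => p (expMap gN q (t • v))) :=
    isGeodesic_iff.2 fun t => (isGeodesic_iff.1 h1 t).map hp
  have h5 := expMap_eq h4
  have h6 : velocity n (fun t : ℝ => p (expMap gN q (t • v))) 0 = tderiv n p q v := by
    have h7 := velocity_comp (n := n) (f := p) (c := fun t : ℝ => expMap gN q (t • v)) (t := 0)
      (hp.1.contMDiffAt.mdifferentiableAt (by simp)) (h1.1.contMDiffAt.mdifferentiableAt (by simp))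
    rw [h3, zero_smul, h2] at h7
    exact h7
  rw [h6] at h5
  simp only [zero_smul, one_smul, h2] at h5
  exact h5.symm

lemma speedSq_expMap [T2Space M] [CompactSpace M] (g : Metric n M) (p : M) (v : Euc n) (s : ℝ) :
    speedSq g (fun t : ℝ => expMap g p (t • v)) s = tnorm g p v ^ 2 := by
  obtain ⟨h1, h2, h3⟩ := isGeodesic_expMap g p v
  have h := speedSq_eq_of_isGeodesicAt (a := min s 0 - 1) (b := max s 0 + 1) (s := s) (t := 0)
    (fun r _ => isGeodesic_iff.1 h1 r)
    ⟨by linarith [min_le_left s 0], by linarith [le_max_left s 0]⟩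
    ⟨by linarith [min_le_right s 0], by linarith [le_max_right s 0]⟩
  rw [h, tnorm_sq, speedSq, h3]
  simp only [zero_smul, h2]

/-- An injective nonsingular exponential map on a ball is a diffeomorphism onto an open set. -/
lemma expIsDiffeoOnBall_of_injOn [T2Space M] [CompactSpace M] {g : Metric n M} {p : M} {r : ℝ≥0}
    (hd : ∀ v, Function.Injective (tderiv n (expMap g p) v))
    (hinj : InjOn (expMap g p) (tangentBall g p r)) : ExpIsDiffeoOnBall g p r := by
  have hF := contMDiff_expMap g p
  have hopen : IsOpen (tangentBall g p r) := isOpen_lt (continuous_tnorm g p) continuous_const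
  set Φ : PartialEquiv (Euc n) M := hinj.toPartialEquiv _ _
  refine ⟨{ toPartialEquiv := Φ
            open_source := hopen
            open_target := (isLocalHomeomorph_of_injective hF hd).isOpenMap _ hopen
            contMDiffOn_toFun := hF.contMDiffOn
            contMDiffOn_invFun := ?_ }, rfl, fun _ _ => rfl⟩
  rintro _ ⟨v, hv, rfl⟩
  obtain ⟨q, hq, hFq, hsm⟩ := exists_localInverse hF (hd v)
  refine (hsm.congr_of_eventuallyEq ?_).contMDiffWithinAt
  have hv' : expMap g p v = q v := hFq hq
  have hU : q.symm ⁻¹' tangentBall g p r ∈ 𝓝 (expMap g p v) := by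
    rw [hv']
    refine (q.continuousAt_symm (q.map_source hq)).preimage_mem_nhds ?_
    rw [q.left_inv hq]
    exact hopen.mem_nhds hv
  have hT : q.target ∈ 𝓝 (expMap g p v) := by
    rw [hv']
    exact q.open_target.mem_nhds (q.map_source hq)
  filter_upwards [hU, hT] with y hy hyT
  have h1 : expMap g p (q.symm y) = y := by rw [hFq (q.map_target hyT), q.right_inv hyT]
  have h2 : Φ.symm (expMap g p (q.symm y)) = q.symm y := Φ.left_inv hy
  rwa [h1] at h2

lemma ofReal_le_injectivityRadius {g : Metric n M} {R : ℝ}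
    (h : ∀ p, ExpIsDiffeoOnBall g p R.toNNReal) : ENNReal.ofReal R ≤ injectivityRadius g :=
  le_iInf fun p => le_sSup ⟨R.toNNReal, rfl, h p⟩

end LocalIsometry

/-! ### Large finite coverings -/

section Conclusion

variable {n : ℕ} {M : Type u} [TopologicalSpace M] [ChartedSpace (Euc n) M]
  [IsManifold (𝓡 n) ∞ M] [T2Space M] [CompactSpace M]

/-- By compactness, some closed ball in the tangent space is mapped onto the manifold. -/
lemma exists_image_tnorm_le_eq_univ [ConnectedSpace M] {g : Metric n M}
    (hg : NoConjugatePoints g) (p : M) :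
    ∃ r, expMap g p '' {v | tnorm g p v ≤ r} = univ := by
  have hsurj := surjective_of_isCoveringMap (isCoveringMap_expMap hg p)
  have hop : IsOpenMap (expMap g p) := (isCoveringMap_expMap hg p).isLocalHomeomorph.isOpenMap
  obtain ⟨r, hr⟩ := isCompact_univ.elim_directed_cover
    (fun r : ℝ => expMap g p '' {v | tnorm g p v < r})
    (fun r => hop _ (isOpen_lt (continuous_tnorm g p) continuous_const))
    (fun y _ => by
      obtain ⟨v, rfl⟩ := hsurj y
      exact mem_iUnion.2 ⟨tnorm g p v + 1, v, lt_add_one (tnorm g p v), rfl⟩)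
    (Monotone.directed_le fun r s hrs => image_mono fun v hv => lt_of_lt_of_le hv hrs)
  exact ⟨r, univ_subset_iff.1 (hr.trans (image_mono fun v (hv : tnorm g p v < r) => hv.le))⟩

/-- If a covering `π` of a covering space `N` of `M` by the tangent space is injective on the ball
of radius `r₀ + R` up to deck transformations, and the ball of radius `r₀` is mapped onto `M`, then
the exponential maps of `N` are injective on balls of radius `R`: they lift to the tangent space,
where the lifts of geodesics of length at most `R` which start in the ball of radius `r₀` stay in
the ball of radius `r₀ + R`. -/
lemma injOn_expMap_of_covering {g : Metric n M} (hg : NoConjugatePoints g) {x₀ : M}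
    {N : Type u} [TopologicalSpace N] [ChartedSpace (Euc n) N] [IsManifold (𝓡 n) ∞ N] [T2Space N]
    [CompactSpace N] {gN : Metric n N} {p : N → M} {π : Euc n → N} {q : N} {R r₀ : ℝ}
    (hpe : ∀ v, p (expMap gN q v) = expMap g (p q) v)
    (hπ : IsCoveringMap π) (hπs : Function.Surjective π) (hpπ : p ∘ π = expMap g x₀)
    (hr₀ : expMap g x₀ '' {v | tnorm g x₀ v ≤ r₀} = univ)
    (hφ : ∀ a b, expMap g x₀ a = expMap g x₀ b → ∃ φ : Euc n → Euc n, Continuous φ ∧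
      expMap g x₀ ∘ φ = expMap g x₀ ∧ φ a = b ∧ ∀ x y, π x = π y → tnorm g x₀ (φ x) ≤ r₀ + R →
      tnorm g x₀ (φ y) ≤ r₀ + R → x = y) :
    InjOn (expMap gN q) {v | tnorm g (p q) v ≤ R} := by
  obtain ⟨a, ha⟩ := hπs q
  have h0 : expMap gN q 0 = q := (isGeodesic_expMap gN q 0).2.1
  obtain ⟨Ψ, ⟨hΨ0, hΨ⟩, -⟩ := hπ.existsUnique_continuousMap_lifts
    ⟨expMap gN q, (contMDiff_expMap gN q).continuous⟩ 0 a (by simpa [h0] using ha)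
  have hΨ : ∀ v, π (Ψ v) = expMap gN q v := congrFun hΨ
  have hfΨ : ∀ v, expMap g x₀ (Ψ v) = expMap g (p q) v := fun v => by
    rw [← hpπ, Function.comp_apply, hΨ, hpe]
  have hΨi : Function.Injective Ψ := injective_of_comp_eq (isCoveringMap_expMap hg x₀)
    (isCoveringMap_expMap hg (p q)) Ψ.continuous (funext hfΨ)
  obtain ⟨b, hb, hfb⟩ : p q ∈ expMap g x₀ '' {v | tnorm g x₀ v ≤ r₀} := hr₀ ▸ mem_univ _
  have hfa : expMap g x₀ a = expMap g x₀ b := by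
    rw [hfb, ← hpπ, Function.comp_apply, ha]
  obtain ⟨φ, hφc, hfφ, hφa, hφi⟩ := hφ a b hfa
  have hbound : ∀ v, tnorm g (p q) v ≤ R → tnorm g x₀ (φ (Ψ v)) ≤ r₀ + R := by
    intro v hv
    have hgeo := (isGeodesic_expMap g (p q) v).1
    have h := tnorm_lift_le hg (p := x₀) (c := fun t : ℝ => expMap g (p q) (t • v))
      (x := fun t : ℝ => φ (Ψ (t • v))) (T := 1) (L := tnorm g (p q) v) zero_le_one
      (Real.sqrt_nonneg _) (fun s _ => hgeo.1.contMDiffAt.mdifferentiableAt (by simp))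
      (fun s _ => (speedSq_expMap g (p q) v s).le)
      (hφc.comp (Ψ.continuous.comp (by fun_prop))).continuousOn
      (fun s _ => (congrFun hfφ _).trans (hfΨ _))
    simp only [one_smul, zero_smul, hΨ0, hφa, mul_one] at h
    exact h.trans (add_le_add hb hv)
  intro v hv w hw hvw
  refine hΨi (hφi _ _ ?_ (hbound v hv) (hbound w hw))
  rw [hΨ, hΨ, hvw]

end Conclusion

end RiemGeom

end

theorem mainTheorem8 {n : ℕ} {M : Type u} [TopologicalSpace M] [T2Space M] [CompactSpace M]
    [ConnectedSpace M] [ChartedSpace (EuclideanSpace ℝ (Fin n)) M] [IsManifold (𝓡 n) ∞ M]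
    (g : RiemGeom.Metric n M) (hconj : RiemGeom.NoConjugatePoints g)
    (x₀ : M) (hπ : Group.ResiduallyFinite (FundamentalGroup M x₀))
    (R : ℝ) (hR : 0 < R) :
    ∃ (N : Type u) (_ : TopologicalSpace N) (_ : ChartedSpace (EuclideanSpace ℝ (Fin n)) N)
      (_ : IsManifold (𝓡 n) ∞ N) (gN : RiemGeom.Metric n N) (p : N → M),
      T2Space N ∧ CompactSpace N ∧ ConnectedSpace N ∧
      IsCoveringMap p ∧ Function.Surjective p ∧ (∀ y : M, (p ⁻¹' {y}).Finite) ∧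
      RiemGeom.IsLocalIsometry gN g p ∧
      ENNReal.ofReal R ≤ RiemGeom.injectivityRadius gN := by
  open RiemGeom in
  have hf := isCoveringMap_expMap hconj x₀
  obtain ⟨r₀, hr₀⟩ := exists_image_tnorm_le_eq_univ hconj x₀
  obtain ⟨N, _, π, p, hN₁, hN₂, hN₃, hπc, hp, hπs, hpπ, hφ⟩ := exists_finite_covering hf
    (surjective_of_isCoveringMap hf) x₀ (isCompact_tnorm_le g x₀ (r₀ + R)) (by
      refine Set.univ_subset_iff.1 (hr₀ ▸ Set.image_mono fun v (hv : tnorm g x₀ v ≤ r₀) => ?_)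
      exact hv.trans (le_add_of_nonneg_right hR.le))
  have hl : IsLocalHomeomorph p := hp.isLocalHomeomorph
  have hiso := isLocalIsometry_coverProj hl g
  have hexp : ∀ (q : CoverSpace hl) (v : Euc n),
      coverProj hl (expMap (coverMetric hl g) q v) = expMap g (coverProj hl q) v := fun q v => by
    rw [hiso.comp_expMap, tderiv_coverProj]
    rfl
  refine ⟨CoverSpace hl, inferInstance, inferInstance, inferInstance, coverMetric hl g,
    coverProj hl, inferInstance, inferInstance, inferInstance, hp,
    Function.Surjective.of_comp (g := π) (hpπ ▸ surjective_of_isCoveringMap hf),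
    finite_fiber_of_isCoveringMap (E := N) hp, hiso, ofReal_le_injectivityRadius fun q => ?_⟩
  refine expIsDiffeoOnBall_of_injOn (fun v => ?_) ?_
  · -- The differential of `exp_q` is that of the exponential map of the base.
    have h := tderiv_comp (n := n) (f := expMap (coverMetric hl g) q) (h := coverProj hl) (x := v)
      (hiso.1.contMDiffAt.mdifferentiableAt (by simp))
      ((contMDiff_expMap (coverMetric hl g) q).contMDiffAt.mdifferentiableAt (by simp))
    rw [tderiv_coverProj, ContinuousLinearMap.id_comp,
      show coverProj hl ∘ expMap (coverMetric hl g) q = expMap g (coverProj hl q) from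
        funext (hexp q)] at h
    rw [← h]
    exact hconj (coverProj hl q) v
  · refine (injOn_expMap_of_covering hconj (hexp q) hπc hπs hpπ hr₀ hφ).mono fun v hv => ?_
    exact (lt_of_lt_of_eq hv (Real.coe_toNNReal R hR.le)).le
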